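/- Let $A_{\mathrm{cl}}$ be the classical mod 2 Steenrod algebra and $\mathrm{Ext}_{\mathrm{cl}}=\mathrm{Ext}_{A_{\mathrm{cl}}}(\mathbb F_2,\mathbb F_2)$ its cohomology ring, bigraded by $(s,f)$, where $f$ is the Adams filtration (homological degree), $s$ is the stem, and $s+f$ is the internal degree. Let $\mathbb M_2=\mathbb F_2[\tau]$, with $\tau$ of bidegree $(0,1)$, be the mod 2 motivic cohomology of $\mathbb C$, and let $A$ be the mod 2 motivic Steenrod algebra over $\mathbb C$, that is, the bigraded $\mathbb M_2$-algebra generated by elements $\mathrm{Sq}^{2k}$ of bidegree $(2k,k)$ and $\mathrm{Sq}^{2k-1}$ of bidegree $(2k-1,k-1)$, $k\ge 1$ (with $\mathrm{Sq}^0=1$), subject to the motivic Adem relations $$\mathrm{Sq}^a\,\mathrm{Sq}^b=\sum_c\binom{b-1-c}{a-2c}\,\tau^{?}\,\mathrm{Sq}^{a+b-c}\,\mathrm{Sq}^c\qquad(0<a<2b),$$ where $?\in\{0,1\}$ is the exponent that balances the weights (the second degrees). Let $\mathrm{Ext}=\mathrm{Ext}_A(\mathbb M_2,\mathbb M_2)$,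 trigraded by $(s,f,w)$, where $f$ is the Adams filtration and $(s+f,w)$ is the internal bidegree. Then there is an isomorphism $\varphi$ of rings from $\mathrm{Ext}_{\mathrm{cl}}$ onto the subalgebra of $\mathrm{Ext}$ consisting of the elements in degrees $(s,f,w)$ with $s+f-2w=0$, such that: 1. an element $x$ of $\mathrm{Ext}_{\mathrm{cl}}$ is homogeneous of degree $(s,f)$ if and only if $\varphi(x)$ is homogeneous of degree $(2s+f,\,f,\,s+f)$; 2. $\varphi$ preserves the algebraic squaring operations: $\varphi(\mathrm{Sq}^r x)=\mathrm{Sq}^r\varphi(x)$ for all $x$ of Adams filtration $f$ and all $0\le r\le f$. Here $\mathrm{Sq}^r$ raises the Adams filtration by $r$, doubles the internal degrees, and is represented by $z\cup_{f-r}z$ for a cocycle $z$ in the cobar complex representing $x$; 3. $\varphi$ preserves Massey products: for all $n\ge 3$ and all homogeneous $x_0,\dots,x_{n-1}$ in $\mathrm{Ext}_{\mathrm{cl}}$, the set $\varphi(\langle x_0,\dots,x_{n-1}\rangle)$ is equal to $\langle\varphi(x_0),\dots,\varphi(x_{n-1})\rangle$, formed in $\mathrm{Ext}$; in particular one of them is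 defined (nonempty) if and only if the other is. -/

import Mathlib

open Polynomial TensorProduct

/-! ### Adem relations and the Cartan formula

The next results only serve to show that the coproduct of the Steenrod algebra, which is given on the
generators by the Cartan formula, is compatible with the Adem relations. The relations are encoded in
the generating function identity of Bullett and Macdonald. -/

namespace Steenrod

/-- `e` satisfies the Adem relations of total degree `n`, `e a` standing for `Sq^a Sq^(n-a)`. -/
def AdemLin {V : Type*} [AddCommGroup V] (n : ℕ) (e : ℕ → V) : Prop :=
  ∀ a b : ℕ, a + b = n → a < 2 * b →
    e a = ∑ c ∈ Finset.range (a / 2 + 1), (b - 1 - c).choose (a - 2 * c) • e (a + b - c)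

/-- `(x ^ 2 + x) ^ a` -/
noncomputable def bmL (a : ℕ) : (ZMod 2)[X] := (X ^ 2 + X) ^ a
/-- `(1 + x) ^ a x ^ (2 (n - a))` -/
noncomputable def bmR (n a : ℕ) : (ZMod 2)[X] := (1 + X) ^ a * X ^ (2 * (n - a))
/-- `x ^ a (1 + x) ^ (2 (n - a))` -/
noncomputable def bmK (n a : ℕ) : (ZMod 2)[X] := X ^ a * (1 + X) ^ (2 * (n - a))

theorem ps_inv : (PowerSeries.mk 1 : PowerSeries (ZMod 2)) * (1 + PowerSeries.X) = 1 := by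
  have := PowerSeries.mk_one_mul_one_sub_eq_one (ZMod 2)
  have h2 : (PowerSeries.X : PowerSeries (ZMod 2)) = -PowerSeries.X := by
    ext n
    simp only [map_neg]
    exact (CharTwo.neg_eq _).symm
  rw [h2, ← sub_eq_add_neg]
  exact this

theorem coeff_bmL (a i : ℕ) :
    PowerSeries.coeff a ((bmL i : PowerSeries (ZMod 2)) * (PowerSeries.mk 1) ^ (a + 1))
      = if i = a then 1 else 0 := by
  have h1 : (PowerSeries.mk 1 : PowerSeries (ZMod 2)) * (1 + PowerSeries.X) = 1 := by
    exact ps_inv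
  have h2 : ((bmL i : (ZMod 2)[X]) : PowerSeries (ZMod 2))
      = PowerSeries.X ^ i * (1 + PowerSeries.X) ^ i := by
    simp only [bmL, Polynomial.coe_pow, Polynomial.coe_add, Polynomial.coe_X]
    rw [← mul_pow]; ring
  rw [h2, mul_assoc, PowerSeries.coeff_X_pow_mul']
  by_cases hia : i ≤ a
  · obtain ⟨m, rfl⟩ := Nat.exists_eq_add_of_le hia
    have h3 : ((1 : PowerSeries (ZMod 2)) + PowerSeries.X) ^ i * (PowerSeries.mk 1) ^ (i + m + 1)
        = (PowerSeries.mk 1) ^ (m + 1) := by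
      rw [add_assoc, pow_add, ← mul_assoc, ← mul_pow, mul_comm (1 + PowerSeries.X), h1]; simp
    rw [if_pos hia, h3, PowerSeries.mk_one_pow_eq_mk_choose_add, PowerSeries.coeff_mk]
    rcases Nat.eq_zero_or_pos m with rfl | hm
    · simp
    · have := Nat.two_dvd_centralBinom_of_one_le hm
      rw [if_neg (by omega), show i + m - i = m by omega, ← two_mul]
      exact (ZMod.natCast_eq_zero_iff _ 2).2 this
  · rw [if_neg hia, if_neg (by omega)]

theorem coeff_bmR (a b c : ℕ) (hab : a < 2 * b) (hc : c ≤ a + b) :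
    PowerSeries.coeff a
      ((bmR (a + b) (a + b - c) : PowerSeries (ZMod 2)) * (PowerSeries.mk 1) ^ (a + 1))
      = if c ∈ Finset.range (a / 2 + 1) then (((b - 1 - c).choose (a - 2 * c) : ℕ) : ZMod 2)
        else 0 := by
  have h1 : (PowerSeries.mk 1 : PowerSeries (ZMod 2)) * (1 + PowerSeries.X) = 1 := by
    exact ps_inv
  have h2 : ((bmR (a + b) (a + b - c) : (ZMod 2)[X]) : PowerSeries (ZMod 2))
      = PowerSeries.X ^ (2 * c) * (1 + PowerSeries.X) ^ (a + b - c) := by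
    simp only [bmR, Polynomial.coe_pow, Polynomial.coe_add, Polynomial.coe_X, Polynomial.coe_mul,
      Polynomial.coe_one]
    rw [mul_comm, show a + b - (a + b - c) = c by omega]
  rw [h2, mul_assoc, PowerSeries.coeff_X_pow_mul']
  by_cases hca : 2 * c ≤ a
  · rw [if_pos hca, if_pos (by simp; omega)]
    have h3 : ((1 : PowerSeries (ZMod 2)) + PowerSeries.X) ^ (a + b - c)
        * (PowerSeries.mk 1) ^ (a + 1)
          = (((1 + X) ^ (b - 1 - c) : (ZMod 2)[X]) : PowerSeries (ZMod 2)) := by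
      rw [show a + b - c = (b - 1 - c) + (a + 1) by omega, pow_add, mul_assoc, ← mul_pow,
        mul_comm (1 + PowerSeries.X), h1]
      simp
    rw [h3, Polynomial.coeff_coe, Polynomial.coeff_one_add_X_pow]
  · rw [if_neg hca, if_neg (by simp; omega)]

/-- The functional `f ↦ coeff_a (f (1+x)^(-a-1))`. -/
noncomputable def resFun (a : ℕ) : (ZMod 2)[X] →ₗ[ZMod 2] ZMod 2 where
  toFun f := PowerSeries.coeff a ((f : PowerSeries (ZMod 2)) * (PowerSeries.mk 1) ^ (a + 1))
  map_add' f g := by simp [add_mul]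
  map_smul' c f := by
    rw [smul_eq_C_mul, Polynomial.coe_mul, Polynomial.coe_C, mul_assoc, PowerSeries.coeff_C_mul]
    rfl

/-- The difference of the two sides of the generating function identity in degree `n`. -/
noncomputable def bmF (n : ℕ) (e : ℕ → ZMod 2) : (ZMod 2)[X] :=
  ∑ a ∈ Finset.range (n + 1), e a • (bmL a + bmR n a)

theorem resFun_bmF (a b : ℕ) (hab : a < 2 * b) (e : ℕ → ZMod 2) :
    resFun a (bmF (a + b) e)
      = e a + ∑ c ∈ Finset.range (a / 2 + 1), (b - 1 - c).choose (a - 2 * c) • e (a + b - c) := by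
  have hsplit : bmF (a + b) e = ∑ i ∈ Finset.range (a + b + 1), e i • bmL i
      + ∑ c ∈ Finset.range (a + b + 1), e (a + b - c) • bmR (a + b) (a + b - c) := by
    rw [bmF]
    simp only [smul_add]
    rw [Finset.sum_add_distrib]
    congr 1
    rw [← Finset.sum_range_reflect]
    rfl
  have hR : ∀ i, resFun a (bmL i) = if i = a then 1 else 0 := fun i => coeff_bmL a i
  rw [hsplit, map_add, map_sum, map_sum]
  simp only [map_smul, hR]
  congr 1
  · simp
  · have h1 : ∀ c ∈ Finset.range (a + b + 1),
        e (a + b - c) • resFun a (bmR (a + b) (a + b - c))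
          = if c ∈ Finset.range (a / 2 + 1) then
            (b - 1 - c).choose (a - 2 * c) • e (a + b - c) else 0 := by
      intro c hc
      have h2 : resFun a (bmR (a + b) (a + b - c)) = _ :=
        coeff_bmR a b c hab (by simp at hc; omega)
      rw [h2]
      split_ifs
      · simp [mul_comm]
      · simp
    rw [Finset.sum_congr rfl h1, ← Finset.sum_filter]
    refine Finset.sum_congr ?_ fun _ _ => rfl
    ext c
    simp only [Finset.mem_filter, Finset.mem_range]
    omega

theorem ademLin_of_bmF {n : ℕ} {e : ℕ → ZMod 2} (h : bmF n e = 0) : AdemLin n e := by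
  rintro a b rfl hab
  have := resFun_bmF a b hab e
  rw [h, map_zero] at this
  exact CharTwo.add_eq_zero.1 this.symm

theorem coeff_bmF_of_adem {n : ℕ} {e : ℕ → ZMod 2} (h : AdemLin n e) (a : ℕ)
    (ha : 3 * a < 2 * n) : (bmF n e).coeff a = 0 := by
  induction a using Nat.strong_induction_on with
  | _ a ih =>
    obtain ⟨b, rfl⟩ := Nat.exists_eq_add_of_le (show a ≤ n by omega)
    have h1 := resFun_bmF a b (by omega) e
    rw [← h a b rfl (by omega), CharTwo.add_self_eq_zero] at h1
    have h2 : PowerSeries.coeff a (((bmF (a + b) e : (ZMod 2)[X]) : PowerSeries (ZMod 2))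
        * (PowerSeries.mk 1) ^ (a + 1)) = 0 := h1
    rw [PowerSeries.coeff_mul, Finset.sum_eq_single (a, 0)] at h2
    · simpa using h2
    · rintro ⟨i, j⟩ hij hne
      replace hij : i + j = a := Finset.HasAntidiagonal.mem_antidiagonal.1 hij
      have : i < a := by
        rcases Nat.lt_or_ge i a with h | h
        · exact h
        · exact absurd (Prod.ext (by simp only; omega) (by simp only; omega)) hne
      rw [Polynomial.coeff_coe, ih i this (by omega), zero_mul]
    · simp

theorem natDegree_bmL (n a : ℕ) (ha : a ≤ n) : (bmL a).natDegree ≤ 2 * n := by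
  unfold bmL
  have : ((X : (ZMod 2)[X]) ^ 2 + X).natDegree ≤ 2 := by compute_degree
  exact (natDegree_pow_le_of_le a this).trans (by omega)

theorem natDegree_oneX : ((1 : (ZMod 2)[X]) + X).natDegree ≤ 1 := by compute_degree

theorem natDegree_bmR (n a : ℕ) (ha : a ≤ n) : (bmR n a).natDegree ≤ 2 * n := by
  unfold bmR
  refine (natDegree_mul_le_of_le (natDegree_pow_le_of_le a natDegree_oneX)
    (natDegree_X_pow_le _)).trans (by omega)

theorem natDegree_bmK (n a : ℕ) (ha : a ≤ n) : (bmK n a).natDegree ≤ 2 * n := by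
  unfold bmK
  refine (natDegree_mul_le_of_le (natDegree_X_pow_le _)
    (natDegree_pow_le_of_le _ natDegree_oneX)).trans (by omega)

theorem reflect_oneX : reflect 1 ((1 : (ZMod 2)[X]) + X) = 1 + X := by
  rw [reflect_add, reflect_one_X, reflect_one]; ring

theorem reflect_oneX_pow (m : ℕ) : reflect m (((1 : (ZMod 2)[X]) + X) ^ m) = (1 + X) ^ m := by
  induction m with
  | zero => simp
  | succ m ih =>
    rw [pow_succ, reflect_mul _ _ ((natDegree_pow_le_of_le m natDegree_oneX).trans (by omega))
      natDegree_oneX, ih, reflect_oneX]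

theorem reflect_Xpow (N m : ℕ) (h : m ≤ N) :
    reflect N ((X : (ZMod 2)[X]) ^ m) = X ^ (N - m) := by
  rw [reflect_monomial, revAt_le h]

theorem reflect_bmL (n a : ℕ) (ha : a ≤ n) : reflect (2 * n) (bmL a) = bmR n a := by
  have h : bmL a = (1 + X) ^ a * X ^ a := by
    rw [bmL, ← mul_pow]; ring
  obtain ⟨b, rfl⟩ := Nat.exists_eq_add_of_le ha
  rw [h, show 2 * (a + b) = a + (a + 2 * b) by ring,
    reflect_mul _ _ ((natDegree_pow_le_of_le a natDegree_oneX).trans (by omega))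
      ((natDegree_X_pow_le _).trans (by omega)), reflect_oneX_pow, reflect_Xpow _ _ (by omega), bmR]
  congr 2; omega

theorem reflect_bmK (n a : ℕ) (ha : a ≤ n) : reflect (2 * n) (bmK n a) = bmK n a := by
  obtain ⟨b, rfl⟩ := Nat.exists_eq_add_of_le ha
  rw [bmK, show 2 * (a + b) = (2 * a) + (2 * b) by ring, show 2 * (a + b - a) = 2 * b by omega,
    reflect_mul _ _ ((natDegree_X_pow_le _).trans (by omega))
      ((natDegree_pow_le_of_le _ natDegree_oneX).trans (by omega)), reflect_oneX_pow,
      reflect_Xpow _ _ (by omega)]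
  congr 2; omega

theorem comp_bmL (a : ℕ) : (bmL a).comp (1 + X) = bmL a := by
  have h : ((1 : (ZMod 2)[X]) + X) ^ 2 + (1 + X) = X ^ 2 + X := by
    have h2 : ((1 : (ZMod 2)[X]) + X) ^ 2 + (1 + X) = X ^ 2 + X + ((1 + X) + (1 + X)) := by ring
    rw [h2, CharTwo.add_self_eq_zero, add_zero]
  simp only [bmL, pow_comp, add_comp, X_comp, h]

theorem oneX_comp : ((1 : (ZMod 2)[X]) + X).comp (1 + X) = X := by
  simp only [add_comp, one_comp, X_comp]
  rw [← add_assoc, CharTwo.add_self_eq_zero, zero_add]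

theorem comp_bmR (n a : ℕ) : (bmR n a).comp (1 + X) = bmK n a := by
  simp only [bmR, bmK, mul_comp, pow_comp, oneX_comp, X_comp]

theorem bmF_eq_zero {n : ℕ} {e : ℕ → ZMod 2} (h : AdemLin n e) : bmF n e = 0 := by
  set g : (ZMod 2)[X] := ∑ a ∈ Finset.range (n + 1), e a • bmL a with hg
  set r : (ZMod 2)[X] := ∑ a ∈ Finset.range (n + 1), e a • bmR n a with hr
  set k : (ZMod 2)[X] := ∑ a ∈ Finset.range (n + 1), e a • bmK n a with hk
  have hF : bmF n e = g + r := by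
    simp only [bmF, smul_add, Finset.sum_add_distrib, hg, hr]
  have dg : g.natDegree ≤ 2 * n := natDegree_sum_le_of_forall_le _ _ fun a ha =>
    (natDegree_smul_le _ _).trans (natDegree_bmL n a (by simp at ha; omega))
  have dr : r.natDegree ≤ 2 * n := natDegree_sum_le_of_forall_le _ _ fun a ha =>
    (natDegree_smul_le _ _).trans (natDegree_bmR n a (by simp at ha; omega))
  have dk : k.natDegree ≤ 2 * n := natDegree_sum_le_of_forall_le _ _ fun a ha =>
    (natDegree_smul_le _ _).trans (natDegree_bmK n a (by simp at ha; omega))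
  have rsum : ∀ (u : ℕ → (ZMod 2)[X]), reflect (2 * n) (∑ a ∈ Finset.range (n + 1), e a • u a)
      = ∑ a ∈ Finset.range (n + 1), e a • reflect (2 * n) (u a) := by
    intro u
    induction Finset.range (n + 1) using Finset.induction_on with
    | empty => simp
    | insert a s ha ih =>
      rw [Finset.sum_insert ha, Finset.sum_insert ha, reflect_add, ih, smul_eq_C_mul,
        reflect_C_mul, ← smul_eq_C_mul]
  have rg : reflect (2 * n) g = r := by
    rw [hg, rsum]
    exact Finset.sum_congr rfl fun a ha => by rw [reflect_bmL n a (by simp at ha; omega)]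
  have rr : reflect (2 * n) r = g := by rw [← rg, reflect_reflect]
  have rk : reflect (2 * n) k = k := by
    rw [hk, rsum]
    exact Finset.sum_congr rfl fun a ha => by rw [reflect_bmK n a (by simp at ha; omega)]
  have csum : ∀ (u : ℕ → (ZMod 2)[X]), (∑ a ∈ Finset.range (n + 1), e a • u a).comp (1 + X)
      = ∑ a ∈ Finset.range (n + 1), e a • (u a).comp (1 + X) := by
    intro u
    rw [Polynomial.sum_comp]
    simp only [smul_comp]
  have cg : g.comp (1 + X) = g := by
    rw [hg, csum]
    simp only [comp_bmL]
  have cr : r.comp (1 + X) = k := by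
    rw [hr, csum]
    simp only [comp_bmR]; rfl
  obtain ⟨N, hN1, hN2⟩ : ∃ N, 2 * n ≤ 3 * N ∧ 3 * N ≤ 2 * n + 2 := ⟨(2 * n + 2) / 3, by omega, by omega⟩
  have hX : X ^ N ∣ g + r := by
    rw [← hF, X_pow_dvd_iff]
    intro d hd
    exact coeff_bmF_of_adem h d (by omega)
  have hX1 : (1 + X) ^ N ∣ g + k := by
    obtain ⟨q, hq⟩ := hX
    refine ⟨q.comp (1 + X), ?_⟩
    have := congrArg (fun p => p.comp (1 + X)) hq
    simpa only [add_comp, cg, cr, mul_comp, pow_comp, X_comp] using this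
  have hX2 : (1 + X) ^ N ∣ r + k := by
    by_cases h0 : g + k = 0
    · have : reflect (2 * n) (g + k) = 0 := by rw [h0, reflect_zero]
      rw [reflect_add, rg, rk] at this
      rw [this]; exact dvd_zero _
    obtain ⟨q, hq⟩ := hX1
    have hm : ((1 : (ZMod 2)[X]) + X).Monic := by
      rw [add_comm]; exact monic_X_add_C 1
    have hm1 : ((1 : (ZMod 2)[X]) + X).natDegree = 1 := by
      rw [add_comm]; exact natDegree_X_add_C 1
    have hd : N + q.natDegree ≤ 2 * n := by
      have h1 : (g + k).natDegree ≤ 2 * n := natDegree_add_le_of_degree_le dg dk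
      rw [hq, (hm.pow N).natDegree_mul', hm.natDegree_pow, hm1] at h1
      · omega
      · rintro rfl; exact h0 (by rw [hq, mul_zero])
    refine ⟨reflect (2 * n - N) q, ?_⟩
    have := congrArg (reflect (2 * n)) hq
    rw [reflect_add, rg, rk, show 2 * n = N + (2 * n - N) by omega,
      reflect_mul _ _ ((natDegree_pow_le_of_le N natDegree_oneX).trans (by omega)) (by omega),
      reflect_oneX_pow] at this
    rw [this]
  have hX3 : (1 + X) ^ N ∣ g + r := by
    have := dvd_add hX1 hX2
    rwa [show g + k + (r + k) = g + r + (k + k) by ring, CharTwo.add_self_eq_zero, add_zero] at this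
  have hcop : IsCoprime ((X : (ZMod 2)[X]) ^ N) ((1 + X) ^ N) :=
    IsCoprime.pow ⟨-1, 1, by ring⟩
  obtain ⟨q, hq⟩ := hcop.mul_dvd hX hX3
  rw [hF]
  by_contra hne
  have hmX : ((X : (ZMod 2)[X]) ^ N * (1 + X) ^ N).Monic := by
    refine (monic_X_pow N).mul (Monic.pow ?_ N)
    rw [add_comm]; exact monic_X_add_C 1
  have hq0 : q ≠ 0 := by rintro rfl; exact hne (by rw [hq, mul_zero])
  -- low order vanishing bounds the degree
  have hdeg : (g + r).natDegree + N ≤ 2 * n := by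
    by_contra hlt
    push Not at hlt
    have hd2 : (g + r).natDegree ≤ 2 * n := natDegree_add_le_of_degree_le dg dr
    have hsym : reflect (2 * n) (g + r) = g + r := by rw [reflect_add, rg, rr, add_comm]
    have hc : (g + r).coeff (g + r).natDegree = 0 := by
      conv_lhs => rw [← hsym]
      rw [coeff_reflect, hsym, revAt_le hd2]
      exact (X_pow_dvd_iff.1 hX) _ (by omega)
    exact hne (leadingCoeff_eq_zero.1 hc)
  have hdq : q.natDegree = 0 := by
    have h1 := hmX.natDegree_mul' hq0
    rw [← hq] at h1
    have h2 : ((X : (ZMod 2)[X]) ^ N * (1 + X) ^ N).natDegree = 2 * N := by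
      have hm : ((1 : (ZMod 2)[X]) + X).Monic := by
        rw [add_comm]; exact monic_X_add_C 1
      have hm1 : ((1 : (ZMod 2)[X]) + X).natDegree = 1 := by
        rw [add_comm]; exact natDegree_X_add_C 1
      rw [(monic_X_pow N).natDegree_mul (hm.pow N), natDegree_X_pow, hm.natDegree_pow, hm1]
      ring
    omega
  rw [natDegree_eq_zero] at hdq
  obtain ⟨c, hc⟩ := hdq
  have hinv : (g + r).comp (1 + X) = g + r := by
    rw [hq, ← hc]
    simp only [mul_comp, pow_comp, X_comp, oneX_comp, C_comp]
    ring
  have h1 : g + k = g + r := by rw [← hinv, add_comp, cg, cr]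
  have h2 : k = r := add_left_cancel h1
  have h3 : g = r := by
    have := congrArg (reflect (2 * n)) h2
    rw [rk, rr] at this
    rw [← this, h2]
  exact hne (by rw [h3, CharTwo.add_self_eq_zero])

theorem ademLin_iff (n : ℕ) (e : ℕ → ZMod 2) : AdemLin n e ↔ bmF n e = 0 :=
  ⟨bmF_eq_zero, ademLin_of_bmF⟩

theorem ademLin_iff_coeff {V : Type*} [AddCommGroup V] [Module (ZMod 2) V] (n : ℕ) (e : ℕ → V) :
    AdemLin n e ↔
      ∀ j, ∑ a ∈ Finset.range (n + 1), (bmL a + bmR n a).coeff j • e a = 0 := by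
  have h1 : AdemLin n e ↔ ∀ f : Module.Dual (ZMod 2) V, AdemLin n (fun a => f (e a)) := by
    constructor
    · intro h f a b hab hb
      simp only [h a b hab hb, map_sum, map_nsmul]
    · intro h a b hab hb
      rw [← sub_eq_zero, ← Module.forall_dual_apply_eq_zero_iff (ZMod 2)]
      intro f
      have : f (e a) = _ := h f a b hab hb
      rw [map_sub, sub_eq_zero, this]
      simp only [map_sum, map_nsmul]
  rw [h1]
  simp only [ademLin_iff]
  constructor
  · intro h j
    rw [← Module.forall_dual_apply_eq_zero_iff (ZMod 2)]
    intro f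
    have := congrArg (fun p => p.coeff j) (h f)
    simp only [bmF, finsetSum_coeff, coeff_smul, coeff_zero] at this
    rw [← this, map_sum]
    exact Finset.sum_congr rfl fun a _ => by rw [map_smul, smul_eq_mul, smul_eq_mul, mul_comm]
  · intro h f
    ext j
    have := congrArg f (h j)
    simp only [bmF, finsetSum_coeff, coeff_smul, coeff_zero]
    rw [map_zero, map_sum] at this
    rw [← this]
    exact Finset.sum_congr rfl fun a _ => by rw [map_smul, smul_eq_mul, smul_eq_mul, mul_comm]

section Seq
variable {R : Type*} [Ring R] [Algebra (ZMod 2) R]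

/-- The generating function of `s` at `z`. -/
noncomputable def bmP (s : ℕ → R) (z : (ZMod 2)[X]) : PowerSeries R[X] :=
  PowerSeries.mk fun a => C (s a) * (z ^ a).map (algebraMap (ZMod 2) R)

theorem map_comm (z : (ZMod 2)[X]) (p : R[X]) :
    z.map (algebraMap (ZMod 2) R) * p = p * z.map (algebraMap (ZMod 2) R) := by
  induction z using Polynomial.induction_on' with
  | add p q hp hq => rw [Polynomial.map_add, add_mul, mul_add, hp, hq]
  | monomial n a =>
    have h : C (algebraMap (ZMod 2) R a) * p = p * C (algebraMap (ZMod 2) R a) := by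
      ext j
      rw [coeff_C_mul, coeff_mul_C, Algebra.commutes]
    rw [map_monomial, ← C_mul_X_pow_eq_monomial, mul_assoc, X_pow_mul, ← mul_assoc, ← mul_assoc, h]

theorem coeff_bmP_mul (s t : ℕ → R) (z w : (ZMod 2)[X]) (n : ℕ) :
    PowerSeries.coeff n (bmP s z * bmP t w)
      = ∑ a ∈ Finset.range (n + 1), C (s a * t (n - a)) *
        (z ^ a * w ^ (n - a)).map (algebraMap (ZMod 2) R) := by
  rw [PowerSeries.coeff_mul, Finset.Nat.sum_antidiagonal_eq_sum_range_succ_mk]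
  refine Finset.sum_congr rfl fun a _ => ?_
  simp only [bmP, PowerSeries.coeff_mk]
  rw [C_mul, Polynomial.map_mul, mul_assoc, ← mul_assoc _ (C (t (n - a))), map_comm]
  simp only [mul_assoc]

/-- The Adem relations without `τ`. -/
def IsAdem (s : ℕ → R) : Prop := ∀ n, AdemLin n (fun a => s a * s (n - a))

theorem isAdem_iff (s : ℕ → R) :
    IsAdem s ↔ bmP s (X ^ 2 + X) * bmP s 1 = bmP s (1 + X) * bmP s (X ^ 2) := by
  rw [PowerSeries.ext_iff]
  refine forall_congr' fun n => ?_
  rw [ademLin_iff_coeff, coeff_bmP_mul, coeff_bmP_mul, ← sub_eq_zero, ← Finset.sum_sub_distrib,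
    Polynomial.ext_iff]
  refine forall_congr' fun j => ?_
  rw [finsetSum_coeff, coeff_zero]
  have : ∀ a ∈ Finset.range (n + 1),
      (C (s a * s (n - a)) * ((X ^ 2 + X) ^ a * 1 ^ (n - a)).map (algebraMap (ZMod 2) R)
      - C (s a * s (n - a)) * ((1 + X) ^ a * (X ^ 2) ^ (n - a)).map (algebraMap (ZMod 2) R)).coeff j
      = (bmL a + bmR n a).coeff j • (s a * s (n - a)) := by
    intro a _
    rw [← mul_sub, ← Polynomial.map_sub, CharTwo.sub_eq_add, coeff_C_mul, coeff_map,
      ← Algebra.commutes, ← Algebra.smul_def, bmL, bmR, one_pow, mul_one, pow_mul]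
  rw [Finset.sum_congr rfl this]

theorem bmP_conv (s t : ℕ → R) (z : (ZMod 2)[X]) :
    bmP (fun n => ∑ i ∈ Finset.range (n + 1), s i * t (n - i)) z = bmP s z * bmP t z := by
  ext1 n
  rw [coeff_bmP_mul]
  simp only [bmP, PowerSeries.coeff_mk, map_sum]
  rw [Finset.sum_mul]
  refine Finset.sum_congr rfl fun i hi => ?_
  rw [← pow_add, Nat.add_sub_cancel' (by simp at hi; omega)]

theorem bmP_comm (s t : ℕ → R) (h : ∀ i j, Commute (s i) (t j)) (z w : (ZMod 2)[X]) :
    Commute (bmP s z) (bmP t w) := by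
  ext1 n
  rw [PowerSeries.coeff_mul, PowerSeries.coeff_mul, ← Finset.Nat.sum_antidiagonal_swap]
  refine Finset.sum_congr rfl fun p _ => ?_
  simp only [bmP, PowerSeries.coeff_mk, Prod.fst_swap, Prod.snd_swap]
  have h1 : C (s p.2) * C (t p.1) = C (t p.1) * C (s p.2) := by
    rw [← C_mul, ← C_mul, (h _ _).eq]
  calc _ = C (s p.2) * (((z ^ p.2).map (algebraMap (ZMod 2) R) * C (t p.1))
          * (w ^ p.1).map (algebraMap (ZMod 2) R)) := by simp only [mul_assoc]
    _ = C (s p.2) * C (t p.1) * ((z ^ p.2).map (algebraMap (ZMod 2) R)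
          * (w ^ p.1).map (algebraMap (ZMod 2) R)) := by rw [map_comm]; simp only [mul_assoc]
    _ = C (t p.1) * (C (s p.2) * (w ^ p.1).map (algebraMap (ZMod 2) R))
          * (z ^ p.2).map (algebraMap (ZMod 2) R) := by rw [h1, map_comm]; simp only [mul_assoc]
    _ = _ := by rw [← map_comm (w ^ p.1) (C (s p.2))]; simp only [mul_assoc]

theorem IsAdem.conv {s t : ℕ → R} (hs : IsAdem s) (ht : IsAdem t)
    (h : ∀ i j, Commute (s i) (t j)) :
    IsAdem (fun n => ∑ i ∈ Finset.range (n + 1), s i * t (n - i)) := by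
  rw [isAdem_iff] at *
  simp only [bmP_conv]
  rw [mul_assoc, ← mul_assoc (bmP t _), ← (bmP_comm s t h 1 _).eq, mul_assoc, ← mul_assoc, hs, ht,
    mul_assoc, ← mul_assoc (bmP s (X ^ 2)), (bmP_comm s t h (X ^ 2) (1 + X)).eq]
  simp only [mul_assoc]

end Seq

end Steenrod

namespace Steenrod

/-- The sequence `s` of elements of a `k`-algebra satisfies `s 0 = 1` and the Adem relations with
parameter `τ`. -/
def SatisfiesAdem {k B : Type*} [CommRing k] (τ : k) [Ring B] [Algebra k B] (s : ℕ → B) : Prop :=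
  s 0 = 1 ∧ ∀ a b : ℕ, 0 < a → a < 2 * b →
    s a * s b = ∑ c ∈ Finset.range (a / 2 + 1),
      (((b - 1 - c).choose (a - 2 * c) : k) * τ ^ (a / 2 + b / 2 - ((a + b - c) / 2 + c / 2))) •
        (s (a + b - c) * s c)

section mat
variable {k B : Type*} [CommRing k] (τ : k) [Ring B] [Algebra k B]

/-- `x` as a diagonal matrix. -/
def matD (x : B) : Matrix (Fin 2) (Fin 2) B := !![x, 0; 0, x]
/-- `u x`, where `u ^ 2 = τ`. -/
def matU (x : B) : Matrix (Fin 2) (Fin 2) B := !![0, τ • x; x, 0]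

theorem matD_mul_matD (x y : B) : matD x * matD y = matD (x * y) := by
  simp [matD]
theorem matD_mul_matU (x y : B) : matD x * matU τ y = matU τ (x * y) := by
  simp [matD, matU]
theorem matU_mul_matD (x y : B) : matU τ x * matD y = matU τ (x * y) := by
  simp [matD, matU]
theorem matU_mul_matU (x y : B) : matU τ x * matU τ y = matD (τ • (x * y)) := by
  simp [matD, matU]

theorem matD_sum {ι : Type*} (s : Finset ι) (f : ι → B) :
    matD (∑ i ∈ s, f i) = ∑ i ∈ s, matD (f i) := by
  ext i j; fin_cases i <;> fin_cases j <;> simp [matD, Matrix.sum_apply]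
theorem matU_sum {ι : Type*} (s : Finset ι) (f : ι → B) :
    matU τ (∑ i ∈ s, f i) = ∑ i ∈ s, matU τ (f i) := by
  ext i j; fin_cases i <;> fin_cases j <;> simp [matU, Matrix.sum_apply, Finset.smul_sum]
theorem matD_nsmul (n : ℕ) (x : B) : matD (n • x) = n • matD x := by
  ext i j; fin_cases i <;> fin_cases j <;> simp [matD]
theorem matU_nsmul (n : ℕ) (x : B) : matU τ (n • x) = n • matU τ x := by
  ext i j; fin_cases i <;> fin_cases j <;> simp [matU, smul_comm]
theorem matD_inj {x y : B} (h : matD x = matD y) : x = y := by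
  simpa [matD] using congrFun (congrFun h 0) 0
theorem matU_inj {x y : B} (h : matU τ x = matU τ y) : x = y := by
  simpa [matU] using congrFun (congrFun h 1) 0

/-- `u ^ (n mod 2) s_n`. -/
def matSeq (s : ℕ → B) (n : ℕ) : Matrix (Fin 2) (Fin 2) B :=
  if Even n then matD (s n) else matU τ (s n)

theorem matSeq_mul (s t : ℕ → B) (i j : ℕ) : matSeq τ s i * matSeq τ t j
    = if Even (i + j) then matD (τ ^ ((i + j) / 2 - (i / 2 + j / 2)) • (s i * t j))
      else matU τ (s i * t j) := by
  rcases Nat.even_or_odd' i with ⟨p, rfl | rfl⟩ <;> rcases Nat.even_or_odd' j with ⟨q, rfl | rfl⟩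
  · have h : (2 * p + 2 * q) / 2 - (2 * p / 2 + 2 * q / 2) = 0 := by omega
    simp [matSeq, matD_mul_matD, ← mul_add]
  · have h : ¬ Even (2 * p + (2 * q + 1)) := by rw [Nat.not_even_iff_odd]; exact ⟨p + q, by ring⟩
    simp [matSeq, matD_mul_matU, h]
  · have h : ¬ Even (2 * p + 1 + 2 * q) := by rw [Nat.not_even_iff_odd]; exact ⟨p + q, by ring⟩
    simp [matSeq, matU_mul_matD, h]
  · have h : Even (2 * p + 1 + (2 * q + 1)) := ⟨p + q + 1, by ring⟩
    have h2 : (2 * p + 1 + (2 * q + 1)) / 2 - ((2 * p + 1) / 2 + (2 * q + 1) / 2) = 1 := by omega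
    simp [matSeq, matU_mul_matU, h, h2]

/-- The Cartan combination of two sequences. -/
def cartan (s t : ℕ → B) (n : ℕ) : B :=
  ∑ i ∈ Finset.range (n + 1), τ ^ (n / 2 - (i / 2 + (n - i) / 2)) • (s i * t (n - i))

theorem matSeq_cartan (s t : ℕ → B) (n : ℕ) : matSeq τ (cartan τ s t) n
    = ∑ i ∈ Finset.range (n + 1), matSeq τ s i * matSeq τ t (n - i) := by
  have h : ∀ i ∈ Finset.range (n + 1), matSeq τ s i * matSeq τ t (n - i)
      = if Even n then matD (τ ^ (n / 2 - (i / 2 + (n - i) / 2)) • (s i * t (n - i)))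
      else matU τ (s i * t (n - i)) := by
    intro i hi
    rw [matSeq_mul, Nat.add_sub_cancel' (by simp at hi; omega)]
  rw [Finset.sum_congr rfl h, matSeq]
  split_ifs with hn
  · rw [cartan, matD_sum]
  · rw [cartan, matU_sum]
    refine Finset.sum_congr rfl fun i hi => ?_
    rw [Nat.not_even_iff_odd] at hn
    obtain ⟨m, rfl⟩ := hn
    have : (2 * m + 1) / 2 - (i / 2 + (2 * m + 1 - i) / 2) = 0 := by
      simp at hi; omega
    rw [this, pow_zero, one_smul]

theorem commute_matSeq (s t : ℕ → B) (h : ∀ i j, Commute (s i) (t j)) (i j : ℕ) :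
    Commute (matSeq τ s i) (matSeq τ t j) := by
  rw [Commute, SemiconjBy, matSeq_mul, matSeq_mul, (h i j).eq, add_comm j i, add_comm (j / 2)]

end mat

section mat2
variable {k B : Type*} [CommRing k] (τ : k) [Ring B] [Algebra k B]

theorem choose_cast_zero [CharP k 2] {m r : ℕ} (hm : Even m) (hr : Odd r) :
    ((m.choose r : ℕ) : k) = 0 := by
  rw [CharP.cast_eq_zero_iff k 2]
  have := Choose.choose_modEq_choose_mod_mul_choose_div_nat (n := m) (k := r) (p := 2)
  rw [Nat.even_iff.1 hm, Nat.odd_iff.1 hr] at this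
  simpa using (Nat.modEq_zero_iff_dvd.1 (by simpa using this))

theorem choose_cast_succ [CharP k 2] {m r : ℕ} (hm : Odd m) (hr : Even r) :
    ((m.choose (r + 1) : ℕ) : k) = (m.choose r : ℕ) := by
  rw [CharP.cast_eq_iff_mod_eq k 2]
  have h1 := Choose.choose_modEq_choose_mod_mul_choose_div_nat (n := m) (k := r) (p := 2)
  have h2 := Choose.choose_modEq_choose_mod_mul_choose_div_nat (n := m) (k := r + 1) (p := 2)
  have e1 : (r + 1) % 2 = 1 := by have := Nat.even_iff.1 hr; omega
  have e2 : (r + 1) / 2 = r / 2 := by have := Nat.even_iff.1 hr; omega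
  rw [Nat.odd_iff.1 hm, Nat.even_iff.1 hr] at h1
  rw [Nat.odd_iff.1 hm, e1, e2] at h2
  simp only [Nat.choose_self, Nat.choose_zero_right] at h1 h2
  exact h2.trans h1.symm

theorem matRel_iff (s : ℕ → B) (a b : ℕ) :
    (matSeq τ s a * matSeq τ s (a + b - a) = ∑ c ∈ Finset.range (a / 2 + 1),
      (b - 1 - c).choose (a - 2 * c) •
        (matSeq τ s (a + b - c) * matSeq τ s (a + b - (a + b - c)))) ↔
    if Even (a + b) then
      τ ^ ((a + b) / 2 - (a / 2 + b / 2)) • (s a * s b) = ∑ c ∈ Finset.range (a / 2 + 1),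
        (b - 1 - c).choose (a - 2 * c) • τ ^ ((a + b) / 2 - ((a + b - c) / 2 + c / 2)) •
          (s (a + b - c) * s c)
    else s a * s b = ∑ c ∈ Finset.range (a / 2 + 1),
        (b - 1 - c).choose (a - 2 * c) • (s (a + b - c) * s c) := by
  have key : ∀ c ∈ Finset.range (a / 2 + 1), (b - 1 - c).choose (a - 2 * c) •
        (matSeq τ s (a + b - c) * matSeq τ s (a + b - (a + b - c)))
      = if Even (a + b) then
          matD ((b - 1 - c).choose (a - 2 * c) •
            τ ^ ((a + b) / 2 - ((a + b - c) / 2 + c / 2)) • (s (a + b - c) * s c))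
        else matU τ ((b - 1 - c).choose (a - 2 * c) • (s (a + b - c) * s c)) := by
    intro c hc
    simp only [Finset.mem_range] at hc
    rw [matSeq_mul, show a + b - (a + b - c) = c by omega, Nat.sub_add_cancel (by omega)]
    split_ifs
    · rw [matD_nsmul]
    · rw [matU_nsmul]
  rw [Finset.sum_congr rfl key, matSeq_mul, Nat.add_sub_cancel_left]
  split_ifs with h
  · rw [← matD_sum]
    exact ⟨fun h => matD_inj h, fun h => by rw [h]⟩
  · rw [← matU_sum]
    exact ⟨fun h => matU_inj τ h, fun h => by rw [h]⟩

theorem ademRel_eo (s : ℕ → B) (a b : ℕ) (h : Even a ∨ Even b) :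
    (s a * s b = ∑ c ∈ Finset.range (a / 2 + 1),
      (((b - 1 - c).choose (a - 2 * c) : k) * τ ^ (a / 2 + b / 2 - ((a + b - c) / 2 + c / 2))) •
        (s (a + b - c) * s c)) ↔
    if Even (a + b) then
      τ ^ ((a + b) / 2 - (a / 2 + b / 2)) • (s a * s b) = ∑ c ∈ Finset.range (a / 2 + 1),
        (b - 1 - c).choose (a - 2 * c) • τ ^ ((a + b) / 2 - ((a + b - c) / 2 + c / 2)) •
          (s (a + b - c) * s c)
    else s a * s b = ∑ c ∈ Finset.range (a / 2 + 1),
        (b - 1 - c).choose (a - 2 * c) • (s (a + b - c) * s c) := by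
  have e1 : a / 2 + b / 2 = (a + b) / 2 := by
    rcases h with h | h <;> rw [Nat.even_iff] at h <;> omega
  simp only [mul_smul, Nat.cast_smul_eq_nsmul, e1]
  split_ifs with hn
  · simp
  · have : ∀ c ∈ Finset.range (a / 2 + 1), (b - 1 - c).choose (a - 2 * c) •
        τ ^ ((a + b) / 2 - ((a + b - c) / 2 + c / 2)) • (s (a + b - c) * s c)
        = (b - 1 - c).choose (a - 2 * c) • (s (a + b - c) * s c) := by
      intro c hc
      simp only [Finset.mem_range] at hc
      rw [Nat.even_iff] at hn
      rw [show (a + b) / 2 - ((a + b - c) / 2 + c / 2) = 0 by omega, pow_zero, one_smul]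
    rw [Finset.sum_congr rfl this]

theorem ademRel_oo [CharP k 2] (s : ℕ → B) (a b : ℕ) (ha : Odd a) (hb : Odd b) :
    ∑ c ∈ Finset.range (a / 2 + 1),
      (((b - 1 - c).choose (a - 2 * c) : k) * τ ^ (a / 2 + b / 2 - ((a + b - c) / 2 + c / 2))) •
        (s (a + b - c) * s c)
    = ∑ c ∈ Finset.range (a / 2 + 1),
      if Odd c then ((b - 1 - c).choose (a - 2 * c) : k) • (s (a + b - c) * s c) else 0 := by
  refine Finset.sum_congr rfl fun c hc => ?_
  simp only [Finset.mem_range] at hc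
  split_ifs with h
  · rw [Nat.odd_iff] at h ha hb
    rw [show a / 2 + b / 2 - ((a + b - c) / 2 + c / 2) = 0 by omega, pow_zero, mul_one]
  · rw [choose_cast_zero, zero_mul, zero_smul]
    · rw [Nat.odd_iff] at h ha hb
      rw [Nat.even_iff]; omega
    · rw [Nat.odd_iff] at h ha hb ⊢
      omega

theorem SatisfiesAdem.isAdem [CharP k 2] {s : ℕ → B} (h : SatisfiesAdem τ s) :
    IsAdem (matSeq τ s) := by
  rintro n a b rfl hab
  refine (matRel_iff τ s a b).2 ?_
  rcases Nat.eq_zero_or_pos a with rfl | ha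
  · split_ifs <;> simp [h.1]
  by_cases hp : Even a ∨ Even b
  · exact (ademRel_eo τ s a b hp).1 (h.2 a b ha hab)
  · rw [not_or, Nat.not_even_iff_odd, Nat.not_even_iff_odd] at hp
    rw [if_pos (hp.1.add_odd hp.2), h.2 a b ha hab, ademRel_oo τ s a b hp.1 hp.2,
      Finset.smul_sum]
    refine Finset.sum_congr rfl fun c hc => ?_
    simp only [Finset.mem_range] at hc
    obtain ⟨ha1, hb1⟩ := hp
    split_ifs with hodd
    · rw [Nat.odd_iff] at hodd ha1 hb1
      rw [show (a + b) / 2 - (a / 2 + b / 2) = 1 by omega,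
        show (a + b) / 2 - ((a + b - c) / 2 + c / 2) = 1 by omega, Nat.cast_smul_eq_nsmul,
        smul_comm]
    · rw [← Nat.cast_smul_eq_nsmul k, choose_cast_zero, zero_smul, smul_zero]
      · rw [Nat.odd_iff] at hodd ha1 hb1
        rw [Nat.even_iff]; omega
      · rw [Nat.odd_iff] at hodd ha1 hb1 ⊢
        omega

theorem SatisfiesAdem.of_isAdem [CharP k 2] {s : ℕ → B} (h : IsAdem (matSeq τ s)) (h0 : s 0 = 1)
    (h1 : s 1 * s 1 = 0) : SatisfiesAdem τ s := by
  have heo : ∀ a b, a < 2 * b → (Even a ∨ Even b) →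
      s a * s b = ∑ c ∈ Finset.range (a / 2 + 1),
      (((b - 1 - c).choose (a - 2 * c) : k) * τ ^ (a / 2 + b / 2 - ((a + b - c) / 2 + c / 2))) •
        (s (a + b - c) * s c) := fun a b hab hp =>
    (ademRel_eo τ s a b hp).2 ((matRel_iff τ s a b).1 (h (a + b) a b rfl hab))
  have hs1 : ∀ m, s 1 * s (2 * m) = s (2 * m + 1) := by
    intro m
    rcases Nat.eq_zero_or_pos m with rfl | hm
    · simp [h0]
    rw [heo 1 (2 * m) (by omega) (Or.inr (even_two_mul m))]
    have e : (1 : ℕ) = 0 + 1 := rfl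
    have hc : (((2 * m - 1).choose 1 : ℕ) : k) = 1 := by
      rw [e, choose_cast_succ ⟨m - 1, by omega⟩ Even.zero]; simp
    simp only [show 1 / 2 + 1 = 1 from rfl, Finset.sum_range_one]
    rw [show 2 * m - 1 - 0 = 2 * m - 1 by omega, show 1 - 2 * 0 = 1 from rfl, hc, h0,
      show 1 / 2 + 2 * m / 2 - ((1 + 2 * m - 0) / 2 + 0 / 2) = 0 by omega,
      show 1 + 2 * m - 0 = 2 * m + 1 by omega]
    simp
  have hs1' : ∀ m, s 1 * s (2 * m + 1) = 0 := by
    intro m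
    rw [← hs1, ← mul_assoc, h1, zero_mul]
  refine ⟨h0, fun a b ha hab => ?_⟩
  by_cases hp : Even a ∨ Even b
  · exact heo a b hab hp
  · rw [not_or, Nat.not_even_iff_odd, Nat.not_even_iff_odd] at hp
    obtain ⟨⟨p, rfl⟩, hb⟩ := hp
    rw [ademRel_oo τ s _ b ⟨p, rfl⟩ hb, ← hs1, mul_assoc,
      heo (2 * p) b (by omega) (Or.inl (even_two_mul p)), Finset.mul_sum]
    rw [show (2 * p + 1) / 2 = p by omega, show 2 * p / 2 = p by omega]
    refine Finset.sum_congr rfl fun c hc => ?_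
    simp only [Finset.mem_range] at hc
    rw [mul_smul_comm, ← mul_assoc]
    split_ifs with hodd
    · have hev : ∃ m, 2 * p + b - c = 2 * m := by
        rw [Nat.odd_iff] at hodd hb
        exact ⟨(2 * p + b - c) / 2, by omega⟩
      obtain ⟨m, hm⟩ := hev
      rw [hm, hs1, show 2 * p + 1 + b - c = 2 * m + 1 by omega,
        show 2 * p + 1 - 2 * c = (2 * p - 2 * c) + 1 by omega, choose_cast_succ]
      · rw [show p + b / 2 - (2 * m / 2 + c / 2) = 0 by
          rw [Nat.odd_iff] at hodd hb; omega, pow_zero, mul_one]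
      · rw [Nat.odd_iff] at hodd hb ⊢; omega
      · rw [Nat.even_iff]; omega
    · have hev : ∃ m, 2 * p + b - c = 2 * m + 1 := by
        rw [Nat.odd_iff] at hodd hb
        exact ⟨(2 * p + b - c) / 2, by omega⟩
      obtain ⟨m, hm⟩ := hev
      rw [hm, hs1', zero_mul, smul_zero]

theorem SatisfiesAdem.cartan [CharP k 2] {s t : ℕ → B} (hs : SatisfiesAdem τ s)
    (ht : SatisfiesAdem τ t) (h : ∀ i j, Commute (s i) (t j)) :
    SatisfiesAdem τ (Steenrod.cartan τ s t) := by
  let _ : Algebra (ZMod 2) k := ZMod.algebra k 2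
  let _ : Algebra (ZMod 2) B := Algebra.compHom B (algebraMap (ZMod 2) k)
  have h2 : ∀ x : B, x + x = 0 := fun x => by
    rw [← two_smul k, CharTwo.two_eq_zero, zero_smul]
  refine SatisfiesAdem.of_isAdem τ ?_ ?_ ?_
  · have := hs.isAdem.conv ht.isAdem (commute_matSeq τ s t h)
    have e : matSeq τ (Steenrod.cartan τ s t)
        = fun n => ∑ i ∈ Finset.range (n + 1), matSeq τ s i * matSeq τ t (n - i) :=
      funext fun n => matSeq_cartan τ s t n
    rw [e]; exact this
  · simp [Steenrod.cartan, hs.1, ht.1]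
  · have e : Steenrod.cartan τ s t 1 = t 1 + s 1 := by
      simp [Steenrod.cartan, hs.1, ht.1, Finset.sum_range_succ]
    have hsq : ∀ u : ℕ → B, SatisfiesAdem τ u → u 1 * u 1 = 0 := by
      intro u hu
      rw [hu.2 1 1 one_pos (by omega)]
      simp
    rw [e, mul_add, add_mul, add_mul, hsq s hs, hsq t ht, (h 1 1).eq, zero_add, add_zero, h2]

end mat2
end Steenrod

namespace Steenrod

theorem SatisfiesAdem.map {k B C : Type*} [CommRing k] [Ring B] [Algebra k B] [Ring C] [Algebra k C]
    {τ : k} {s : ℕ → B} (hs : SatisfiesAdem τ s) (f : B →ₐ[k] C) :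
    SatisfiesAdem τ (fun n => f (s n)) := by
  refine ⟨by simp only [hs.1, map_one], fun a b ha hab => ?_⟩
  simp only [← map_mul, hs.2 a b ha hab, map_sum, map_smul]

/-- The defining relations of the mod 2 Steenrod algebra with parameter `τ ∈ k`, where the generator
`ι n` stands for `Sq^n`: `Sq^0 = 1`, and, for `0 < a < 2 b`, the Adem relations
`Sq^a Sq^b = ∑_c binom(b - 1 - c, a - 2 c) τ^? Sq^(a + b - c) Sq^c`. Both `Sq^(2 n)` and `Sq^(2 n + 1)`
have weight `n`, and the exponent `?` of `τ`, which has weight `1`, is the one that balances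
the weights: it is `1` if `a` and `b` are even and `c` is odd, and otherwise it is `0`. (If `a` and `b` are
odd and `c` is even, where no exponent would balance the weights, the binomial coefficient is even.)
For `τ = 1` these are the classical Adem relations. -/
inductive AdemRel {k : Type*} [CommRing k] (τ : k) : FreeAlgebra k ℕ → FreeAlgebra k ℕ → Prop
  | sq_zero : AdemRel τ (FreeAlgebra.ι k 0) 1
  | adem (a b : ℕ) (ha : 0 < a) (hab : a < 2 * b) :
      AdemRel τ (FreeAlgebra.ι k a * FreeAlgebra.ι k b)
        (∑ c ∈ Finset.range (a / 2 + 1),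
          (((b - 1 - c).choose (a - 2 * c) : k) * τ ^ (a / 2 + b / 2 - ((a + b - c) / 2 + c / 2))) •
            (FreeAlgebra.ι k (a + b - c) * FreeAlgebra.ι k c))

/-- The `k`-algebra on generators `Sq^n` with the Adem relations with parameter `τ`. -/
abbrev SteenrodAlg (k : Type*) [CommRing k] (τ : k) : Type _ := RingQuot (AdemRel τ)

namespace SteenrodAlg
variable {k : Type*} [CommRing k] (τ : k)

/-- The generator `Sq^n`. -/
noncomputable def Sq (n : ℕ) : SteenrodAlg k τ := RingQuot.mkAlgHom k (AdemRel τ) (FreeAlgebra.ι k n)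

theorem satisfiesAdem_Sq : SatisfiesAdem τ (Sq τ) := by
  constructor
  · have := RingQuot.mkAlgHom_rel k (AdemRel.sq_zero (τ := τ))
    rw [map_one] at this
    exact this
  · intro a b ha hab
    have := RingQuot.mkAlgHom_rel k (AdemRel.adem (τ := τ) a b ha hab)
    rw [map_mul, map_sum] at this
    refine this.trans (Finset.sum_congr rfl fun c _ => ?_)
    rw [map_smul, map_mul]
    rfl

/-- The universal property of the presentation. -/
noncomputable def lift {τ : k} {B : Type*} [Ring B] [Algebra k B] (s : ℕ → B) (hs : SatisfiesAdem τ s) :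
    SteenrodAlg k τ →ₐ[k] B :=
  RingQuot.liftAlgHom k ⟨FreeAlgebra.lift k s, by
    intro x y h
    cases h with
    | sq_zero => rw [FreeAlgebra.lift_ι_apply, hs.1, map_one]
    | adem a b ha hab =>
      simp only [map_mul, map_sum, map_smul, FreeAlgebra.lift_ι_apply]
      exact hs.2 a b ha hab⟩

theorem lift_Sq {τ : k} {B : Type*} [Ring B] [Algebra k B] (s : ℕ → B) (hs : SatisfiesAdem τ s) (n : ℕ) :
    lift s hs (Sq τ n) = s n := by
  unfold lift Sq
  rw [RingQuot.liftAlgHom_mkAlgHom_apply, FreeAlgebra.lift_ι_apply]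

theorem algHom_ext {B : Type*} [Semiring B] [Algebra k B] {f g : SteenrodAlg k τ →ₐ[k] B}
    (h : ∀ n, f (Sq τ n) = g (Sq τ n)) : f = g := by
  refine RingQuot.ringQuot_ext' k f g ?_
  ext n
  exact h n

/-- The augmentation, killing `Sq^n` for `n > 0`. -/
noncomputable def augmentation : SteenrodAlg k τ →ₐ[k] k :=
  lift (fun n => if n = 0 then 1 else 0) (by
    refine ⟨if_pos rfl, fun a b ha hab => ?_⟩
    simp only
    rw [if_neg (by omega), zero_mul, eq_comm]
    refine Finset.sum_eq_zero fun c hc => ?_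
    simp only [Finset.mem_range] at hc
    rw [if_neg (by omega), zero_mul, smul_zero])

/-- The coproduct, given by the Cartan formula `Δ(Sq^n) = ∑_i τ^? Sq^i ⊗ Sq^(n - i)`, where the exponent
of `τ` balances the weights: it is `1` if `i` and `n - i` are both odd, and otherwise it is `0`. -/
noncomputable def coproduct [CharP k 2] : SteenrodAlg k τ →ₐ[k] SteenrodAlg k τ ⊗[k] SteenrodAlg k τ :=
  lift (fun n => ∑ i ∈ Finset.range (n + 1),
      τ ^ (n / 2 - (i / 2 + (n - i) / 2)) • (Sq τ i ⊗ₜ[k] Sq τ (n - i))) (by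
    have := ((satisfiesAdem_Sq τ).map Algebra.TensorProduct.includeLeft).cartan τ
      ((satisfiesAdem_Sq τ).map (Algebra.TensorProduct.includeRight (R := k) (A := SteenrodAlg k τ)))
      (fun i j => by simp [Commute, SemiconjBy])
    have e : cartan τ (fun n => (Algebra.TensorProduct.includeLeft :
          SteenrodAlg k τ →ₐ[k] SteenrodAlg k τ ⊗[k] SteenrodAlg k τ) (Sq τ n))
        (fun n => (Algebra.TensorProduct.includeRight :
          SteenrodAlg k τ →ₐ[k] SteenrodAlg k τ ⊗[k] SteenrodAlg k τ) (Sq τ n))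
        = fun n => ∑ i ∈ Finset.range (n + 1),
          τ ^ (n / 2 - (i / 2 + (n - i) / 2)) • (Sq τ i ⊗ₜ[k] Sq τ (n - i)) := by
      funext n
      simp [cartan]
    rw [← e]
    exact this)

theorem coproduct_Sq [CharP k 2] (n : ℕ) : coproduct τ (Sq τ n) = ∑ i ∈ Finset.range (n + 1),
      τ ^ (n / 2 - (i / 2 + (n - i) / 2)) • (Sq τ i ⊗ₜ[k] Sq τ (n - i)) := lift_Sq _ _ n

theorem augmentation_Sq (n : ℕ) : augmentation τ (Sq τ n) = if n = 0 then 1 else 0 := lift_Sq _ _ n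

/-- The Hopf algebra structure of the Steenrod algebra. -/
noncomputable instance instBialgebra [CharP k 2] : Bialgebra k (SteenrodAlg k τ) :=
  Bialgebra.ofAlgHom (coproduct τ) (augmentation τ)
    (by
      apply algHom_ext
      intro n
      have hL : (Algebra.TensorProduct.assoc k k k (SteenrodAlg k τ) (SteenrodAlg k τ)
          (SteenrodAlg k τ)) ((Algebra.TensorProduct.map (coproduct τ) (.id k (SteenrodAlg k τ)))
            (coproduct τ (Sq τ n))) = ∑ m ∈ Finset.range (n + 1), ∑ p ∈ Finset.range (m + 1),
              τ ^ (n / 2 - (p / 2 + (m - p) / 2 + (n - p - (m - p)) / 2)) •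
                (Sq τ p ⊗ₜ[k] (Sq τ (m - p) ⊗ₜ[k] Sq τ (n - p - (m - p)))) := by
        simp only [coproduct_Sq, map_sum, map_smul, Algebra.TensorProduct.map_tmul,
          TensorProduct.sum_tmul, AlgHom.id_apply, Finset.smul_sum]
        refine Finset.sum_congr rfl fun m hm => Finset.sum_congr rfl fun p hp => ?_
        simp only [Finset.mem_range] at hm hp
        rw [← TensorProduct.smul_tmul', map_smul, smul_smul, ← pow_add,
          show n - p - (m - p) = n - m by omega, Algebra.TensorProduct.assoc_tmul]
        congr 2
        omega
      have hR : (Algebra.TensorProduct.map (.id k (SteenrodAlg k τ)) (coproduct τ))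
            (coproduct τ (Sq τ n)) = ∑ p ∈ Finset.range (n + 1), ∑ q ∈ Finset.range (n + 1 - p),
              τ ^ (n / 2 - (p / 2 + q / 2 + (n - p - q) / 2)) •
                (Sq τ p ⊗ₜ[k] (Sq τ q ⊗ₜ[k] Sq τ (n - p - q))) := by
        simp only [coproduct_Sq, map_sum, map_smul, Algebra.TensorProduct.map_tmul,
          TensorProduct.tmul_sum, AlgHom.id_apply, Finset.smul_sum]
        refine Finset.sum_congr rfl fun p hp => ?_
        simp only [Finset.mem_range] at hp
        rw [show n + 1 - p = n - p + 1 by omega]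
        refine Finset.sum_congr rfl fun q hq => ?_
        simp only [Finset.mem_range] at hq
        rw [TensorProduct.tmul_smul, smul_smul, ← pow_add]
        congr 2
        omega
      have hflip := Finset.sum_range_diag_flip (n + 1) (fun p q =>
              τ ^ (n / 2 - (p / 2 + q / 2 + (n - p - q) / 2)) •
                (Sq τ p ⊗ₜ[k] (Sq τ q ⊗ₜ[k] Sq τ (n - p - q))))
      exact hL.trans (hflip.trans hR.symm))
    (by
      apply algHom_ext
      intro n
      simp only [AlgHom.comp_apply, coproduct_Sq, map_sum, map_smul,
        Algebra.TensorProduct.map_tmul, augmentation_Sq]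
      rw [Finset.sum_eq_single 0]
      · simp
      · intro i _ hi
        simp [hi]
      · simp)
    (by
      apply algHom_ext
      intro n
      simp only [AlgHom.comp_apply, coproduct_Sq, map_sum, map_smul,
        Algebra.TensorProduct.map_tmul, augmentation_Sq]
      rw [Finset.sum_eq_single n]
      · simp
      · intro i hi hin
        simp only [Finset.mem_range] at hi
        rw [if_neg (by omega)]
        simp
      · simp)

end SteenrodAlg
end Steenrod

/-! ### The bar complex

`Ext_H(k, k)` for a bialgebra `H` over a ring `k` of characteristic two (free as a `k`-module) is the
cohomology of `Hom_H(B, k)`, where `B` is the bar resolution of `k`. A cochain of `Hom_H(Bₙ, k)` is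
a `k`-multilinear function of `n` variables in `H` with values in `k`. -/

/-- Families of functions of `0, 1, 2, …` variables in `H` with values in `k`; the functions of `n`
variables are the values at lists of length `n`. -/
def BarCochain (k H : Type*) : Type _ := List H → k

namespace BarCochain

section ring
variable {k H : Type*} [CommRing k]

instance : AddCommGroup (BarCochain k H) := inferInstanceAs (AddCommGroup (List H → k))

/-- The product `(x y)(a₁, …, aₙ) = ∑ₚ x(a₁, …, aₚ) y(aₚ₊₁, …, aₙ)`. -/
instance : Mul (BarCochain k H) :=
  ⟨fun x y l => ∑ p ∈ Finset.range (l.length + 1), x (l.take p) * y (l.drop p)⟩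

/-- The unit: `1` on the empty list and `0` on all other lists. -/
instance : One (BarCochain k H) := ⟨fun l => if l.isEmpty then 1 else 0⟩

/-- The pointwise multiple `c x`. -/
def scale (c : k) (x : BarCochain k H) : BarCochain k H := fun l => c * x l

/-- `x.shift a` is `x(a, -)`. -/
def shift (x : BarCochain k H) (a : H) : BarCochain k H := fun l => x (a :: l)

theorem add_apply (x y : BarCochain k H) (l : List H) : (x + y) l = x l + y l := rfl
theorem neg_apply (x : BarCochain k H) (l : List H) : (-x) l = -x l := rfl
theorem zero_apply (l : List H) : (0 : BarCochain k H) l = 0 := rfl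
theorem mul_apply (x y : BarCochain k H) (l : List H) :
    (x * y) l = ∑ p ∈ Finset.range (l.length + 1), x (l.take p) * y (l.drop p) := rfl
theorem one_nil : (1 : BarCochain k H) [] = 1 := rfl
theorem one_cons (a : H) (l : List H) : (1 : BarCochain k H) (a :: l) = 0 := rfl

theorem mul_nil (x y : BarCochain k H) : (x * y) [] = x [] * y [] := by
  simp [mul_apply]

theorem mul_cons (x y : BarCochain k H) (a : H) (l : List H) :
    (x * y) (a :: l) = x [] * y (a :: l) + (x.shift a * y) l := by
  rw [mul_apply, List.length_cons, Finset.sum_range_succ', add_comm]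
  simp [mul_apply, shift]

theorem add_mul' (x y z : BarCochain k H) : (x + y) * z = x * z + y * z := by
  funext l
  simp only [mul_apply, add_apply, add_mul, Finset.sum_add_distrib]

theorem mul_add' (x y z : BarCochain k H) : x * (y + z) = x * y + x * z := by
  funext l
  simp only [mul_apply, add_apply, mul_add, Finset.sum_add_distrib]

theorem mul_assoc' (x y z : BarCochain k H) : x * y * z = x * (y * z) := by
  funext l
  induction l generalizing x with
  | nil => simp only [mul_nil, mul_assoc]
  | cons a l ih =>
    have h : (x * y).shift a = scale (x []) (y.shift a) + x.shift a * y := by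
      funext m
      exact mul_cons x y a m
    have h2 : (scale (x []) (y.shift a) * z) l = x [] * (y.shift a * z) l := by
      simp only [mul_apply, scale, Finset.mul_sum, mul_assoc]
    rw [mul_cons, h, add_mul', add_apply, h2, ih, mul_cons x, mul_cons y, mul_nil]
    ring

theorem one_mul' (x : BarCochain k H) : 1 * x = x := by
  funext l
  cases l with
  | nil => rw [mul_nil, one_nil, one_mul]
  | cons a l =>
    have h : (1 : BarCochain k H).shift a = 0 := rfl
    rw [mul_cons, one_nil, one_mul, h]
    simp [mul_apply, zero_apply]

theorem mul_one' (x : BarCochain k H) : x * 1 = x := by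
  funext l
  induction l generalizing x with
  | nil => rw [mul_nil, one_nil, mul_one]
  | cons a l ih => rw [mul_cons, one_cons, mul_zero, zero_add, ih]; rfl

instance : Ring (BarCochain k H) where
  __ := (inferInstance : AddCommGroup (BarCochain k H))
  mul := (· * ·)
  one := 1
  left_distrib := mul_add'
  right_distrib := add_mul'
  zero_mul x := by funext l; simp [mul_apply, zero_apply]
  mul_zero x := by funext l; simp [mul_apply, zero_apply]
  mul_assoc := mul_assoc'
  one_mul := one_mul'
  mul_one := mul_one'

theorem add_self [CharP k 2] (x : BarCochain k H) : x + x = 0 := by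
  funext l
  exact CharTwo.add_self_eq_zero (R := k) (x l)

end ring

section inner
variable {k H : Type*} [CommRing k] [Ring H]

/-- The sum of the inner faces,
`(a₁, …, aₙ) ↦ ∑ₚ x(a₁, …, aₚ aₚ₊₁, …, aₙ)`. -/
def inner (x : BarCochain k H) : BarCochain k H
  | [] => 0
  | [_] => 0
  | a :: b :: l => x (a * b :: l) + inner (x.shift a) (b :: l)

theorem inner_nil (x : BarCochain k H) : inner x [] = 0 := rfl
theorem inner_singleton (x : BarCochain k H) (a : H) : inner x [a] = 0 := rfl
theorem inner_cons_cons (x : BarCochain k H) (a b : H) (l : List H) :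
    inner x (a :: b :: l) = x (a * b :: l) + inner (x.shift a) (b :: l) := rfl

theorem inner_add (x y : BarCochain k H) : inner (x + y) = inner x + inner y := by
  funext l
  induction l generalizing x y with
  | nil => simp only [inner_nil, add_apply, add_zero]
  | cons a l ih =>
    cases l with
    | nil => simp only [inner_singleton, add_apply, add_zero]
    | cons b l =>
      have h : (x + y).shift a = x.shift a + y.shift a := rfl
      simp only [inner_cons_cons, add_apply, h, ih]
      ring

theorem inner_scale (c : k) (x : BarCochain k H) (l : List H) :
    inner (scale c x) l = c * inner x l := by
  induction l generalizing x with
  | nil => simp only [inner_nil, mul_zero]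
  | cons a l ih =>
    cases l with
    | nil => simp only [inner_singleton, mul_zero]
    | cons b l =>
      have h : (scale c x).shift a = scale c (x.shift a) := rfl
      rw [inner_cons_cons, h, ih, inner_cons_cons, mul_add]
      rfl

theorem inner_mul (x y : BarCochain k H) : inner (x * y) = inner x * y + x * inner y := by
  funext l
  induction l generalizing x with
  | nil => simp only [inner_nil, add_apply, mul_nil, mul_zero, zero_mul, add_zero]
  | cons a l ih =>
    cases l with
    | nil =>
      have h : (inner x).shift a [] = 0 := rfl
      simp only [inner_nil, inner_singleton, add_apply, mul_cons, mul_nil, h]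
      ring
    | cons b l =>
      have h : (x * y).shift a = scale (x []) (y.shift a) + x.shift a * y := by
        funext m
        exact mul_cons x y a m
      have h1 : ((inner x).shift a).shift b = x.shift (a * b) + (inner (x.shift a)).shift b := by
        funext m
        rfl
      have h2 : (inner x).shift a [] = 0 := rfl
      rw [inner_cons_cons, h, inner_add, add_apply, inner_scale, ih, add_apply, add_apply,
        mul_cons x y, mul_cons (inner x), mul_cons ((inner x).shift a), h1, h2, add_mul', add_apply,
        mul_cons x (inner y), inner_cons_cons y, mul_cons (inner (x.shift a)), inner_nil, inner_nil]
      ring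

end inner

section differential
variable {k H : Type*} [CommRing k] [Ring H] [Bialgebra k H]

/-- The counit `ε`, as a cochain of one variable. -/
def counitCochain (k H : Type*) [CommRing k] [Ring H] [Bialgebra k H] : BarCochain k H
  | [a] => Coalgebra.counit (R := k) a
  | _ => 0

/-- The differential of the bar complex (there are no signs as `k` will have characteristic two):
`(d x)(a₁, …, aₙ) = ε(a₁) x(a₂, …, aₙ) + ∑ₚ x(a₁, …, aₚ aₚ₊₁, …, aₙ) + x(a₁, …, aₙ₋₁) ε(aₙ)`. -/
def d (x : BarCochain k H) : BarCochain k H :=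
  counitCochain k H * x + inner x + x * counitCochain k H

/-- The Leibniz rule. -/
theorem d_mul [CharP k 2] (x y : BarCochain k H) : d (x * y) = d x * y + x * d y := by
  have h := add_self (x * counitCochain k H * y)
  have e : ∀ e p q r s t : BarCochain k H, t + t = 0 →
      p + (q + r) + s = p + q + t + (t + r + s) := by
    intro _ p q r s t ht
    rw [show p + q + t + (t + r + s) = p + (q + r) + s + (t + t) by abel, ht, add_zero]
  simp only [d, inner_mul, add_mul, mul_add, mul_assoc] at h ⊢
  exact e 0 _ _ _ _ _ h

theorem d_add (x y : BarCochain k H) : d (x + y) = d x + d y := by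
  simp only [d, inner_add, add_mul, mul_add]
  abel

/-- The differential as an additive map. -/
def dHom (k H : Type*) [CommRing k] [Ring H] [Bialgebra k H] :
    BarCochain k H →+ BarCochain k H := AddMonoidHom.mk' d d_add

theorem d_zero : d (0 : BarCochain k H) = 0 := map_zero (dHom k H)

theorem d_one [CharP k 2] : d (1 : BarCochain k H) = 0 := by
  have h := d_mul (1 : BarCochain k H) 1
  rw [mul_one, mul_one, one_mul, add_self] at h
  exact h

end differential
end BarCochain

namespace BarCochain

section graded
variable {k H ι : Type*} [CommRing k] [Ring H] [Algebra k H] [AddCommGroup ι]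

/-- The cochains of degree `(f, e)`: `k`-multilinear functions of `f` variables (zero on lists of any
other length) that lower the internal degree by `e`, where `p = (f, e)`. Here `M` and `A` are the gradings of `k` and
of `H`. -/
def homogeneous (M : ι → AddSubgroup k) (A : ι → AddSubgroup H) (p : ℤ × ι) :
    AddSubgroup (BarCochain k H) where
  carrier := {x |
    (∀ l : List H, (l.length : ℤ) ≠ p.1 → x l = 0) ∧
    (∀ (l r : List H) (a b : H), x (l ++ (a + b) :: r) = x (l ++ a :: r) + x (l ++ b :: r)) ∧
    (∀ (l r : List H) (c : k) (a : H), x (l ++ (c • a) :: r) = c * x (l ++ a :: r)) ∧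
    (∀ L : List (ι × H), (∀ q ∈ L, q.2 ∈ A q.1) →
      x (L.map Prod.snd) ∈ M ((L.map Prod.fst).sum - p.2))}
  zero_mem' := ⟨fun _ _ => rfl, fun _ _ _ _ => (add_zero (0 : k)).symm,
    fun _ _ c _ => (mul_zero c).symm, fun _ _ => zero_mem _⟩
  add_mem' := by
    rintro x y ⟨hx1, hx2, hx3, hx4⟩ ⟨hy1, hy2, hy3, hy4⟩
    refine ⟨fun l hl => ?_, fun l r a b => ?_, fun l r c a => ?_, fun L hL => ?_⟩
    · rw [add_apply, hx1 l hl, hy1 l hl, add_zero]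
    · simp only [add_apply, hx2, hy2]; ring
    · simp only [add_apply, hx3, hy3]; ring
    · exact add_mem (hx4 L hL) (hy4 L hL)
  neg_mem' := by
    rintro x ⟨hx1, hx2, hx3, hx4⟩
    refine ⟨fun l hl => ?_, fun l r a b => ?_, fun l r c a => ?_, fun L hL => ?_⟩
    · rw [neg_apply, hx1 l hl, neg_zero]
    · simp only [neg_apply, hx2]; ring
    · simp only [neg_apply, hx3]; ring
    · exact neg_mem (hx4 L hL)

variable (M : ι → AddSubgroup k) (A : ι → AddSubgroup H)

theorem one_mem_homogeneous [SetLike.GradedMonoid M] : 1 ∈ homogeneous M A 0 := by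
  refine ⟨fun l hl => ?_, fun l r a b => ?_, fun l r c a => ?_, fun L _ => ?_⟩
  · cases l with
    | nil => exact absurd rfl hl
    | cons a l => rfl
  · cases l <;> exact (add_zero (0 : k)).symm
  · cases l <;> exact (mul_zero c).symm
  · cases L with
    | nil =>
      have : (0 : ι) - (0 : ℤ × ι).2 = 0 := by simp
      simp only [List.map_nil, List.sum_nil, this]
      exact SetLike.GradedOne.one_mem
    | cons q L => exact zero_mem _

theorem mul_mem_homogeneous [SetLike.GradedMonoid M] {p q : ℤ × ι} {x y : BarCochain k H}
    (hx : x ∈ homogeneous M A p) (hy : y ∈ homogeneous M A q) :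
    x * y ∈ homogeneous M A (p + q) := by
  obtain ⟨hx1, hx2, hx3, hx4⟩ := hx
  obtain ⟨hy1, hy2, hy3, hy4⟩ := hy
  refine ⟨fun l hl => ?_, fun l r a b => ?_, fun l r c a => ?_, fun L hL => ?_⟩
  · rw [mul_apply]
    refine Finset.sum_eq_zero fun n hn => ?_
    simp only [Finset.mem_range] at hn
    by_cases h : ((l.take n).length : ℤ) = p.1
    · rw [hy1, mul_zero]
      intro h2
      apply hl
      rw [Prod.fst_add, ← h, ← h2]
      simp only [List.length_take, List.length_drop]
      omega
    · rw [hx1 _ h, zero_mul]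
  · simp only [mul_apply, List.length_append, List.length_cons, ← Finset.sum_add_distrib]
    refine Finset.sum_congr rfl fun n _ => ?_
    rcases Nat.lt_or_ge l.length n with h | h
    · obtain ⟨m, rfl⟩ := Nat.exists_eq_add_of_lt h
      simp only [List.take_append, List.drop_append,
        List.take_of_length_le (show l.length ≤ l.length + m + 1 by omega),
        List.drop_eq_nil_of_le (show l.length ≤ l.length + m + 1 by omega),
        show l.length + m + 1 - l.length = m + 1 by omega, List.take_succ_cons, List.drop_succ_cons,
        hx2, add_mul, List.nil_append]
    · simp only [List.take_append_of_le_length h, List.drop_append_of_le_length h, hy2, mul_add]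
  · simp only [mul_apply, List.length_append, List.length_cons, Finset.mul_sum]
    refine Finset.sum_congr rfl fun n _ => ?_
    rcases Nat.lt_or_ge l.length n with h | h
    · obtain ⟨m, rfl⟩ := Nat.exists_eq_add_of_lt h
      simp only [List.take_append, List.drop_append,
        List.take_of_length_le (show l.length ≤ l.length + m + 1 by omega),
        List.drop_eq_nil_of_le (show l.length ≤ l.length + m + 1 by omega),
        show l.length + m + 1 - l.length = m + 1 by omega, List.take_succ_cons, List.drop_succ_cons,
        hx3, mul_assoc, List.nil_append]
    · simp only [List.take_append_of_le_length h, List.drop_append_of_le_length h, hy3]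
      ring
  · rw [mul_apply]
    refine sum_mem fun n _ => ?_
    have h1 := hx4 (L.take n) (fun q hq => hL q (List.mem_of_mem_take hq))
    have h2 := hy4 (L.drop n) (fun q hq => hL q (List.mem_of_mem_drop hq))
    have h3 := SetLike.GradedMul.mul_mem h1 h2
    rw [← List.map_take, ← List.map_drop]
    convert h3 using 2
    conv_lhs => rw [← List.take_append_drop n L]
    rw [List.map_append, List.sum_append, Prod.snd_add]
    abel

/-- The total complex: all finite sums of homogeneous cochains, as a ring. -/
def total [SetLike.GradedMonoid M] : Subring (BarCochain k H) where
  __ := ⨆ p, homogeneous M A p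
  one_mem' := AddSubgroup.mem_iSup_of_mem 0 (one_mem_homogeneous M A)
  mul_mem' := by
    intro x y hx hy
    change x ∈ ⨆ p, homogeneous M A p at hx
    change y ∈ ⨆ p, homogeneous M A p at hy
    change x * y ∈ ⨆ p, homogeneous M A p
    refine AddSubgroup.iSup_induction _ (C := fun x => x * y ∈ ⨆ p, homogeneous M A p) hx
      (fun p x hx => ?_) (by simp) (fun x x' h h' => by rw [add_mul]; exact add_mem h h')
    refine AddSubgroup.iSup_induction _ (C := fun y => x * y ∈ ⨆ p, homogeneous M A p) hy
      (fun q y hy => ?_) (by simp) (fun y y' h h' => by rw [mul_add]; exact add_mem h h')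
    exact AddSubgroup.mem_iSup_of_mem (p + q) (mul_mem_homogeneous M A hx hy)

end graded

section cohomology
variable {k H ι : Type*} [CommRing k] [CharP k 2] [Ring H] [Bialgebra k H] [AddCommGroup ι]
  (M : ι → AddSubgroup k) (A : ι → AddSubgroup H) [SetLike.GradedMonoid M]

/-- The ring of cocycles. -/
def cocycles : Subring (BarCochain k H) where
  carrier := {x | x ∈ total M A ∧ d x = 0}
  zero_mem' := ⟨zero_mem _, d_zero⟩
  one_mem' := ⟨one_mem _, d_one⟩
  add_mem' := fun {x y} hx hy => ⟨add_mem hx.1 hy.1, by rw [d_add, hx.2, hy.2, add_zero]⟩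
  neg_mem' := fun {x} hx => ⟨neg_mem hx.1, by
    have := map_neg (dHom k H) x
    exact this.trans (by rw [show dHom k H x = 0 from hx.2, neg_zero])⟩
  mul_mem' := fun {x y} hx hy => ⟨mul_mem hx.1 hy.1, by
    rw [d_mul, hx.2, hy.2, zero_mul, mul_zero, add_zero]⟩

/-- The ideal of coboundaries. -/
def coboundaries : Ideal (cocycles M A) where
  carrier := {z | ∃ x ∈ total M A, d x = z}
  zero_mem' := ⟨0, zero_mem _, d_zero⟩
  add_mem' := by
    rintro _ _ ⟨x, hx, h⟩ ⟨y, hy, h'⟩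
    exact ⟨x + y, add_mem hx hy, by rw [d_add, h, h']; rfl⟩
  smul_mem' := by
    rintro z _ ⟨x, hx, h⟩
    exact ⟨z * x, mul_mem z.2.1 hx, by rw [d_mul, z.2.2, zero_mul, zero_add, h]; rfl⟩

instance : (coboundaries M A).IsTwoSided := ⟨by
  rintro _ z ⟨x, hx, h⟩
  exact ⟨x * z, mul_mem hx z.2.1, by rw [d_mul, z.2.2, mul_zero, add_zero, h]; rfl⟩⟩

end cohomology
end BarCochain

/-- The ring `Ext_H(k, k)`, the cohomology of the bar complex, for the gradings `M` of `k` and `A` of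
`H`. It is the sum of its homogeneous parts `ExtRing.deg`. -/
abbrev ExtRing {k H ι : Type*} [CommRing k] [CharP k 2] [Ring H] [Bialgebra k H] [AddCommGroup ι]
    (M : ι → AddSubgroup k) (A : ι → AddSubgroup H) [SetLike.GradedMonoid M] : Type _ :=
  BarCochain.cocycles M A ⧸ BarCochain.coboundaries M A

namespace ExtRing
variable {k H ι : Type*} [CommRing k] [CharP k 2] [Ring H] [Bialgebra k H] [AddCommGroup ι]
  (M : ι → AddSubgroup k) (A : ι → AddSubgroup H) [SetLike.GradedMonoid M]

/-- The cohomology class of a cocycle. -/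
def cls : BarCochain.cocycles M A →+* ExtRing M A := Ideal.Quotient.mk _

/-- The homogeneous part of degree `p = (f, e)`: the classes of the cocycles of cohomological degree `f`
and internal degree `e`. -/
def deg (p : ℤ × ι) : AddSubgroup (ExtRing M A) :=
  ((BarCochain.homogeneous M A p).comap (BarCochain.cocycles M A).subtype.toAddMonoidHom).map
    (cls M A).toAddMonoidHom

theorem mul_mem_deg {p q : ℤ × ι} {x y : ExtRing M A} (hx : x ∈ deg M A p) (hy : y ∈ deg M A q) :
    x * y ∈ deg M A (p + q) := by
  obtain ⟨x, hx, rfl⟩ := hx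
  obtain ⟨y, hy, rfl⟩ := hy
  exact ⟨x * y, BarCochain.mul_mem_homogeneous M A hx hy, map_mul (cls M A) x y⟩

theorem one_mem_deg : (1 : ExtRing M A) ∈ deg M A 0 :=
  ⟨1, BarCochain.one_mem_homogeneous M A, map_one (cls M A)⟩

/-- The subring of sums of homogeneous elements with degrees in `S`. -/
def degreePart (S : AddSubmonoid (ℤ × ι)) : Subring (ExtRing M A) where
  __ := ⨆ p : S, deg M A p
  one_mem' := AddSubgroup.mem_iSup_of_mem (0 : S) (one_mem_deg M A)
  mul_mem' := by
    intro x y hx hy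
    change x ∈ ⨆ p : S, deg M A p at hx
    change y ∈ ⨆ p : S, deg M A p at hy
    change x * y ∈ ⨆ p : S, deg M A p
    refine AddSubgroup.iSup_induction _ (C := fun x => x * y ∈ ⨆ p : S, deg M A p) hx
      (fun p x hx => ?_) (by simp) (fun x x' h h' => by rw [add_mul]; exact add_mem h h')
    refine AddSubgroup.iSup_induction _ (C := fun y => x * y ∈ ⨆ p : S, deg M A p) hy
      (fun q y hy => ?_) (by simp) (fun y y' h h' => by rw [mul_add]; exact add_mem h h')
    exact AddSubgroup.mem_iSup_of_mem (p + q) (mul_mem_deg M A hx hy)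

end ExtRing

namespace BarCochain

section cup
variable {k H : Type*} [CommRing k] [Ring H] [Bialgebra k H]

/-- The product of two functions of `n` variables dual to the coproduct of `H`:
`(x ⋆ y)(a₁, …, aₙ) = ∑ x(a₁', …, aₙ') y(a₁'', …, aₙ'')`, where `Δ aᵢ = ∑ aᵢ' ⊗ aᵢ''`. For
multilinear `x` and `y` it does not depend on the way in which the `Δ aᵢ` are written as sums. -/
noncomputable def star (x y : BarCochain k H) : BarCochain k H
  | [] => x [] * y []
  | a :: l => ∑ i ∈ (Coalgebra.Repr.arbitrary k a).index,
      star (x.shift ((Coalgebra.Repr.arbitrary k a).left i))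
        (y.shift ((Coalgebra.Repr.arbitrary k a).right i)) l

/-- For blocks `B₀, B₁, B₂, …`, the value `x(B₀, ∏ B₁, B₂, ∏ B₃, …)`, where the variables in the
blocks of even index are kept, those in a block of odd index are multiplied together, and a last
block of odd index gives the factor `ε(∏ B)`. This is the coface of `x` that belongs to the vertices
in the even blocks. -/
noncomputable def evalEven : BarCochain k H → List (List H) → k
  | x, [] => x []
  | x, [B] => x B
  | x, [B, C] => x B * Coalgebra.counit (R := k) C.prod
  | x, B :: C :: D :: L => evalEven (fun l => x (B ++ C.prod :: l)) (D :: L)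

/-- The same with the even and the odd blocks exchanged: `ε(∏ B₀) x(B₁, ∏ B₂, B₃, …)`. -/
noncomputable def evalOdd (x : BarCochain k H) : List (List H) → k
  | [] => x []
  | B :: L => Coalgebra.counit (R := k) B.prod * evalEven x L

/-- Steenrod's cup-`i` product on the bar complex: the sum, over all ways to cut `(a₁, …, aₙ)` into
consecutive blocks `B₀, …, Bᵢ₊₁` such that `B₁, …, Bᵢ` are nonempty, of the
product `⋆` of the coface of `x` on the even blocks and the coface of `y` on the odd blocks. -/
noncomputable def cup (i : ℕ) (x y : BarCochain k H) : BarCochain k H := fun l =>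
  ∑ n ∈ (Finset.Nat.antidiagonalTuple (i + 2) l.length).filter
      (fun n => ∀ j, j ≠ 0 → j ≠ Fin.last (i + 1) → 0 < n j),
    star (fun m => evalEven x ((List.ofFn n).splitLengths m))
      (fun m => evalOdd y ((List.ofFn n).splitLengths m)) l

end cup
end BarCochain

namespace ExtRing
variable {k H ι : Type*} [CommRing k] [CharP k 2] [Ring H] [Bialgebra k H] [AddCommGroup ι]
  (M : ι → AddSubgroup k) (A : ι → AddSubgroup H) [SetLike.GradedMonoid M]

/-- The value of the squaring operation `Sq^r : Ext^(f, e) → Ext^(f + r, 2 e)`, for `r ≤ f`, at `x`: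
the class of `z ∪_(f - r) z` for cocycles `z` that represent `x`. -/
def squaring (f r : ℕ) (e : ι) (x : ExtRing M A) : Set (ExtRing M A) :=
  {y | ∃ z w : BarCochain.cocycles M A,
    (z : BarCochain k H) ∈ BarCochain.homogeneous M A ((f : ℤ), e) ∧ cls M A z = x ∧
    (w : BarCochain k H) ∈ BarCochain.homogeneous M A ((f : ℤ) + (r : ℤ), e + e) ∧
    (w : BarCochain k H) = BarCochain.cup (f - r) (z : BarCochain k H) z ∧ cls M A w = y}

/-- The `n`-fold Massey product `⟨x₀, …, xₙ₋₁⟩` of elements `xᵢ` of degree `p i`: the set of the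
classes of `∑ a₀ₘ aₘₙ` for all defining systems `(aᵢⱼ)`, consisting of homogeneous cochains, where `aᵢⱼ`
has `d aᵢⱼ = ∑ aᵢₘ aₘⱼ` and `aᵢ,ᵢ₊₁` represents `xᵢ`. -/
def massey (n : ℕ) (p : ℕ → ℤ × ι) (x : ℕ → ExtRing M A) : Set (ExtRing M A) :=
  {y | ∃ a : ℕ → ℕ → BarCochain k H,
    (∀ i j, i < j → j ≤ n → (i, j) ≠ (0, n) →
      a i j ∈ BarCochain.homogeneous M A ((∑ m ∈ Finset.Ico i j, p m) - ((j : ℤ) - i - 1, 0)) ∧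
      BarCochain.d (a i j) = ∑ m ∈ Finset.Ioo i j, a i m * a m j) ∧
    (∀ i < n, ∃ z : BarCochain.cocycles M A, (z : BarCochain k H) = a i (i + 1) ∧ cls M A z = x i) ∧
    ∃ w : BarCochain.cocycles M A,
      (w : BarCochain k H) = ∑ m ∈ Finset.Ioo 0 n, a 0 m * a m n ∧ cls M A w = y}

end ExtRing

/-! ### The classical Steenrod algebra -/

/-- The classical mod 2 Steenrod algebra. -/
abbrev ClassicalSteenrod : Type := Steenrod.SteenrodAlg (ZMod 2) 1

/-- `F₂`, concentrated in degree `0`. -/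
def classicalBase (t : ℤ) : AddSubgroup (ZMod 2) where
  carrier := {c | c ≠ 0 → t = 0}
  zero_mem' := fun h => absurd rfl h
  add_mem' := by
    intro a b ha hb h
    by_cases h0 : a = 0
    · exact hb (by rintro rfl; exact h (by rw [h0, add_zero]))
    · exact ha h0
  neg_mem' := fun h h0 => h (by simpa using h0)

instance : SetLike.GradedMonoid classicalBase where
  one_mem := fun _ => rfl
  mul_mem := by
    intro s t a b ha hb h
    rw [ha (left_ne_zero_of_mul h), hb (right_ne_zero_of_mul h), add_zero]

/-- The internal grading: the monomial `Sq^(i₁) ⋯ Sq^(iᵣ)` has degree `i₁ + ⋯ + iᵣ`. -/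
def classicalGrading (t : ℤ) : AddSubgroup ClassicalSteenrod :=
  AddSubgroup.closure {x | ∃ l : List ℕ, (l.sum : ℤ) = t ∧ x = (l.map (Steenrod.SteenrodAlg.Sq 1)).prod}

/-- The bigraded ring `Ext` over the classical Steenrod algebra. -/
abbrev ExtCl : Type := ExtRing classicalBase classicalGrading

/-- The part of degree `(s, f)`, with stem `s` and Adams filtration `f`; the internal degree is `s + f`. -/
noncomputable def ExtCl.deg (s f : ℤ) : AddSubgroup ExtCl :=
  ExtRing.deg classicalBase classicalGrading (f, s + f)
/-- The value of `Sq^r` at `x` of degree `(s, f)`. -/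
noncomputable def ExtCl.squaring (s : ℤ) (f r : ℕ) (x : ExtCl) : Set ExtCl :=
  ExtRing.squaring classicalBase classicalGrading f r (s + f) x

/-- The `n`-fold Massey product of elements `x i` of degrees `(s i, f i)`, for `i < n`. -/
noncomputable def ExtCl.massey (n : ℕ) (s f : ℕ → ℤ) (x : ℕ → ExtCl) : Set ExtCl :=
  ExtRing.massey classicalBase classicalGrading n (fun i => (f i, s i + f i)) x

/-! ### The motivic Steenrod algebra over `ℂ` -/

/-- `M₂ = F₂[τ]`, the mod 2 motivic cohomology of `ℂ`. -/
abbrev M2 : Type := (ZMod 2)[X]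

/-- The mod 2 motivic Steenrod algebra over `ℂ`; the parameter is the variable `τ` of `M₂ = F₂[τ]`. -/
abbrev MotivicSteenrod : Type := Steenrod.SteenrodAlg M2 X

/-- The bigrading of `M₂`: `τ ^ j` has degree `(0, j)`. -/
def motivicBase (e : ℤ × ℤ) : AddSubgroup M2 where
  carrier := {c | ∀ j : ℕ, c.coeff j ≠ 0 → e = (0, (j : ℤ))}
  zero_mem' := fun j h => absurd (coeff_zero j) h
  add_mem' := by
    intro a b ha hb j h
    by_cases h0 : a.coeff j = 0
    · exact hb j (fun h1 => h (by rw [coeff_add, h0, h1, add_zero]))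
    · exact ha j h0
  neg_mem' := fun h j h0 => h j (by simpa using h0)

instance : SetLike.GradedMonoid motivicBase where
  one_mem := by
    intro j h
    rw [coeff_one] at h
    have : j = 0 := by by_contra h1; exact h (if_neg h1)
    rw [this]; rfl
  mul_mem := by
    intro d e a b ha hb j h
    rw [coeff_mul] at h
    obtain ⟨⟨i, m⟩, him, h1⟩ := Finset.exists_ne_zero_of_sum_ne_zero h
    rw [ha i (left_ne_zero_of_mul h1), hb m (right_ne_zero_of_mul h1)]
    have : i + m = j := Finset.HasAntidiagonal.mem_antidiagonal.1 him
    rw [← this]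
    simp

/-- The bigrading of the motivic Steenrod algebra: `Sq^i` has degree `(i, ⌊i / 2⌋)` and `τ` has degree
`(0, 1)`. -/
noncomputable def motivicGrading (e : ℤ × ℤ) : AddSubgroup MotivicSteenrod :=
  AddSubgroup.closure {x | ∃ (j : ℕ) (l : List ℕ),
    e = ((l.sum : ℤ), (j : ℤ) + ((l.map (· / 2)).sum : ℕ)) ∧
    x = (X ^ j : M2) • (l.map (Steenrod.SteenrodAlg.Sq (X : M2))).prod}

/-- The trigraded ring `Ext_A(M₂, M₂)` over the motivic Steenrod algebra. -/
abbrev ExtMot : Type := ExtRing motivicBase motivicGrading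

/-- The part of degree `(s, f, w)`, with stem `s`, Adams filtration `f` and weight `w`; the internal
bidegree is `(s + f, w)`. -/
noncomputable def ExtMot.deg (s f w : ℤ) : AddSubgroup ExtMot :=
  ExtRing.deg motivicBase motivicGrading (f, (s + f, w))

/-- The degrees `(f, (t, w))` with `t - 2 w = 0`, that is, `s + f - 2 w = 0` for the stem `s = t - f`. -/
def chowZeroDegrees : AddSubmonoid (ℤ × (ℤ × ℤ)) where
  carrier := {p | p.2.1 - 2 * p.2.2 = 0}
  zero_mem' := by simp
  add_mem' := by
    intro p q hp hq
    simp only [Set.mem_ofPred_eq, Prod.snd_add, Prod.fst_add] at *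
    linarith

/-- The subalgebra of `Ext` of the elements in degrees `(s, f, w)` with `s + f - 2 w = 0`. -/
noncomputable def ExtMot.chowZero : Subring ExtMot :=
  ExtRing.degreePart motivicBase motivicGrading chowZeroDegrees

/-- The value of `Sq^r` at `x` of degree `(s, f, w)`. -/
noncomputable def ExtMot.squaring (s : ℤ) (f : ℕ) (w : ℤ) (r : ℕ) (x : ExtMot) : Set ExtMot :=
  ExtRing.squaring motivicBase motivicGrading f r (s + f, w) x

/-- The `n`-fold Massey product of elements `x i` of degrees `(s i, f i, w i)`, for `i < n`. -/
noncomputable def ExtMot.massey (n : ℕ) (s f w : ℕ → ℤ) (x : ℕ → ExtMot) : Set ExtMot :=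
  ExtRing.massey motivicBase motivicGrading n (fun i => (f i, (s i + f i, w i))) x

/-!
The Chow degree of an element of internal bidegree `(t, w)` is `t - 2 w`. In the motivic Steenrod algebra
`A` the squares `Sq^(2 n)` have Chow degree `0`, the squares `Sq^(2 n + 1)` have Chow degree `1`, and `τ` has
Chow degree `-2`. The isomorphism comes from the part of Chow degree zero of the bar complex of `A`, which is
a copy of the bar complex of the classical Steenrod algebra `A_cl`, with degrees doubled.

For even `a` and `b` the motivic Adem relations reduce modulo `τ` and the odd squares to the classical ones
for `a / 2` and `b / 2`. Hence `Sq^(2 n) ↦ Sq^n`, `Sq^(2 n + 1) ↦ 0`, `τ ↦ 0` defines a surjective homomorphism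
of bialgebras `red : A → A_cl` over `F₂[τ] → F₂`, whose kernel is the ideal generated by `τ` and the odd squares
(`red_surjective`, `counit_red`, `comul_red`, `mem_span_kerGenerators_of_red_eq_zero`). Putting `τ ↦ τ`
instead, it lifts to `polyRed : A → A_cl[τ]`.

Let `x` be a motivic cochain of Chow degree zero. Monomials in the squares have nonnegative Chow degree, so
that the value of `x` at a list of monomials is a polynomial in `τ` of Chow degree at least `0`, that is, a
constant; it is `0` if one of the monomials has an odd factor. Therefore `x` is determined by the constant
terms of its values (`eq_of_coeff_zero_eq`), and these depend only on the images of the variables under `red`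
(`coeff_zero_eq_of_map_red_eq`). This makes `x` the pullback of a classical cochain, its reduction
(`reduces_reduction`). Conversely each classical cochain `y` has the `F₂[τ]`-multilinear extension `extend y`
along `polyRed`, which has Chow degree zero and the reduction `y` (`extend_mem_homogeneous`,
`reduces_extend`). So cochains in Chow degree zero correspond to classical cochains.

The relation `Reduces x y` is compatible with sums, products, the differential and, as `red` is a
homomorphism of coalgebras, with the cup-`i` products. By uniqueness of both sides (`Reduces.left_unique`,
`Reduces.right_unique`), an identity between classical cochains can be transported to the motivic bar complex
and back. This gives a homomorphism `extMap` of the cohomology rings. It is injective, because a coboundary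
in Chow degree zero has a primitive in Chow degree zero (`exists_primitive`), and its image is the part in
Chow degree zero. The cocycles `z ∪_(f - r) z` and the defining systems of Massey products
of classes in Chow degree zero consist of cochains in Chow degree zero, hence correspond to the classical
ones; here the cup-`i` product is known to have Chow degree zero by inspection of its definition
(`trunc_cup_mem_homogeneous`).
-/

/-! ### Spanning monomials and reduction of the Adem relations -/

namespace Steenrod

/-- The coefficients of the Adem relations between the even squares, modulo `2`. -/
theorem choose_two_mul_cast {k : Type*} [CommRing k] [CharP k 2] (m r : ℕ) :
    (((2 * m + 1).choose (2 * r) : ℕ) : k) = (m.choose r : ℕ) := by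
  rw [CharP.cast_eq_iff_mod_eq k 2]
  have h := Choose.choose_modEq_choose_mod_mul_choose_div_nat (n := 2 * m + 1) (k := 2 * r) (p := 2)
  rw [show (2 * m + 1) % 2 = 1 by omega, show 2 * r % 2 = 0 by omega,
    show (2 * m + 1) / 2 = m by omega, show 2 * r / 2 = r by omega] at h
  rw [Nat.choose_zero_right, one_mul] at h
  exact h

theorem sum_range_eq_sum_even {V : Type*} [AddCommMonoid V] (a : ℕ) (F : ℕ → V)
    (hF : ∀ c, Odd c → F c = 0) :
    ∑ c ∈ Finset.range (a + 1), F c = ∑ c ∈ Finset.range (a / 2 + 1), F (2 * c) := by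
  induction a using Nat.twoStepInduction with
  | zero => simp
  | one => simp [Finset.sum_range_succ, hF 1 odd_one]
  | more a ih _ =>
    rw [show (a + 2) / 2 + 1 = (a / 2 + 1) + 1 by omega, Finset.sum_range_succ _ (a / 2 + 1), ← ih,
      Finset.sum_range_succ _ (a + 2), Finset.sum_range_succ _ (a + 1)]
    rcases Nat.even_or_odd' a with ⟨b, rfl | rfl⟩
    · rw [hF (2 * b + 1) ⟨b, rfl⟩, add_zero, show 2 * (2 * b / 2 + 1) = 2 * b + 2 by omega]
    · rw [hF (2 * b + 1 + 2) ⟨b + 1, by ring⟩, add_zero,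
        show 2 * ((2 * b + 1) / 2 + 1) = 2 * b + 1 + 1 by omega]

/-- If the odd terms of `s` vanish, then the Adem relations between the even terms are the
Adem relations with parameter `1` for `n ↦ s (2 * n)`. -/
theorem adem_even_sum {k k' B : Type*} [CommRing k] [CharP k 2] [CommRing k'] [CharP k' 2] [Ring B]
    [Algebra k B] [Algebra k' B] (τ : k) (s : ℕ → B) (hs : ∀ n, Odd n → s n = 0) (a b : ℕ)
    (hab : a < 2 * b) :
    ∑ c ∈ Finset.range (2 * a / 2 + 1), (((2 * b - 1 - c).choose (2 * a - 2 * c) : k) *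
        τ ^ (2 * a / 2 + 2 * b / 2 - ((2 * a + 2 * b - c) / 2 + c / 2))) •
          (s (2 * a + 2 * b - c) * s c)
      = ∑ c ∈ Finset.range (a / 2 + 1), (((b - 1 - c).choose (a - 2 * c) : k') *
        1 ^ (a / 2 + b / 2 - ((a + b - c) / 2 + c / 2))) • (s (2 * (a + b - c)) * s (2 * c)) := by
  rw [show 2 * a / 2 = a by omega, sum_range_eq_sum_even]
  · refine Finset.sum_congr rfl fun c hc => ?_
    simp only [Finset.mem_range] at hc
    rw [show a + 2 * b / 2 - ((2 * a + 2 * b - 2 * c) / 2 + 2 * c / 2) = 0 by omega, pow_zero,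
      one_pow, mul_one, mul_one, show 2 * b - 1 - 2 * c = 2 * (b - 1 - c) + 1 by omega,
      show 2 * a - 2 * (2 * c) = 2 * (a - 2 * c) by omega, choose_two_mul_cast,
      show 2 * a + 2 * b - 2 * c = 2 * (a + b - c) by omega, Nat.cast_smul_eq_nsmul,
      Nat.cast_smul_eq_nsmul]
  · intro c hc
    rw [hs c hc, mul_zero, smul_zero]

/-- A sequence with vanishing odd terms satisfies the Adem relations with any parameter `τ` as soon as
its even terms satisfy those with parameter `1`. -/
theorem SatisfiesAdem.of_even {k k' B : Type*} [CommRing k] [CharP k 2] [CommRing k'] [CharP k' 2]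
    [Ring B] [Algebra k B] [Algebra k' B] (τ : k) {s : ℕ → B} (hs : ∀ n, Odd n → s n = 0)
    (h : SatisfiesAdem (1 : k') fun n => s (2 * n)) : SatisfiesAdem τ s := by
  refine ⟨h.1, fun a b ha hab => ?_⟩
  rcases Nat.even_or_odd' a with ⟨a, rfl | rfl⟩
  · rcases Nat.even_or_odd' b with ⟨b, rfl | rfl⟩
    · rw [adem_even_sum (k' := k') τ s hs a b (by omega)]
      exact h.2 a b (by omega) (by omega)
    · rw [hs _ ⟨b, rfl⟩, mul_zero, eq_comm]
      refine Finset.sum_eq_zero fun c hc => ?_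
      simp only [Finset.mem_range] at hc
      rcases Nat.even_or_odd c with hc2 | hc2
      · rw [hs (2 * a + (2 * b + 1) - c), zero_mul, smul_zero]
        rw [Nat.even_iff] at hc2; rw [Nat.odd_iff]; omega
      · rw [hs c hc2, mul_zero, smul_zero]
  · rw [hs _ ⟨a, rfl⟩, zero_mul, eq_comm]
    refine Finset.sum_eq_zero fun c hc => ?_
    simp only [Finset.mem_range] at hc
    rcases Nat.even_or_odd c with hc2 | hc2
    · rcases Nat.even_or_odd' b with ⟨b, rfl | rfl⟩
      · rw [hs (2 * a + 1 + 2 * b - c), zero_mul, smul_zero]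
        rw [Nat.even_iff] at hc2; rw [Nat.odd_iff]; omega
      · rw [choose_cast_zero, zero_mul, zero_smul]
        · rw [Nat.even_iff] at hc2 ⊢; omega
        · rw [Nat.even_iff] at hc2; rw [Nat.odd_iff]; omega
    · rw [hs c hc2, mul_zero, smul_zero]

namespace SteenrodAlg
variable {k : Type*} [CommRing k] (τ : k)

/-- The monomial `Sq^(i₁) ⋯ Sq^(iᵣ)`. -/
noncomputable def mono (l : List ℕ) : SteenrodAlg k τ := (l.map (Sq τ)).prod

theorem mono_append (l m : List ℕ) : mono τ (l ++ m) = mono τ l * mono τ m := by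
  simp [mono]

theorem mono_nil : mono τ [] = 1 := rfl

theorem mono_cons (n : ℕ) (l : List ℕ) : mono τ (n :: l) = Sq τ n * mono τ l := by
  simp [mono]

theorem span_range_mono : Submodule.span k (Set.range (mono τ)) = ⊤ := by
  have h1 : Algebra.adjoin k (Set.range (Sq τ)) = ⊤ := by
    rw [eq_top_iff]
    rintro x -
    obtain ⟨x, rfl⟩ := RingQuot.mkAlgHom_surjective k (AdemRel τ) x
    induction x using FreeAlgebra.induction with
    | grade0 r => rw [AlgHom.commutes]; exact Subalgebra.algebraMap_mem _ r
    | grade1 n => exact Algebra.subset_adjoin ⟨n, rfl⟩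
    | mul a b ha hb => rw [map_mul]; exact mul_mem ha hb
    | add a b ha hb => rw [map_add]; exact add_mem ha hb
  have h2 := congrArg Subalgebra.toSubmodule h1
  rw [Algebra.adjoin_eq_span, Algebra.top_toSubmodule] at h2
  rw [← h2]
  refine le_antisymm (Submodule.span_mono ?_) (Submodule.span_mono ?_)
  · rintro _ ⟨l, rfl⟩
    exact Submonoid.list_prod_mem _ fun x hx => by
      obtain ⟨n, _, rfl⟩ := List.mem_map.1 hx
      exact Submonoid.subset_closure ⟨n, rfl⟩
  · intro x hx
    obtain ⟨L, hL, rfl⟩ := Submonoid.exists_list_of_mem_closure hx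
    clear hx
    induction L with
    | nil => exact ⟨[], rfl⟩
    | cons z L ih =>
      obtain ⟨l, hl⟩ := ih fun y hy => hL y (List.mem_cons_of_mem _ hy)
      obtain ⟨n, rfl⟩ := hL z List.mem_cons_self
      exact ⟨n :: l, by rw [mono_cons, hl, List.prod_cons]⟩

theorem augmentation_mono_of_ne {l : List ℕ} (h : l.sum ≠ 0) : augmentation τ (mono τ l) = 0 := by
  induction l with
  | nil => exact absurd rfl h
  | cons n l ih =>
    rw [mono_cons, map_mul, augmentation_Sq]
    by_cases hn : n = 0
    · rw [ih (by simpa [hn] using h), mul_zero]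
    · rw [if_neg hn, zero_mul]

theorem augmentation_mono_of_eq {l : List ℕ} (h : l.sum = 0) : augmentation τ (mono τ l) = 1 := by
  induction l with
  | nil => exact map_one _
  | cons n l ih =>
    simp only [List.sum_cons, Nat.add_eq_zero_iff] at h
    rw [mono_cons, map_mul, augmentation_Sq, ih h.2, if_pos h.1, one_mul]

theorem counit_eq [CharP k 2] (a : SteenrodAlg k τ) :
    Coalgebra.counit (R := k) a = augmentation τ a := rfl

theorem comul_eq [CharP k 2] (a : SteenrodAlg k τ) :
    Coalgebra.comul (R := k) a = coproduct τ a := rfl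

end SteenrodAlg
end Steenrod

/-! ### The reduction homomorphism -/

namespace Steenrod
open SteenrodAlg

/-- `n ↦ Sq^(n / 2)` for even `n`, and `0` for odd `n`. -/
noncomputable def halfSq (n : ℕ) : ClassicalSteenrod := if Even n then Sq 1 (n / 2) else 0

theorem halfSq_odd {n : ℕ} (h : Odd n) : halfSq n = 0 := if_neg (Nat.not_even_iff_odd.2 h)

theorem halfSq_two_mul (n : ℕ) : halfSq (2 * n) = Sq 1 n := by
  rw [halfSq, if_pos (even_two_mul n), Nat.mul_div_cancel_left n two_pos]

/-- `A_cl[X]` as an algebra over `F₂[X]`. -/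
noncomputable abbrev polyAlgebra : Algebra M2 ClassicalSteenrod[X] :=
  (mapRingHom (algebraMap (ZMod 2) ClassicalSteenrod)).toAlgebra' fun z p => map_comm z p

theorem satisfiesAdem_C_halfSq :
    @SatisfiesAdem M2 ClassicalSteenrod[X] _ X _ polyAlgebra fun n => C (halfSq n) := by
  let _ := polyAlgebra
  refine SatisfiesAdem.of_even (k' := ZMod 2) X (fun n hn => by simp only [halfSq_odd hn, map_zero]) ?_
  simp only [halfSq_two_mul]
  exact (satisfiesAdem_Sq (1 : ZMod 2)).map (CAlgHom (R := ZMod 2))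

/-- The homomorphism `A → A_cl[τ]` with `Sq^(2 n) ↦ Sq^n`, `Sq^(2 n + 1) ↦ 0` and `τ ↦ τ`. It is dual
to the inclusion of `F₂[τ][ξ₁, ξ₂, …]` into the dual motivic Steenrod algebra. -/
noncomputable def polyRed : MotivicSteenrod →+* ClassicalSteenrod[X] :=
  letI := polyAlgebra
  (SteenrodAlg.lift (τ := (X : M2)) (fun n => C (halfSq n)) satisfiesAdem_C_halfSq).toRingHom

theorem polyRed_Sq (n : ℕ) : polyRed (Sq X n) = C (halfSq n) :=
  letI := polyAlgebra
  lift_Sq (τ := (X : M2)) (fun n => C (halfSq n)) satisfiesAdem_C_halfSq n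

theorem polyRed_smul (c : M2) (a : MotivicSteenrod) :
    polyRed (c • a) = c.map (algebraMap (ZMod 2) ClassicalSteenrod) * polyRed a := by
  let _ := polyAlgebra
  refine (map_smul (SteenrodAlg.lift (τ := (X : M2)) (fun n => C (halfSq n))
    satisfiesAdem_C_halfSq) c a).trans ?_
  rw [Algebra.smul_def]
  rfl

/-- The homomorphism `A → A_cl` with `Sq^(2 n) ↦ Sq^n`, `Sq^(2 n + 1) ↦ 0` and `τ ↦ 0`. -/
noncomputable def red : MotivicSteenrod →+* ClassicalSteenrod := constantCoeff.comp polyRed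

theorem red_apply (a : MotivicSteenrod) : red a = (polyRed a).coeff 0 := rfl

theorem red_Sq (n : ℕ) : red (Sq X n) = halfSq n := by
  rw [red_apply, polyRed_Sq, coeff_C_zero]

theorem red_smul (c : M2) (a : MotivicSteenrod) : red (c • a) = c.coeff 0 • red a := by
  rw [red_apply, polyRed_smul, mul_coeff_zero, coeff_map, red_apply, Algebra.smul_def]

theorem polyRed_mono (l : List ℕ) : polyRed (mono X l) = C (l.map halfSq).prod := by
  induction l with
  | nil => simp [mono]
  | cons n l ih => rw [mono_cons, map_mul, polyRed_Sq, ih, List.map_cons, List.prod_cons, map_mul]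

theorem prod_halfSq_of_odd {l : List ℕ} {n : ℕ} (hn : n ∈ l) (ho : Odd n) :
    (l.map halfSq).prod = 0 := List.prod_eq_zero (List.mem_map.2 ⟨n, hn, halfSq_odd ho⟩)

theorem exists_eq_map_two_mul {l : List ℕ} (h : ∀ n ∈ l, ¬ Odd n) :
    ∃ m : List ℕ, l = m.map (2 * ·) := by
  induction l with
  | nil => exact ⟨[], rfl⟩
  | cons n l ih =>
    obtain ⟨m, rfl⟩ := ih fun n hn => h n (List.mem_cons_of_mem _ hn)
    obtain ⟨p, hp⟩ := Nat.not_odd_iff_even.1 (h n List.mem_cons_self)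
    exact ⟨p :: m, by rw [hp, ← two_mul]; rfl⟩

theorem prod_halfSq_two_mul (m : List ℕ) : ((m.map (2 * ·)).map halfSq).prod = mono 1 m := by
  rw [List.map_map, mono]
  congr 1
  exact List.map_congr_left fun n _ => halfSq_two_mul n

theorem red_mono_two_mul (m : List ℕ) : red (mono X (m.map (2 * ·))) = mono 1 m := by
  rw [red_apply, polyRed_mono, coeff_C_zero, prod_halfSq_two_mul]

theorem red_surjective : Function.Surjective red := by
  intro b
  have hb : b ∈ Submodule.span (ZMod 2) (Set.range (mono 1)) := by
    rw [span_range_mono]; trivial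
  induction hb using Submodule.span_induction with
  | mem b hb =>
    obtain ⟨l, rfl⟩ := hb
    exact ⟨_, red_mono_two_mul l⟩
  | zero => exact ⟨0, map_zero _⟩
  | add b c _ _ hb hc =>
    obtain ⟨b, rfl⟩ := hb
    obtain ⟨c, rfl⟩ := hc
    exact ⟨b + c, map_add _ _ _⟩
  | smul r b _ hb =>
    obtain ⟨b, rfl⟩ := hb
    exact ⟨(C r : M2) • b, by rw [red_smul, coeff_C_zero]⟩

theorem counit_red (a : MotivicSteenrod) :
    Coalgebra.counit (R := ZMod 2) (red a) = (Coalgebra.counit (R := M2) a).coeff 0 := by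
  have ha : a ∈ Submodule.span M2 (Set.range (mono X)) := by
    rw [span_range_mono]; trivial
  induction ha using Submodule.span_induction with
  | mem b hb =>
    obtain ⟨l, rfl⟩ := hb
    rw [counit_eq, counit_eq]
    induction l with
    | nil => simp [mono]
    | cons n l ih =>
      rw [mono_cons, map_mul, map_mul, map_mul, mul_coeff_zero, ih, red_Sq, augmentation_Sq]
      congr 1
      rcases Nat.even_or_odd' n with ⟨m, rfl | rfl⟩
      · rw [halfSq_two_mul, augmentation_Sq]
        by_cases hm : m = 0 <;> simp [hm]
      · rw [halfSq_odd ⟨m, rfl⟩]; simp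
  | zero => simp
  | add b c _ _ hb hc => rw [map_add, map_add, map_add, coeff_add, hb, hc]
  | smul r b _ hb => rw [red_smul, map_smul, map_smul, hb, smul_eq_mul, smul_eq_mul, mul_coeff_zero]

/-- `red` as a semilinear map over `τ ↦ 0`. -/
noncomputable def redLin : MotivicSteenrod →ₛₗ[(constantCoeff : M2 →+* ZMod 2)] ClassicalSteenrod where
  toFun := red
  map_add' := map_add red
  map_smul' := red_smul

/-- `red` is a homomorphism of coalgebras. -/
theorem comul_red (a : MotivicSteenrod) :
    Coalgebra.comul (R := ZMod 2) (red a)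
      = TensorProduct.map redLin redLin (Coalgebra.comul (R := M2) a) := by
  have hmul : ∀ x y : MotivicSteenrod ⊗[M2] MotivicSteenrod,
      TensorProduct.map redLin redLin (x * y)
        = TensorProduct.map redLin redLin x * TensorProduct.map redLin redLin y := by
    intro x y
    induction x with
    | zero => simp
    | add x x' hx hx' => rw [add_mul, map_add, map_add, add_mul, hx, hx']
    | tmul a b =>
      induction y with
      | zero => simp
      | add y y' hy hy' => rw [mul_add, map_add, map_add, mul_add, hy, hy']
      | tmul c d =>
        simp only [Algebra.TensorProduct.tmul_mul_tmul, TensorProduct.map_tmul]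
        congr 1 <;> exact map_mul red _ _
  have ha : a ∈ Submodule.span M2 (Set.range (mono X)) := by
    rw [span_range_mono]; trivial
  induction ha using Submodule.span_induction with
  | mem b hb =>
    obtain ⟨l, rfl⟩ := hb
    rw [comul_eq, comul_eq]
    induction l with
    | nil =>
      rw [mono_nil, map_one, map_one, map_one, Algebra.TensorProduct.one_def,
        Algebra.TensorProduct.one_def, TensorProduct.map_tmul]
      congr 1 <;> exact (map_one red).symm
    | cons n l ih =>
      rw [mono_cons, map_mul, map_mul, map_mul, hmul, ih]
      congr 1
      rw [red_Sq, coproduct_Sq, map_sum]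
      simp only [map_smulₛₗ, TensorProduct.map_tmul, map_pow]
      rcases Nat.even_or_odd' n with ⟨m, rfl | rfl⟩
      · rw [halfSq_two_mul, coproduct_Sq, sum_range_eq_sum_even (2 * m)]
        · rw [Nat.mul_div_cancel_left m two_pos]
          refine Finset.sum_congr rfl fun i hi => ?_
          simp only [Finset.mem_range] at hi
          rw [show m - (2 * i / 2 + (2 * m - 2 * i) / 2) = 0 by omega, pow_zero, one_smul,
            one_pow, one_smul, show 2 * m - 2 * i = 2 * (m - i) by omega]
          congr 1
          · exact ((red_Sq _).trans (halfSq_two_mul i)).symm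
          · exact ((red_Sq _).trans (halfSq_two_mul (m - i))).symm
        · intro c hc
          have h : redLin (Sq X c) = 0 := (red_Sq c).trans (halfSq_odd hc)
          rw [h, zero_tmul, smul_zero]
      · rw [halfSq_odd ⟨m, rfl⟩, map_zero, eq_comm]
        refine Finset.sum_eq_zero fun i hi => ?_
        simp only [Finset.mem_range] at hi
        rcases Nat.even_or_odd i with h2 | h2
        · have h : redLin (Sq X (2 * m + 1 - i)) = 0 := (red_Sq _).trans (halfSq_odd (by
            rw [Nat.even_iff] at h2; rw [Nat.odd_iff]; omega))
          rw [h, tmul_zero, smul_zero]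
        · have h : redLin (Sq X i) = 0 := (red_Sq i).trans (halfSq_odd h2)
          rw [h, zero_tmul, smul_zero]
  | zero => simp
  | add b c _ _ hb hc => rw [map_add, map_add, map_add, map_add, hb, hc]
  | smul r b _ hb =>
    rw [red_smul, map_smul, map_smul, hb, map_smulₛₗ]
    rfl

/-- The elements `τ a`, and the monomials with an odd factor. -/
def kerGenerators : Set MotivicSteenrod :=
  {a | (∃ b : MotivicSteenrod, a = (X : M2) • b) ∨ ∃ l : List ℕ, (∃ n ∈ l, Odd n) ∧ a = mono X l}

theorem mul_mem_span_kerGenerators (b : MotivicSteenrod) {a : MotivicSteenrod}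
    (ha : a ∈ Submodule.span M2 kerGenerators) :
    b * a ∈ Submodule.span M2 kerGenerators ∧ a * b ∈ Submodule.span M2 kerGenerators := by
  induction ha using Submodule.span_induction with
  | mem a ha =>
    rcases ha with ⟨a, rfl⟩ | ⟨l, ⟨n, hn, ho⟩, rfl⟩
    · exact ⟨Submodule.subset_span (Or.inl ⟨b * a, mul_smul_comm _ _ _⟩),
        Submodule.subset_span (Or.inl ⟨a * b, smul_mul_assoc _ _ _⟩)⟩
    · have hb : b ∈ Submodule.span M2 (Set.range (mono X)) := by
        rw [span_range_mono]; trivial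
      induction hb using Submodule.span_induction with
      | mem b hb =>
        obtain ⟨m, rfl⟩ := hb
        rw [← mono_append, ← mono_append]
        exact ⟨Submodule.subset_span (Or.inr ⟨_, ⟨n, List.mem_append_right _ hn, ho⟩, rfl⟩),
          Submodule.subset_span (Or.inr ⟨_, ⟨n, List.mem_append_left _ hn, ho⟩, rfl⟩)⟩
      | zero => simp
      | add b c _ _ hb hc =>
        rw [add_mul, mul_add]
        exact ⟨add_mem hb.1 hc.1, add_mem hb.2 hc.2⟩
      | smul r b _ hb =>
        rw [smul_mul_assoc, mul_smul_comm]
        exact ⟨Submodule.smul_mem _ _ hb.1, Submodule.smul_mem _ _ hb.2⟩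
  | zero => simp
  | add a c _ _ ha hc =>
    rw [add_mul, mul_add]
    exact ⟨add_mem ha.1 hc.1, add_mem ha.2 hc.2⟩
  | smul r a _ ha =>
    rw [smul_mul_assoc, mul_smul_comm]
    exact ⟨Submodule.smul_mem _ _ ha.1, Submodule.smul_mem _ _ ha.2⟩

/-- The two-sided ideal generated by `τ` and the `Sq^(2 n + 1)`. -/
noncomputable def kerIdeal : Ideal MotivicSteenrod where
  __ := (Submodule.span M2 kerGenerators).toAddSubmonoid
  smul_mem' b _ ha := (mul_mem_span_kerGenerators b ha).1

instance : kerIdeal.IsTwoSided := ⟨fun b ha => (mul_mem_span_kerGenerators b ha).2⟩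

/-- The kernel of `red` is the two-sided ideal generated by `τ` and the `Sq^(2 n + 1)`: by the Adem
relations, `Sq^n ↦ Sq^(2 n)` defines a homomorphism from `A_cl` to the quotient by that ideal. -/
theorem mem_span_kerGenerators_of_red_eq_zero {a : MotivicSteenrod} (ha : red a = 0) :
    a ∈ Submodule.span M2 kerGenerators := by
  let _ : Algebra (ZMod 2) (MotivicSteenrod ⧸ kerIdeal) :=
    Algebra.compHom _ (C : ZMod 2 →+* M2)
  let q : MotivicSteenrod →ₐ[M2] MotivicSteenrod ⧸ kerIdeal := Ideal.Quotient.mkₐ M2 kerIdeal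
  have hq : ∀ a, a ∈ Submodule.span M2 kerGenerators ↔ q a = 0 := fun a =>
    (Ideal.Quotient.eq_zero_iff_mem (I := kerIdeal)).symm
  have hodd : ∀ n, Odd n → q (Sq X n) = 0 := fun n hn => (hq _).1
    (Submodule.subset_span (Or.inr ⟨[n], ⟨n, List.mem_singleton_self n, hn⟩, by simp [mono]⟩))
  have hA := (satisfiesAdem_Sq (X : M2)).map q
  have hs : SatisfiesAdem (1 : ZMod 2) (fun n => q (Sq X (2 * n))) := by
    refine ⟨hA.1, fun a b ha hab => ?_⟩
    rw [← adem_even_sum (k' := ZMod 2) (X : M2) (fun n => q (Sq X n)) hodd a b hab]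
    exact hA.2 (2 * a) (2 * b) (by omega) (by omega)
  let ψ := SteenrodAlg.lift _ hs
  have hψ : ∀ a, ψ (red a) = q a := by
    intro a
    have ha : a ∈ Submodule.span M2 (Set.range (mono X)) := by
      rw [span_range_mono]; trivial
    induction ha using Submodule.span_induction with
    | mem b hb =>
      obtain ⟨l, rfl⟩ := hb
      induction l with
      | nil => rw [mono_nil, map_one, map_one, map_one]
      | cons n l ih =>
        rw [mono_cons, map_mul, map_mul, map_mul, ih, red_Sq]
        congr 1
        rcases Nat.even_or_odd' n with ⟨m, rfl | rfl⟩
        · rw [halfSq_two_mul]; exact lift_Sq _ hs m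
        · rw [halfSq_odd ⟨m, rfl⟩, map_zero, hodd _ ⟨m, rfl⟩]
    | zero => simp
    | add b c _ _ hb hc => rw [map_add, map_add, map_add, hb, hc]
    | smul r b _ hb =>
      rw [red_smul, map_smul, hb]
      -- As `τ` acts by `0` on the quotient, `r` acts through its constant term.
      have h0 : q ((X : M2) • (r.divX • b)) = 0 :=
        (hq _).1 (Submodule.subset_span (Or.inl ⟨_, rfl⟩))
      conv_rhs => rw [← divX_mul_X_add r, add_smul, mul_comm, mul_smul, map_add, h0, zero_add, map_smul]
      rfl
  rw [hq, ← hψ, ha, map_zero]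

end Steenrod

/-! ### Multilinear cochains and their degrees -/

namespace BarCochain

section multilinear
variable {k H : Type*} [CommRing k] [Ring H] [Algebra k H]

/-- `x` is `k`-linear in each variable. -/
def IsMultilinear (x : BarCochain k H) : Prop :=
  ∀ l r : List H, IsLinearMap k fun a => x (l ++ a :: r)

theorem IsMultilinear.shift {x : BarCochain k H} (hx : IsMultilinear x) (a : H) :
    IsMultilinear (x.shift a) := fun l r => hx (a :: l) r

theorem IsMultilinear.cons_add {x : BarCochain k H} (hx : IsMultilinear x) (a b : H) (l : List H) :
    x ((a + b) :: l) = x (a :: l) + x (b :: l) := (hx [] l).map_add a b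

theorem IsMultilinear.cons_smul {x : BarCochain k H} (hx : IsMultilinear x) (c : k) (a : H) (l : List H) :
    x ((c • a) :: l) = c * x (a :: l) := (hx [] l).map_smul c a

theorem IsMultilinear.shift_add {x : BarCochain k H} (hx : IsMultilinear x) (a b : H) :
    x.shift (a + b) = x.shift a + x.shift b := funext fun l => (hx [] l).map_add a b

theorem IsMultilinear.shift_smul {x : BarCochain k H} (hx : IsMultilinear x) (c : k) (a : H) :
    x.shift (c • a) = scale c (x.shift a) := funext fun l => (hx [] l).map_smul c a

theorem IsMultilinear.zero : IsMultilinear (0 : BarCochain k H) := fun _ _ =>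
  ⟨fun _ _ => (add_zero (0 : k)).symm, fun c _ => (mul_zero c).symm⟩

theorem IsMultilinear.add {x y : BarCochain k H} (hx : IsMultilinear x) (hy : IsMultilinear y) :
    IsMultilinear (x + y) := fun l r =>
  ((hx l r).mk' _ + (hy l r).mk' _).isLinear

theorem isLinearMap_mul_mul (u v : H) : IsLinearMap k fun a => u * (a * v) :=
  ((LinearMap.mulLeft k u).comp (LinearMap.mulRight k v)).isLinear

theorem isLinearMap_comp {V W U : Type*} [AddCommGroup V] [AddCommGroup W] [AddCommGroup U] [Module k V]
    [Module k W] [Module k U] {g : W → U} {f : V → W} (hg : IsLinearMap k g) (hf : IsLinearMap k f) :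
    IsLinearMap k fun a => g (f a) := ((hg.mk' _).comp (hf.mk' _)).isLinear

theorem isLinearMap_add {V W : Type*} [AddCommGroup V] [AddCommGroup W] [Module k V]
    [Module k W] {g f : V → W} (hg : IsLinearMap k g) (hf : IsLinearMap k f) :
    IsLinearMap k fun a => g a + f a := ((hg.mk' _) + (hf.mk' _)).isLinear

theorem IsMultilinear.inner {x : BarCochain k H} (hx : IsMultilinear x) : IsMultilinear (inner x) := by
  intro l
  induction l generalizing x with
  | nil =>
    intro r
    cases r with
    | nil => exact ⟨fun _ _ => (add_zero (0 : k)).symm, fun c _ => (mul_zero c).symm⟩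
    | cons b r =>
      constructor
      · intro a a'
        simp only [List.nil_append, inner_cons_cons, hx.shift_add, inner_add, add_apply, add_mul]
        rw [hx.cons_add]
        ring
      · intro c a
        simp only [List.nil_append, inner_cons_cons, hx.shift_smul, inner_scale, smul_mul_assoc]
        rw [hx.cons_smul, smul_eq_mul]
        ring
  | cons a l ih =>
    intro r
    cases l with
    | nil =>
      have h := ih (hx.shift a) r
      have h2 := isLinearMap_comp (hx [] r) (LinearMap.mulLeft k a).isLinear
      exact isLinearMap_add h2 h
    | cons b l => exact isLinearMap_add (hx (a * b :: l) r) (ih (hx.shift a) r)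

/-- To check that a semilinear functional of several variables vanishes on a list, it suffices to check
it on lists of elements of sets that span submodules containing the given variables. -/
theorem eq_zero_of_forall₂ {k' : Type*} [CommRing k'] (σ : k →+* k') (R : H → H → Prop)
    {F : List H → k'} (hadd : ∀ l r a b, F (l ++ (a + b) :: r) = F (l ++ a :: r) + F (l ++ b :: r))
    (hsmul : ∀ l r c a, F (l ++ (c • a) :: r) = σ c * F (l ++ a :: r)) (l : List H)
    (hR : ∀ a ∈ l, a ∈ Submodule.span k {b | R a b})
    (h : ∀ m, List.Forall₂ R l m → F m = 0) : F l = 0 := by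
  induction l generalizing F with
  | nil => exact h [] .nil
  | cons a l ih =>
    have ha := hR a List.mem_cons_self
    replace hR := fun c hc => hR c (List.mem_cons_of_mem a hc)
    have hb : ∀ b ∈ {b | R a b}, F (b :: l) = 0 := fun b hb =>
      ih (F := fun m => F (b :: m)) (fun l => hadd (b :: l)) (fun l => hsmul (b :: l)) hR
        fun m hm => h (b :: m) (.cons hb hm)
    clear h
    generalize {b | R a b} = S at ha hb
    induction ha using Submodule.span_induction with
    | mem b hab => exact hb b hab
    | zero =>
      have := hsmul [] l 0 0
      rwa [zero_smul, map_zero, zero_mul] at this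
    | add b c _ _ hb' hc =>
      exact (hadd [] l b c).trans (by rw [List.nil_append, hb', List.nil_append, hc, add_zero])
    | smul c b _ hb' => exact (hsmul [] l c b).trans (by rw [List.nil_append, hb', mul_zero])

end multilinear

section lowers
variable {k H ι : Type*} [CommRing k]

theorem mem_of_mem_of_eq {N : ι → AddSubgroup k} {e e' : ι} {c : k} (h : c ∈ N e) (he : e = e') :
    c ∈ N e' := he ▸ h

variable [AddCommGroup H] [AddCommGroup ι] (M : ι → AddSubgroup k) (A : ι → AddSubgroup H)

/-- `x` lowers the internal degree by `e`. -/
def Lowers (e : ι) (x : BarCochain k H) : Prop :=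
  ∀ L : List (ι × H), (∀ q ∈ L, q.2 ∈ A q.1) → x (L.map Prod.snd) ∈ M ((L.map Prod.fst).sum - e)

variable {M A}

theorem Lowers.shift {e e' : ι} {x : BarCochain k H} (hx : Lowers M A e x) {a : H} (ha : a ∈ A e') :
    Lowers M A (e - e') (x.shift a) := by
  intro L hL
  have := hx ((e', a) :: L) (by
    rintro q hq
    rcases List.mem_cons.1 hq with rfl | hq
    · exact ha
    · exact hL q hq)
  rw [List.map_cons, List.map_cons, List.sum_cons] at this
  exact mem_of_mem_of_eq this (by abel)

end lowers

section innerFaces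
variable {k H ι : Type*} [CommRing k] [Ring H]

theorem inner_eq_zero {x : BarCochain k H} {l : List H}
    (h : ∀ m : List H, m.length + 1 = l.length → x m = 0) : inner x l = 0 := by
  induction l generalizing x with
  | nil => rfl
  | cons a l ih =>
    cases l with
    | nil => rfl
    | cons b l =>
      rw [inner_cons_cons, h (a * b :: l) rfl, zero_add]
      exact ih fun m hm => h (a :: m) (by simp only [List.length_cons] at hm ⊢; omega)

variable [AddCommGroup ι] {M : ι → AddSubgroup k} {A : ι → AddSubgroup H}

theorem Lowers.inner [SetLike.GradedMonoid A] {e : ι} {x : BarCochain k H} (hx : Lowers M A e x) :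
    Lowers M A e (inner x) := by
  intro L
  induction L generalizing e x with
  | nil => exact fun _ => zero_mem _
  | cons q L ih =>
    cases L with
    | nil => exact fun _ => zero_mem _
    | cons q' L =>
      intro hL
      have hq := hL q (by simp)
      have hq' := hL q' (by simp)
      have h1 := ih (hx.shift hq) fun r hr => hL r (List.mem_cons_of_mem _ hr)
      have h2 := hx ((q.1 + q'.1, q.2 * q'.2) :: L) (by
        intro r hr
        rcases List.mem_cons.1 hr with rfl | hr
        · exact SetLike.GradedMul.mul_mem hq hq'
        · exact hL r (by simp [hr]))
      simp only [List.map_cons, List.sum_cons] at h1 h2 ⊢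
      refine add_mem ?_ ?_
      · exact mem_of_mem_of_eq h2 (by abel)
      · exact mem_of_mem_of_eq h1 (by abel)

end innerFaces

section graded
variable {k H ι : Type*} [CommRing k] [Ring H] [Algebra k H] [AddCommGroup ι]
  (M : ι → AddSubgroup k) (A : ι → AddSubgroup H)

theorem mem_homogeneous_iff {p : ℤ × ι} {x : BarCochain k H} :
    x ∈ homogeneous M A p ↔
      (∀ l : List H, (l.length : ℤ) ≠ p.1 → x l = 0) ∧ IsMultilinear x ∧ Lowers M A p.2 x :=
  ⟨fun h => ⟨h.1, fun l r => ⟨h.2.1 l r, h.2.2.1 l r⟩, h.2.2.2⟩,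
    fun h => ⟨h.1, fun l r => (h.2.1 l r).map_add, fun l r => (h.2.1 l r).map_smul, h.2.2⟩⟩

theorem isMultilinear_of_mem_homogeneous {p : ℤ × ι} {x : BarCochain k H}
    (h : x ∈ homogeneous M A p) : IsMultilinear x := ((mem_homogeneous_iff M A).1 h).2.1

variable {M A}

theorem inner_mem_homogeneous [SetLike.GradedMonoid A] {p : ℤ × ι} {x : BarCochain k H}
    (hx : x ∈ homogeneous M A p) : inner x ∈ homogeneous M A (p + (1, 0)) := by
  rw [mem_homogeneous_iff] at hx ⊢
  refine ⟨fun l hl => inner_eq_zero fun m hm => hx.1 m fun h => hl ?_, hx.2.1.inner, ?_⟩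
  · rw [Prod.fst_add, ← h, ← hm]
    push_cast
    rfl
  · rw [Prod.snd_add, add_zero]
    exact hx.2.2.inner

end graded

section differential
variable {k H ι : Type*} [CommRing k] [Ring H] [Bialgebra k H] [AddCommGroup ι]
  {M : ι → AddSubgroup k} {A : ι → AddSubgroup H}

theorem isMultilinear_counitCochain : IsMultilinear (counitCochain k H) := by
  intro l r
  rcases l with _ | ⟨b, l⟩
  · cases r with
    | nil => exact (Coalgebra.counit (R := k) (A := H)).isLinear
    | cons c r => exact (0 : H →ₗ[k] k).isLinear
  · cases l <;> exact (0 : H →ₗ[k] k).isLinear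

theorem counitCochain_mem_homogeneous (hε : ∀ e, ∀ a ∈ A e, Coalgebra.counit (R := k) a ∈ M e) :
    counitCochain k H ∈ homogeneous M A (1, 0) := by
  rw [mem_homogeneous_iff]
  refine ⟨fun l hl => ?_, isMultilinear_counitCochain, fun L hL => ?_⟩
  · match l with
    | [] => rfl
    | [a] => exact absurd rfl hl
    | _ :: _ :: _ => rfl
  · match L with
    | [] => exact zero_mem _
    | [q] => exact mem_of_mem_of_eq (hε q.1 q.2 (hL q List.mem_cons_self)) (by simp)
    | _ :: _ :: _ => exact zero_mem _

theorem d_mem_homogeneous [SetLike.GradedMonoid M] [SetLike.GradedMonoid A]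
    (hε : ∀ e, ∀ a ∈ A e, Coalgebra.counit (R := k) a ∈ M e) {p : ℤ × ι} {x : BarCochain k H}
    (hx : x ∈ homogeneous M A p) : d x ∈ homogeneous M A (p + (1, 0)) := by
  have h := counitCochain_mem_homogeneous hε
  refine add_mem (add_mem ?_ (inner_mem_homogeneous hx)) (mul_mem_homogeneous M A hx h)
  rw [add_comm]
  exact mul_mem_homogeneous M A h hx

end differential

end BarCochain

/-! ### Degrees of cup-`i` products -/

namespace BarCochain

section append
variable {k H ι : Type*} [CommRing k] [AddCommGroup H] [AddCommGroup ι] {M : ι → AddSubgroup k}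
  {A : ι → AddSubgroup H}

theorem Lowers.append {e : ι} {x : BarCochain k H} (hx : Lowers M A e x) (B : List (ι × H))
    (hB : ∀ q ∈ B, q.2 ∈ A q.1) :
    Lowers M A (e - (B.map Prod.fst).sum) fun l => x (B.map Prod.snd ++ l) := by
  intro L hL
  have := hx (B ++ L) fun q hq => (List.mem_append.1 hq).elim (hB q) (hL q)
  rw [List.map_append, List.map_append, List.sum_append] at this
  exact mem_of_mem_of_eq this (by abel)

end append

section trunc
variable {k H : Type*} [CommRing k]

/-- The component of cohomological degree `n`. -/
def trunc (n : ℕ) (x : BarCochain k H) : BarCochain k H := fun l => if l.length = n then x l else 0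

theorem trunc_apply_of_eq {n : ℕ} {x : BarCochain k H} {l : List H} (h : l.length = n) :
    trunc n x l = x l := if_pos h

theorem trunc_apply_of_ne {n : ℕ} {x : BarCochain k H} {l : List H} (h : l.length ≠ n) :
    trunc n x l = 0 := if_neg h

theorem map_splitLengths {α β : Type*} (f : α → β) (ns : List ℕ) (l : List α) :
    ns.splitLengths (l.map f) = (ns.splitLengths l).map (List.map f) := by
  induction ns generalizing l with
  | nil => rfl
  | cons n ns ih => simp only [List.splitLengths_cons, List.map_cons, ← List.map_take, ← List.map_drop, ih]

variable {ι : Type*} [AddCommGroup H] [AddCommGroup ι] {M : ι → AddSubgroup k} {A : ι → AddSubgroup H}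

theorem Lowers.trunc_split {f : List (List H) → k} {e : ι} (ns : List ℕ)
    (hf : ∀ Bs : List (List (ι × H)), (∀ B ∈ Bs, ∀ q ∈ B, q.2 ∈ A q.1) →
      f (Bs.map (List.map Prod.snd)) ∈ M ((Bs.flatten.map Prod.fst).sum - e)) :
    Lowers M A e (trunc ns.sum fun m => f (ns.splitLengths m)) := by
  intro L hL
  by_cases h : (L.map Prod.snd).length = ns.sum
  · have hfl : (ns.splitLengths L).flatten = L :=
      List.flatten_splitLengths _ _ (by rw [← h, List.length_map])
    refine (congrArg (· ∈ _) (trunc_apply_of_eq h)).mpr ?_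
    simp only [map_splitLengths]
    have := hf (ns.splitLengths L) fun B hB q hq => hL q (by
      rw [← hfl]; exact List.mem_flatten.2 ⟨B, hB, hq⟩)
    rwa [hfl] at this
  · exact (congrArg (· ∈ _) (trunc_apply_of_ne h)).mpr (zero_mem _)

end trunc

section star
variable {k H : Type*} [CommRing k] [Ring H] [Bialgebra k H]

theorem star_cons_eq_sum (u v : BarCochain k H) (a : H) (l : List H) :
    star u v (a :: l) = ∑ i ∈ (Coalgebra.Repr.arbitrary k a).index,
      star (u.shift ((Coalgebra.Repr.arbitrary k a).left i))
        (v.shift ((Coalgebra.Repr.arbitrary k a).right i)) l := rfl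

/-- The value of `star u v` at a list depends only on the values of `u` and `v` at lists of the same
length. -/
theorem star_congr {u u' v v' : BarCochain k H} {l : List H}
    (hu : ∀ m : List H, m.length = l.length → u m = u' m)
    (hv : ∀ m : List H, m.length = l.length → v m = v' m) : star u v l = star u' v' l := by
  induction l generalizing u u' v v' with
  | nil => exact congrArg₂ (· * ·) (hu [] rfl) (hv [] rfl)
  | cons a l ih =>
    rw [star_cons_eq_sum, star_cons_eq_sum]
    exact Finset.sum_congr rfl fun i _ =>
      ih (fun m hm => hu (_ :: m) (by simp [hm])) fun m hm => hv (_ :: m) (by simp [hm])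

theorem star_add_left (u u' v : BarCochain k H) (l : List H) :
    star (u + u') v l = star u v l + star u' v l := by
  induction l generalizing u u' v with
  | nil => exact add_mul (u []) (u' []) (v [])
  | cons a l ih =>
    simp only [star_cons_eq_sum, ← Finset.sum_add_distrib]
    exact Finset.sum_congr rfl fun i _ => ih _ _ _

theorem star_add_right (u v v' : BarCochain k H) (l : List H) :
    star u (v + v') l = star u v l + star u v' l := by
  induction l generalizing u v v' with
  | nil => exact mul_add (u []) (v []) (v' [])
  | cons a l ih =>
    simp only [star_cons_eq_sum, ← Finset.sum_add_distrib]
    exact Finset.sum_congr rfl fun i _ => ih _ _ _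

theorem star_scale_left (c : k) (u v : BarCochain k H) (l : List H) :
    star (scale c u) v l = c * star u v l := by
  induction l generalizing u v with
  | nil => exact mul_assoc c (u []) (v [])
  | cons a l ih =>
    simp only [star_cons_eq_sum, Finset.mul_sum]
    exact Finset.sum_congr rfl fun i _ => ih _ _

theorem star_scale_right (c : k) (u v : BarCochain k H) (l : List H) :
    star u (scale c v) l = c * star u v l := by
  induction l generalizing u v with
  | nil => exact mul_left_comm (u []) c (v [])
  | cons a l ih =>
    simp only [star_cons_eq_sum, Finset.mul_sum]
    exact Finset.sum_congr rfl fun i _ => ih _ _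

/-- The bilinear map `(b, c) ↦ (u(b, -) ⋆ v(c, -))(l)`. -/
noncomputable def starBilin {u v : BarCochain k H} (hu : IsMultilinear u) (hv : IsMultilinear v)
    (l : List H) : H →ₗ[k] H →ₗ[k] k :=
  LinearMap.mk₂ k (fun b c => star (u.shift b) (v.shift c) l)
    (fun b b' c => by rw [hu.shift_add, star_add_left])
    (fun r b c => by rw [hu.shift_smul, star_scale_left, smul_eq_mul])
    (fun b c c' => by rw [hv.shift_add, star_add_right])
    (fun r b c => by rw [hv.shift_smul, star_scale_right, smul_eq_mul])

theorem star_cons_eq_lift {u v : BarCochain k H} (hu : IsMultilinear u) (hv : IsMultilinear v)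
    (a : H) (l : List H) :
    star u v (a :: l) = TensorProduct.lift (starBilin hu hv l) (Coalgebra.comul (R := k) a) := by
  rw [← (Coalgebra.Repr.arbitrary k a).eq, map_sum]
  simp only [TensorProduct.lift.tmul]
  rfl

theorem IsMultilinear.star {u v : BarCochain k H} (hu : IsMultilinear u) (hv : IsMultilinear v) :
    IsMultilinear (star u v) := by
  intro l
  induction l generalizing u v with
  | nil =>
    intro r
    simp only [List.nil_append, star_cons_eq_lift hu hv]
    exact ((TensorProduct.lift (starBilin hu hv r)).comp (Coalgebra.comul (R := k))).isLinear
  | cons a l ih =>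
    intro r
    have h := fun i => ih (hu.shift ((Coalgebra.Repr.arbitrary k a).left i))
      (hv.shift ((Coalgebra.Repr.arbitrary k a).right i)) r
    constructor
    · intro b c
      simp only [List.cons_append, star_cons_eq_sum, (h _).map_add, Finset.sum_add_distrib]
    · intro r b
      simp only [List.cons_append, star_cons_eq_sum, (h _).map_smul, Finset.smul_sum]

section degree
variable {ι : Type*} [AddCommGroup ι] {M : ι → AddSubgroup k} {A : ι → AddSubgroup H}

variable (k A) in
/-- The elements of degree `e` of `H ⊗ H`. -/
def tensorGrading (e : ι) : AddSubgroup (H ⊗[k] H) :=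
  AddSubgroup.closure {t | ∃ e₁ e₂, ∃ b ∈ A e₁, ∃ c ∈ A e₂, e₁ + e₂ = e ∧ t = b ⊗ₜ[k] c}

theorem Lowers.star [SetLike.GradedMonoid M]
    (hΔ : ∀ e, ∀ a ∈ A e, Coalgebra.comul (R := k) a ∈ tensorGrading k A e)
    {u v : BarCochain k H} (hu : IsMultilinear u) (hv : IsMultilinear v) {e e' : ι}
    (hu' : Lowers M A e u) (hv' : Lowers M A e' v) : Lowers M A (e + e') (star u v) := by
  intro L
  induction L generalizing u v e e' with
  | nil =>
    intro hL
    exact mem_of_mem_of_eq (SetLike.GradedMul.mul_mem (hu' [] hL) (hv' [] hL)) (by simp; abel)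
  | cons q L ih =>
    intro hL
    have hc := star_cons_eq_lift hu hv q.2 (L.map Prod.snd)
    refine (congrArg (· ∈ _) hc).mpr ?_
    rw [List.map_cons, List.sum_cons]
    have hq := hΔ q.1 q.2 (hL q List.mem_cons_self)
    refine AddSubgroup.closure_induction (p := fun t _ => TensorProduct.lift
      (starBilin hu hv (L.map Prod.snd)) t ∈ M (q.1 + (L.map Prod.fst).sum - (e + e')))
      ?_ ?_ ?_ ?_ hq
    · rintro _ ⟨e₁, e₂, b, hb, c, hc, h, rfl⟩
      rw [TensorProduct.lift.tmul]
      refine mem_of_mem_of_eq (ih (hu.shift b) (hv.shift c) (hu'.shift hb) (hv'.shift hc)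
        fun r hr => hL r (List.mem_cons_of_mem _ hr)) ?_
      rw [← h]
      abel
    · rw [map_zero]; exact zero_mem _
    · intro s t _ _ hs ht
      rw [map_add]; exact add_mem hs ht
    · intro t _ ht
      rw [map_neg]; exact neg_mem ht

theorem star_mem_homogeneous [SetLike.GradedMonoid M]
    (hΔ : ∀ e, ∀ a ∈ A e, Coalgebra.comul (R := k) a ∈ tensorGrading k A e)
    {u v : BarCochain k H} {n : ℤ} {e e' : ι} (hu : u ∈ homogeneous M A (n, e))
    (hv : v ∈ homogeneous M A (n, e')) : star u v ∈ homogeneous M A (n, e + e') := by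
  rw [mem_homogeneous_iff] at *
  refine ⟨fun l hl => ?_, hu.2.1.star hv.2.1, hu.2.2.star hΔ hu.2.1 hv.2.1 hv.2.2⟩
  have h : star u v l = star 0 v l :=
    star_congr (fun m hm => hu.1 m (by rwa [hm])) fun _ _ => rfl
  have h0 : (0 : BarCochain k H) = scale 0 0 := funext fun _ => (zero_mul (0 : k)).symm
  rw [h, h0, star_scale_left, zero_mul]

end degree
end star

section blocks
variable {k H : Type*} [CommRing k] [Ring H] [Bialgebra k H]

theorem evalEven_cons (x : BarCochain k H) (B C D : List H) (L : List (List H)) :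
    evalEven x (B :: C :: D :: L) = evalEven (fun l => x (B ++ C.prod :: l)) (D :: L) := by
  rw [evalEven]

theorem evalEven_pair (x : BarCochain k H) (B C : List H) :
    evalEven x [B, C] = x B * Coalgebra.counit (R := k) C.prod := by rw [evalEven]

theorem evalEven_nil (x : BarCochain k H) : evalEven x [] = x [] := by rw [evalEven]

theorem evalEven_singleton (x : BarCochain k H) (B : List H) : evalEven x [B] = x B := by rw [evalEven]

theorem evalEven_add : ∀ (L : List (List H)) (x y : BarCochain k H),
    evalEven (x + y) L = evalEven x L + evalEven y L
  | [], _, _ => by simp only [evalEven, add_apply]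
  | [_], _, _ => by simp only [evalEven, add_apply]
  | [_, _], _, _ => by simp only [evalEven, add_apply, add_mul]
  | B :: C :: D :: L, x, y => by
    simp only [evalEven_cons]
    exact evalEven_add (D :: L) (fun l => x (B ++ C.prod :: l)) fun l => y (B ++ C.prod :: l)

theorem evalEven_scale : ∀ (L : List (List H)) (c : k) (x : BarCochain k H),
    evalEven (scale c x) L = c * evalEven x L
  | [], _, _ => by simp only [evalEven, scale]
  | [_], _, _ => by simp only [evalEven, scale]
  | [_, _], _, _ => by simp only [evalEven, scale, mul_assoc]
  | B :: C :: D :: L, c, x => by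
    simp only [evalEven_cons]
    exact evalEven_scale (D :: L) c fun l => x (B ++ C.prod :: l)

theorem isLinearMap_prod (l r : List H) : IsLinearMap k fun c : H => (l ++ c :: r).prod := by
  simp only [List.prod_append, List.prod_cons]
  exact isLinearMap_mul_mul l.prod r.prod

theorem IsMultilinear.append {x : BarCochain k H} (hx : IsMultilinear x) (B : List H) :
    IsMultilinear fun l => x (B ++ l) := by
  intro l r
  simp only [← List.append_assoc]
  exact hx (B ++ l) r

theorem isLinearMap_evalEven_of {x : H → BarCochain k H}
    (hx : ∀ m, IsLinearMap k fun a => x a m) (L : List (List H)) :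
    IsLinearMap k fun a => evalEven (x a) L := by
  constructor
  · intro a b
    rw [← evalEven_add]
    congr 1
    exact funext fun m => (hx m).map_add a b
  · intro c a
    rw [smul_eq_mul, ← evalEven_scale]
    congr 1
    exact funext fun m => (hx m).map_smul c a

theorem isLinearMap_counit_prod (l r : List H) :
    IsLinearMap k fun c : H => Coalgebra.counit (R := k) (l ++ c :: r).prod :=
  isLinearMap_comp (Coalgebra.counit (R := k) (A := H)).isLinear (isLinearMap_prod l r)

theorem isLinearMap_mul_right {f : H → k} (hf : IsLinearMap k f) (c : k) :
    IsLinearMap k fun a => f a * c :=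
  isLinearMap_comp (LinearMap.mulRight k c).isLinear hf

theorem isLinearMap_mul_left {f : H → k} (hf : IsLinearMap k f) (c : k) :
    IsLinearMap k fun a => c * f a :=
  isLinearMap_comp (LinearMap.mulLeft k c).isLinear hf

/-- `evalEven x` is linear in each entry of each block. -/
theorem IsMultilinear.evalEven : ∀ (Bs : List (List H)) {x : BarCochain k H} (_ : IsMultilinear x)
    (l r : List H) (Bs' : List (List H)),
      IsLinearMap k fun c => evalEven x (Bs ++ (l ++ c :: r) :: Bs')
  | [], x, hx, l, r, [] => by
    simp only [List.nil_append, evalEven_singleton]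
    exact hx l r
  | [], x, hx, l, r, [C] => by
    simp only [List.nil_append, evalEven_pair]
    exact isLinearMap_mul_right (hx l r) _
  | [], x, hx, l, r, C :: D :: L => by
    simp only [List.nil_append, evalEven_cons]
    refine isLinearMap_evalEven_of (fun m => ?_) _
    simp only [List.append_assoc, List.cons_append]
    exact hx l _
  | [B], x, hx, l, r, [] => by
    simp only [List.cons_append, List.nil_append, evalEven_pair]
    exact isLinearMap_mul_left (isLinearMap_counit_prod l r) _
  | [B], x, hx, l, r, D :: L => by
    simp only [List.cons_append, List.nil_append, evalEven_cons]
    exact isLinearMap_evalEven_of (fun m => isLinearMap_comp (hx B m) (isLinearMap_prod l r)) _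
  | [B, C], x, hx, l, r, L => by
    simp only [List.cons_append, List.nil_append, evalEven_cons]
    exact IsMultilinear.evalEven [] ((hx.append B).shift C.prod) l r L
  | B :: C :: D :: L, x, hx, l, r, L' => by
    simp only [List.cons_append, evalEven_cons]
    exact IsMultilinear.evalEven (D :: L) ((hx.append B).shift C.prod) l r L'

theorem IsMultilinear.evalOdd {x : BarCochain k H} (hx : IsMultilinear x) (Bs : List (List H))
    (l r : List H) (Bs' : List (List H)) :
    IsLinearMap k fun c => evalOdd x (Bs ++ (l ++ c :: r) :: Bs') := by
  cases Bs with
  | nil => exact isLinearMap_mul_right (isLinearMap_counit_prod l r) _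
  | cons B Bs => exact isLinearMap_mul_left (hx.evalEven Bs l r Bs') _

/-- A variable of the uncut list is a variable of one of the blocks. -/
theorem exists_splitLengths_append_cons {α : Type*} (ns : List ℕ) (l r : List α) (h : l.length < ns.sum) :
    ∃ Bs l' r' Bs', ∀ c, ns.splitLengths (l ++ c :: r) = Bs ++ (l' ++ c :: r') :: Bs' := by
  induction ns generalizing l with
  | nil => simp at h
  | cons n ns ih =>
    rcases Nat.lt_or_ge l.length n with hl | hl
    · obtain ⟨m, rfl⟩ := Nat.exists_eq_add_of_lt hl
      refine ⟨[], l, r.take m, ns.splitLengths (r.drop m), fun c => ?_⟩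
      rw [List.splitLengths_cons, List.nil_append, add_assoc, List.take_length_add_append,
        List.drop_length_add_append, List.take_succ_cons, List.drop_succ_cons]
    · obtain ⟨Bs, l', r', Bs', hB⟩ := ih (l.drop n) (by
        rw [List.sum_cons] at h
        rw [List.length_drop]
        omega)
      refine ⟨l.take n :: Bs, l', r', Bs', fun c => ?_⟩
      rw [List.splitLengths_cons, List.take_append_of_le_length hl, List.drop_append_of_le_length hl, hB,
        List.cons_append]

section degree
variable {ι : Type*} [AddCommGroup ι] {M : ι → AddSubgroup k} {A : ι → AddSubgroup H}

theorem prod_mem_grading [SetLike.GradedMonoid A] (B : List (ι × H)) (hB : ∀ q ∈ B, q.2 ∈ A q.1) :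
    (B.map Prod.snd).prod ∈ A (B.map Prod.fst).sum := by
  induction B with
  | nil => exact SetLike.GradedOne.one_mem
  | cons q B ih =>
    simp only [List.map_cons, List.prod_cons, List.sum_cons]
    exact SetLike.GradedMul.mul_mem (hB q List.mem_cons_self)
      (ih fun q hq => hB q (List.mem_cons_of_mem _ hq))

variable [SetLike.GradedMonoid M] [SetLike.GradedMonoid A]

theorem Lowers.evalEven (hε : ∀ e, ∀ a ∈ A e, Coalgebra.counit (R := k) a ∈ M e) :
    ∀ (Bs : List (List (ι × H))) {e : ι} {x : BarCochain k H}
    (_ : Lowers M A e x) (_ : ∀ B ∈ Bs, ∀ q ∈ B, q.2 ∈ A q.1),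
      evalEven x (Bs.map (List.map Prod.snd)) ∈ M ((Bs.flatten.map Prod.fst).sum - e)
  | [], e, x, hx, _ => hx [] (by simp)
  | [B], e, x, hx, hB => by
    rw [List.map_singleton, evalEven_singleton]
    exact mem_of_mem_of_eq (hx B (hB B (by simp))) (by simp)
  | [B, C], e, x, hx, hB => by
    simp only [List.map_cons, List.map_nil, evalEven_pair]
    exact mem_of_mem_of_eq (SetLike.GradedMul.mul_mem (hx B (hB B (by simp)))
      (hε _ _ (prod_mem_grading C (hB C (by simp))))) (by simp; abel)
  | B :: C :: D :: L, e, x, hx, hB => by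
    simp only [List.map_cons, evalEven_cons]
    have := Lowers.evalEven hε (D :: L) ((hx.append B (hB B (by simp))).shift
      (prod_mem_grading C (hB C (by simp)))) fun E hE => hB E (by simp only [List.mem_cons] at hE ⊢; tauto)
    exact mem_of_mem_of_eq this (by simp; abel)

theorem Lowers.evalOdd (hε : ∀ e, ∀ a ∈ A e, Coalgebra.counit (R := k) a ∈ M e)
    (Bs : List (List (ι × H))) {e : ι} {x : BarCochain k H}
    (hx : Lowers M A e x) (hB : ∀ B ∈ Bs, ∀ q ∈ B, q.2 ∈ A q.1) :
    evalOdd x (Bs.map (List.map Prod.snd)) ∈ M ((Bs.flatten.map Prod.fst).sum - e) := by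
  cases Bs with
  | nil => exact hx [] (by simp)
  | cons B Bs =>
    exact mem_of_mem_of_eq (SetLike.GradedMul.mul_mem (hε _ _ (prod_mem_grading B (hB B (by simp))))
      (Lowers.evalEven hε Bs hx fun C hC => hB C (List.mem_cons_of_mem _ hC))) (by simp; abel)

end degree
end blocks

section cup
variable {k H : Type*} [CommRing k] [Ring H] [Bialgebra k H]

theorem isMultilinear_trunc {n : ℕ} {x : BarCochain k H}
    (h : ∀ l r : List H, l.length < n → IsLinearMap k fun a => x (l ++ a :: r)) :
    IsMultilinear (trunc n x) := by
  intro l r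
  by_cases hn : l.length + (r.length + 1) = n
  · have : ∀ a, trunc n x (l ++ a :: r) = x (l ++ a :: r) := fun a =>
      trunc_apply_of_eq (by simp [hn])
    simp only [this]
    exact h l r (by omega)
  · have : ∀ a, trunc n x (l ++ a :: r) = 0 := fun a => trunc_apply_of_ne (by simpa using hn)
    simp only [this]
    exact (0 : H →ₗ[k] k).isLinear

/-- The coface of `x` on the even blocks of the cut `ns`. -/
noncomputable def evenFace (x : BarCochain k H) (ns : List ℕ) : BarCochain k H :=
  trunc ns.sum fun m => evalEven x (ns.splitLengths m)

/-- The coface of `x` on the odd blocks of the cut `ns`. -/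
noncomputable def oddFace (x : BarCochain k H) (ns : List ℕ) : BarCochain k H :=
  trunc ns.sum fun m => evalOdd x (ns.splitLengths m)

theorem IsMultilinear.evenFace {x : BarCochain k H} (hx : IsMultilinear x) (ns : List ℕ) :
    IsMultilinear (evenFace x ns) := isMultilinear_trunc fun l r h => by
  obtain ⟨Bs, l', r', Bs', hB⟩ := exists_splitLengths_append_cons ns l r h
  simp only [hB]
  exact hx.evalEven Bs l' r' Bs'

theorem IsMultilinear.oddFace {x : BarCochain k H} (hx : IsMultilinear x) (ns : List ℕ) :
    IsMultilinear (oddFace x ns) := isMultilinear_trunc fun l r h => by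
  obtain ⟨Bs, l', r', Bs', hB⟩ := exists_splitLengths_append_cons ns l r h
  simp only [hB]
  exact hx.evalOdd Bs l' r' Bs'

theorem trunc_cup (N i : ℕ) (x y : BarCochain k H) :
    trunc N (cup i x y) = ∑ n ∈ (Finset.Nat.antidiagonalTuple (i + 2) N).filter
      (fun n => ∀ j, j ≠ 0 → j ≠ Fin.last (i + 1) → 0 < n j),
        trunc N (star (evenFace x (List.ofFn n)) (oddFace y (List.ofFn n))) := by
  funext l
  refine Eq.trans ?_ (Finset.sum_apply (M := fun _ : List H => k) l _ _).symm
  by_cases hl : l.length = N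
  · rw [trunc_apply_of_eq hl, cup, hl]
    refine Finset.sum_congr rfl fun n hn => ?_
    refine Eq.trans ?_ (trunc_apply_of_eq hl).symm
    have h : (List.ofFn n).sum = N := by
      rw [List.sum_ofFn]
      exact Finset.Nat.mem_antidiagonalTuple.1 (Finset.mem_filter.1 hn).1
    exact star_congr (fun m hm => (trunc_apply_of_eq
        (x := fun m => evalEven x ((List.ofFn n).splitLengths m)) (hm.trans (hl.trans h.symm))).symm)
      fun m hm => (trunc_apply_of_eq
        (x := fun m => evalOdd y ((List.ofFn n).splitLengths m)) (hm.trans (hl.trans h.symm))).symm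
  · rw [trunc_apply_of_ne hl]
    exact (Finset.sum_eq_zero fun n _ => trunc_apply_of_ne hl).symm

section degree
variable {ι : Type*} [AddCommGroup ι] {M : ι → AddSubgroup k} {A : ι → AddSubgroup H}

theorem trunc_mem_homogeneous {p : ℤ × ι} {x : BarCochain k H} (hx : x ∈ homogeneous M A p) (n : ℕ) :
    trunc n x ∈ homogeneous M A ((n : ℤ), p.2) := by
  rw [mem_homogeneous_iff] at hx ⊢
  refine ⟨fun l hl => trunc_apply_of_ne fun h => hl (congrArg _ h),
    isMultilinear_trunc fun l r _ => hx.2.1 l r, fun L hL => ?_⟩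
  by_cases h : (L.map Prod.snd).length = n
  · rw [trunc_apply_of_eq h]; exact hx.2.2 L hL
  · rw [trunc_apply_of_ne h]; exact zero_mem _

theorem trunc_cup_mem_homogeneous [SetLike.GradedMonoid M] [SetLike.GradedMonoid A]
    (hε : ∀ e, ∀ a ∈ A e, Coalgebra.counit (R := k) a ∈ M e)
    (hΔ : ∀ e, ∀ a ∈ A e, Coalgebra.comul (R := k) a ∈ tensorGrading k A e)
    {p q : ℤ × ι} {x y : BarCochain k H} (hx : x ∈ homogeneous M A p) (hy : y ∈ homogeneous M A q)
    (N i : ℕ) : trunc N (cup i x y) ∈ homogeneous M A (N, p.2 + q.2) := by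
  rw [trunc_cup]
  refine sum_mem fun n _ => ?_
  rw [mem_homogeneous_iff] at hx hy
  have hu : evenFace x (List.ofFn n) ∈ homogeneous M A (((List.ofFn n).sum : ℕ), p.2) := by
    rw [mem_homogeneous_iff]
    exact ⟨fun l hl => trunc_apply_of_ne fun h => hl (congrArg _ h), hx.2.1.evenFace _,
      Lowers.trunc_split _ fun Bs hBs => Lowers.evalEven hε Bs hx.2.2 hBs⟩
  have hv : oddFace y (List.ofFn n) ∈ homogeneous M A (((List.ofFn n).sum : ℕ), q.2) := by
    rw [mem_homogeneous_iff]
    exact ⟨fun l hl => trunc_apply_of_ne fun h => hl (congrArg _ h), hy.2.1.oddFace _,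
      Lowers.trunc_split _ fun Bs hBs => Lowers.evalOdd hε Bs hy.2.2 hBs⟩
  exact trunc_mem_homogeneous (star_mem_homogeneous hΔ hu hv) N

end degree
end cup
end BarCochain

/-! ### Gradings of the motivic Steenrod algebra -/

namespace Steenrod
open SteenrodAlg BarCochain

theorem mul_mem_of_mem_closure {R : Type*} [Ring R] {S T : Set R} {N : AddSubgroup R}
    (h : ∀ x ∈ S, ∀ y ∈ T, x * y ∈ N) {x y : R} (hx : x ∈ AddSubgroup.closure S)
    (hy : y ∈ AddSubgroup.closure T) : x * y ∈ N := by
  have h1 : AddSubgroup.closure S ≤ N.comap (AddMonoidHom.mulRight y) := by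
    rw [AddSubgroup.closure_le]
    intro x hx
    have h2 : AddSubgroup.closure T ≤ N.comap (AddMonoidHom.mulLeft x) :=
      (AddSubgroup.closure_le _).2 fun y hy => h x hx y hy
    exact h2 hy
  exact h1 hx

/-- The degree of the monomial `Sq^(i₁) ⋯ Sq^(iᵣ)` in the motivic Steenrod algebra. -/
def monoDeg (l : List ℕ) : ℤ × ℤ := ((l.sum : ℤ), ((l.map (· / 2)).sum : ℕ))

theorem monoDeg_append (l m : List ℕ) : monoDeg (l ++ m) = monoDeg l + monoDeg m := by
  simp [monoDeg]

theorem smul_mono_mem (j : ℕ) (l : List ℕ) {e : ℤ × ℤ} (h : e = (0, (j : ℤ)) + monoDeg l) :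
    (X ^ j : M2) • mono X l ∈ motivicGrading e :=
  AddSubgroup.subset_closure ⟨j, l, by rw [h]; simp [monoDeg], rfl⟩

theorem mono_mem (l : List ℕ) : mono X l ∈ motivicGrading (monoDeg l) := by
  have := smul_mono_mem 0 l (e := monoDeg l) (by simp)
  rwa [pow_zero, one_smul] at this

theorem motivicGrading_induction {e : ℤ × ℤ} {N : AddSubgroup MotivicSteenrod}
    (h : ∀ (j : ℕ) (l : List ℕ), e = (0, (j : ℤ)) + monoDeg l → (X ^ j : M2) • mono (X : M2) l ∈ N) :
    motivicGrading e ≤ N := by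
  refine (AddSubgroup.closure_le _).2 ?_
  rintro _ ⟨j, l, hj, rfl⟩
  exact h j l (by rw [hj]; simp [monoDeg])

instance : SetLike.GradedMonoid motivicGrading where
  one_mem := mono_mem []
  mul_mem := by
    intro d e a b ha hb
    refine mul_mem_of_mem_closure ?_ ha hb
    rintro _ ⟨i, l, rfl, rfl⟩ _ ⟨j, m, rfl, rfl⟩
    rw [smul_mul_smul_comm, ← pow_add]
    refine AddSubgroup.subset_closure ⟨i + j, l ++ m, ?_, by rw [List.map_append, List.prod_append]⟩
    ext
    · simp
    · simp; ring

theorem X_pow_mem (j : ℕ) : (X ^ j : M2) ∈ motivicBase (0, (j : ℤ)) := by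
  intro i hi
  rw [coeff_X_pow] at hi
  rw [show i = j by by_contra h; exact hi (if_neg h)]

theorem counit_mem_motivicBase (e : ℤ × ℤ) :
    ∀ a ∈ motivicGrading e, Coalgebra.counit (R := M2) a ∈ motivicBase e := by
  refine motivicGrading_induction (N := (motivicBase e).comap
    (Coalgebra.counit (R := M2) (A := MotivicSteenrod)).toAddMonoidHom) fun j l hj => ?_
  change Coalgebra.counit (R := M2) ((X ^ j : M2) • mono (X : M2) l) ∈ motivicBase e
  rw [map_smul, smul_eq_mul, counit_eq]
  by_cases h : l.sum = 0
  · have h2 : (l.map (· / 2)).sum = 0 := by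
      rw [List.sum_eq_zero_iff] at h ⊢
      intro x hx
      obtain ⟨y, hy, rfl⟩ := List.mem_map.1 hx
      rw [h y hy, Nat.zero_div]
    rw [augmentation_mono_of_eq _ h, mul_one, hj, monoDeg, h, h2]
    simpa using X_pow_mem j
  · rw [augmentation_mono_of_ne _ h, mul_zero]
    exact zero_mem _

theorem tmul_mem_tensorGrading {e e₁ e₂ : ℤ × ℤ} {b c : MotivicSteenrod} (hb : b ∈ motivicGrading e₁)
    (hc : c ∈ motivicGrading e₂) (h : e₁ + e₂ = e) :
    b ⊗ₜ[M2] c ∈ tensorGrading M2 motivicGrading e :=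
  AddSubgroup.subset_closure ⟨e₁, e₂, b, hb, c, hc, h, rfl⟩

theorem coproduct_mono_mem (l : List ℕ) :
    coproduct X (mono X l) ∈ tensorGrading M2 motivicGrading (monoDeg l) := by
  induction l with
  | nil =>
    rw [mono_nil, map_one]
    exact tmul_mem_tensorGrading (mono_mem []) (mono_mem []) rfl
  | cons n l ih =>
    rw [mono_cons, map_mul]
    have hn : coproduct X (Sq X n) ∈ tensorGrading M2 motivicGrading (monoDeg [n]) := by
      rw [coproduct_Sq]
      refine sum_mem fun i hi => ?_
      simp only [Finset.mem_range] at hi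
      rw [TensorProduct.smul_tmul']
      have h1 := smul_mono_mem (n / 2 - (i / 2 + (n - i) / 2)) [i] rfl
      have h2 := mono_mem [n - i]
      rw [show mono X [i] = Sq X i by simp [mono]] at h1
      rw [show mono X [n - i] = Sq X (n - i) by simp [mono]] at h2
      refine tmul_mem_tensorGrading h1 h2 ?_
      simp only [monoDeg, List.map_cons, List.map_nil, List.sum_cons, List.sum_nil]
      ext
      · simp only [Prod.fst_add]; omega
      · simp only [Prod.snd_add]; omega
    refine mul_mem_of_mem_closure ?_ hn ih
    rintro _ ⟨e₁, e₂, b, hb, c, hc, he, rfl⟩ _ ⟨e₁', e₂', b', hb', c', hc', he', rfl⟩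
    rw [Algebra.TensorProduct.tmul_mul_tmul]
    refine tmul_mem_tensorGrading (SetLike.GradedMul.mul_mem hb hb')
      (SetLike.GradedMul.mul_mem hc hc') ?_
    rw [show n :: l = [n] ++ l from rfl, monoDeg_append, ← he, ← he']
    abel

theorem comul_mem_tensorGrading (e : ℤ × ℤ) :
    ∀ a ∈ motivicGrading e, Coalgebra.comul (R := M2) a ∈ tensorGrading M2 motivicGrading e := by
  refine motivicGrading_induction (N := (tensorGrading M2 motivicGrading e).comap
    (Coalgebra.comul (R := M2) (A := MotivicSteenrod)).toAddMonoidHom) fun j l hj => ?_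
  change Coalgebra.comul (R := M2) ((X ^ j : M2) • mono (X : M2) l) ∈
    tensorGrading M2 motivicGrading e
  rw [map_smul, comul_eq]
  have h : tensorGrading M2 motivicGrading (monoDeg l) ≤ (tensorGrading M2 motivicGrading e).comap
      (LinearMap.lsmul M2 _ (X ^ j : M2)).toAddMonoidHom := by
    refine (AddSubgroup.closure_le _).2 ?_
    rintro _ ⟨e₁, e₂, b, hb, c, hc, he, rfl⟩
    change (X ^ j : M2) • (b ⊗ₜ[M2] c) ∈ tensorGrading M2 motivicGrading e
    rw [TensorProduct.smul_tmul']
    have hb' : (X ^ j : M2) • b ∈ motivicGrading ((0, (j : ℤ)) + e₁) := by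
      have := SetLike.GradedMul.mul_mem (smul_mono_mem j [] (e := (0, (j : ℤ))) (by simp [monoDeg])) hb
      rwa [mono_nil, smul_one_mul] at this
    refine tmul_mem_tensorGrading hb' hc ?_
    rw [hj, ← he, add_assoc]
  exact h (coproduct_mono_mem l)

/-! ### Cochains in Chow degree zero -/

theorem chow_monoDeg_nonneg (l : List ℕ) : 0 ≤ (monoDeg l).1 - 2 * (monoDeg l).2 := by
  induction l with
  | nil => simp [monoDeg]
  | cons n l ih =>
    simp only [monoDeg, List.map_cons, List.sum_cons] at ih ⊢
    omega

theorem chow_monoDeg_pos {l : List ℕ} (h : ∃ n ∈ l, Odd n) :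
    0 < (monoDeg l).1 - 2 * (monoDeg l).2 := by
  obtain ⟨n, hn, ho⟩ := h
  obtain ⟨s, t, rfl⟩ := List.append_of_mem hn
  have h1 := chow_monoDeg_nonneg s
  have h2 := chow_monoDeg_nonneg t
  have h3 : 0 < (monoDeg [n]).1 - 2 * (monoDeg [n]).2 := by
    obtain ⟨m, rfl⟩ := ho
    simp only [monoDeg, List.map_cons, List.sum_cons, List.map_nil, List.sum_nil]
    omega
  rw [show s ++ n :: t = s ++ ([n] ++ t) from rfl, monoDeg_append, monoDeg_append]
  simp only [Prod.fst_add, Prod.snd_add]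
  linarith

theorem chow_sum_monoDeg_nonneg (Ls : List (List ℕ)) :
    0 ≤ (Ls.map monoDeg).sum.1 - 2 * (Ls.map monoDeg).sum.2 := by
  induction Ls with
  | nil => simp
  | cons l Ls ih =>
    have := chow_monoDeg_nonneg l
    simp only [List.map_cons, List.sum_cons, Prod.fst_add, Prod.snd_add]
    linarith

theorem chow_sum_monoDeg_pos {Ls : List (List ℕ)} {l : List ℕ} (hl : l ∈ Ls) (h : ∃ n ∈ l, Odd n) :
    0 < (Ls.map monoDeg).sum.1 - 2 * (Ls.map monoDeg).sum.2 := by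
  obtain ⟨S, T, rfl⟩ := List.append_of_mem hl
  have h1 := chow_sum_monoDeg_nonneg S
  have h2 := chow_sum_monoDeg_nonneg T
  have h3 := chow_monoDeg_pos h
  simp only [List.map_append, List.map_cons, List.sum_append, List.sum_cons, Prod.fst_add, Prod.snd_add]
  linarith

/-- The motivic cochains that are sums of homogeneous cochains with degrees in `S`. -/
noncomputable def cochainPart (S : Set (ℤ × (ℤ × ℤ))) : AddSubgroup (BarCochain M2 MotivicSteenrod) :=
  ⨆ p : S, homogeneous motivicBase motivicGrading p

theorem mem_cochainPart {S : Set (ℤ × (ℤ × ℤ))} {p : ℤ × (ℤ × ℤ)} (hp : p ∈ S)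
    {x : BarCochain M2 MotivicSteenrod} (hx : x ∈ homogeneous motivicBase motivicGrading p) :
    x ∈ cochainPart S := AddSubgroup.mem_iSup_of_mem (⟨p, hp⟩ : S) hx

theorem cochainPart_induction {S : Set (ℤ × (ℤ × ℤ))} {P : BarCochain M2 MotivicSteenrod → Prop}
    (hom : ∀ p ∈ S, ∀ x ∈ homogeneous motivicBase motivicGrading p, P x)
    (zero : P 0) (add : ∀ x y, P x → P y → P (x + y)) {x : BarCochain M2 MotivicSteenrod}
    (hx : x ∈ cochainPart S) : P x :=
  AddSubgroup.iSup_induction _ (C := P) hx (fun p x hx => hom p p.2 x hx) zero add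

theorem isMultilinear_of_mem_cochainPart {S : Set (ℤ × (ℤ × ℤ))} {x : BarCochain M2 MotivicSteenrod}
    (hx : x ∈ cochainPart S) : IsMultilinear x :=
  cochainPart_induction (fun _ _ _ hx => isMultilinear_of_mem_homogeneous _ _ hx) .zero
    (fun _ _ => .add) hx

theorem d_mem_cochainPart {S : Set (ℤ × (ℤ × ℤ))} (hS : ∀ p ∈ S, p + (1, 0) ∈ S)
    {x : BarCochain M2 MotivicSteenrod} (hx : x ∈ cochainPart S) : d x ∈ cochainPart S :=
  cochainPart_induction (P := fun x => d x ∈ cochainPart S)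
    (fun p hp _ hx => mem_cochainPart (hS p hp) (d_mem_homogeneous counit_mem_motivicBase hx))
    (by rw [d_zero]; exact zero_mem _) (fun x y hx hy => by rw [d_add]; exact add_mem hx hy) hx

theorem mul_mem_cochainPart (S : AddSubmonoid (ℤ × (ℤ × ℤ))) {x y : BarCochain M2 MotivicSteenrod}
    (hx : x ∈ cochainPart S) (hy : y ∈ cochainPart S) : x * y ∈ cochainPart S := by
  refine cochainPart_induction (P := fun x => x * y ∈ cochainPart S) (fun p hp x hx => ?_)
    (by rw [zero_mul]; exact zero_mem _) (fun x x' h h' => by rw [add_mul]; exact add_mem h h') hx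
  refine cochainPart_induction (P := fun y => x * y ∈ cochainPart S) (fun q hq y hy => ?_)
    (by rw [mul_zero]; exact zero_mem _) (fun y y' h h' => by rw [mul_add]; exact add_mem h h') hy
  exact mem_cochainPart (add_mem hp hq) (mul_mem_homogeneous _ _ hx hy)

/-- The powers of `τ` in a value at monomials are determined by the degrees. -/
theorem exists_degree_of_coeff_ne_zero {S : Set (ℤ × (ℤ × ℤ))} {x : BarCochain M2 MotivicSteenrod}
    (hx : x ∈ cochainPart S) {Ls : List (List ℕ)} {j : ℕ}
    (h : Polynomial.coeff (x (Ls.map (mono X))) j ≠ 0) :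
    ∃ p ∈ S, p.1 = Ls.length ∧ (Ls.map monoDeg).sum - p.2 = (0, (j : ℤ)) := by
  revert h
  refine cochainPart_induction (P := fun x => Polynomial.coeff (x (Ls.map (mono X))) j ≠ 0 →
    ∃ p ∈ S, p.1 = Ls.length ∧ (Ls.map monoDeg).sum - p.2 = (0, (j : ℤ)))
    (fun p hp x hx h => ⟨p, hp, ?_, ?_⟩)
    (fun h => absurd (coeff_zero j) h) (fun x y hx hy h => ?_) hx
  · by_contra hl
    rw [((mem_homogeneous_iff _ _).1 hx).1 _ fun h => hl (by rw [← h, List.length_map])] at h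
    exact h (coeff_zero j)
  · have h1 := ((mem_homogeneous_iff _ _).1 hx).2.2 (Ls.map fun l => (monoDeg l, mono X l)) (by
      intro q hq
      obtain ⟨l, _, rfl⟩ := List.mem_map.1 hq
      exact mono_mem l)
    rw [List.map_map, List.map_map] at h1
    exact h1 j h
  · by_cases h0 : Polynomial.coeff (x (Ls.map (mono X))) j = 0
    · refine hy fun h1 => h ?_
      rw [BarCochain.add_apply, coeff_add, h0, h1, add_zero]
    · exact hx h0

theorem exists_eq_map_mono {l m : List MotivicSteenrod}
    (h : List.Forall₂ (fun _ b => b ∈ Set.range (mono X)) l m) : ∃ Ls, m = List.map (mono X) Ls := by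
  induction h with
  | nil => exact ⟨[], rfl⟩
  | cons h _ ih =>
    obtain ⟨l, rfl⟩ := h
    obtain ⟨Ls, rfl⟩ := ih
    exact ⟨l :: Ls, rfl⟩

/-- A multilinear cochain is determined by its values at monomials. -/
theorem eq_zero_of_monomials {x : BarCochain M2 MotivicSteenrod} (hx : IsMultilinear x)
    (h : ∀ Ls : List (List ℕ), x (Ls.map (mono X)) = 0) : x = 0 := by
  funext l
  refine eq_zero_of_forall₂ (RingHom.id M2) (fun _ b => b ∈ Set.range (mono X))
    (fun l r => (hx l r).map_add) (fun l r => (hx l r).map_smul) l (fun a _ => ?_) fun m hm => ?_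
  · exact (span_range_mono (X : M2)).symm ▸ trivial
  · obtain ⟨Ls, rfl⟩ := exists_eq_map_mono hm
    exact h Ls

theorem eq_zero_of_mem_cochainPart_of_disjoint {S T : Set (ℤ × (ℤ × ℤ))} (hST : Disjoint S T)
    {x : BarCochain M2 MotivicSteenrod} (hx : x ∈ cochainPart S) (hx' : x ∈ cochainPart T) : x = 0 := by
  refine eq_zero_of_monomials (isMultilinear_of_mem_cochainPart hx) fun Ls => ?_
  ext j
  by_contra h
  obtain ⟨p, hp, h1, h2⟩ := exists_degree_of_coeff_ne_zero hx h
  obtain ⟨q, hq, h3, h4⟩ := exists_degree_of_coeff_ne_zero hx' h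
  obtain rfl : p = q := Prod.ext (h1.trans h3.symm) (sub_right_injective (h2.trans h4.symm))
  exact Set.disjoint_left.1 hST hp hq

/-- In Chow degree zero the values at monomials are constants: monomials have nonnegative Chow degree, and
`τ` has negative Chow degree. Hence a cochain vanishes if its values are divisible by `τ`. -/
theorem eq_zero_of_coeff_zero {x : BarCochain M2 MotivicSteenrod} (hx : x ∈ cochainPart chowZeroDegrees)
    (h : ∀ l, Polynomial.coeff (x l) 0 = 0) : x = 0 := by
  refine eq_zero_of_monomials (isMultilinear_of_mem_cochainPart hx) fun Ls => ?_
  ext j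
  by_contra hj
  obtain ⟨p, hp, -, h1⟩ := exists_degree_of_coeff_ne_zero hx hj
  have hp : p.2.1 - 2 * p.2.2 = 0 := hp
  have h2 := chow_sum_monoDeg_nonneg Ls
  have h3 : (Ls.map monoDeg).sum.1 - p.2.1 = 0 := congrArg Prod.fst h1
  have h4 : (Ls.map monoDeg).sum.2 - p.2.2 = j := congrArg Prod.snd h1
  obtain rfl : j = 0 := by omega
  exact hj (h _)

theorem eq_of_coeff_zero_eq {x y : BarCochain M2 MotivicSteenrod} (hx : x ∈ cochainPart chowZeroDegrees)
    (hy : y ∈ cochainPart chowZeroDegrees)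
    (h : ∀ l, Polynomial.coeff (x l) 0 = Polynomial.coeff (y l) 0) : x = y := by
  rw [← sub_eq_zero]
  refine eq_zero_of_coeff_zero (sub_mem hx hy) fun l => ?_
  have : (x - y) l = x l - y l := rfl
  rw [this, coeff_sub, h, sub_self]

/-- The constant terms of the values vanish if a variable is a monomial with an odd factor, since such
a monomial has positive Chow degree. -/
theorem coeff_zero_of_odd {x : BarCochain M2 MotivicSteenrod} (hx : x ∈ cochainPart chowZeroDegrees)
    {l₀ : List ℕ} (h₀ : ∃ n ∈ l₀, Odd n) {l : List MotivicSteenrod} (hl : mono X l₀ ∈ l) :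
    Polynomial.coeff (x l) 0 = 0 := by
  have hm := isMultilinear_of_mem_cochainPart hx
  -- The other variables are expanded in monomials, while `mono X l₀` is kept.
  have key : ∀ l m : List MotivicSteenrod,
      List.Forall₂ (fun c b => ∃ l, b = mono X l ∧ (c = mono X l₀ → l = l₀)) l m →
        ∃ Ls, m = List.map (mono X) Ls ∧ (mono X l₀ ∈ l → l₀ ∈ Ls) := by
    intro l m h
    induction h with
    | nil => exact ⟨[], rfl, by simp⟩
    | cons h _ ih =>
      obtain ⟨l, rfl, h⟩ := h
      obtain ⟨Ls, rfl, h'⟩ := ih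
      refine ⟨l :: Ls, rfl, fun h1 => ?_⟩
      rcases List.mem_cons.1 h1 with h1 | h1
      · rw [h h1.symm]; exact List.mem_cons_self
      · exact List.mem_cons_of_mem _ (h' h1)
  refine eq_zero_of_forall₂ (F := fun l => Polynomial.coeff (x l) 0) (constantCoeff : M2 →+* ZMod 2)
    (fun c b => ∃ l, b = mono X l ∧ (c = mono X l₀ → l = l₀))
    (fun l r a b => ?_) (fun l r c a => ?_) l (fun c _ => ?_) fun m h => ?_
  · simp only [(hm l r).map_add, coeff_add]
  · simp only [(hm l r).map_smul, smul_eq_mul, mul_coeff_zero]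
    rfl
  · by_cases hc : c = mono X l₀
    · exact Submodule.subset_span ⟨l₀, hc, fun _ => rfl⟩
    · refine Submodule.span_mono (s := Set.range (mono X)) ?_ ((span_range_mono (X : M2)).symm ▸ trivial)
      rintro _ ⟨l, rfl⟩
      exact ⟨l, rfl, fun h => absurd h hc⟩
  · obtain ⟨Ls, rfl, h'⟩ := key l m h
    by_contra hj
    obtain ⟨p, hp, -, h1⟩ := exists_degree_of_coeff_ne_zero hx hj
    have hp : p.2.1 - 2 * p.2.2 = 0 := hp
    have h2 := chow_sum_monoDeg_pos (h' hl) h₀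
    have h3 : (Ls.map monoDeg).sum.1 - p.2.1 = 0 := congrArg Prod.fst h1
    have h4 : (Ls.map monoDeg).sum.2 - p.2.2 = (0 : ℕ) := congrArg Prod.snd h1
    omega

theorem coeff_zero_of_red_eq_zero {x : BarCochain M2 MotivicSteenrod}
    (hx : x ∈ cochainPart chowZeroDegrees) (l r : List MotivicSteenrod) {a : MotivicSteenrod}
    (ha : red a = 0) : Polynomial.coeff (x (l ++ a :: r)) 0 = 0 := by
  have hm := isMultilinear_of_mem_cochainPart hx l r
  replace ha := mem_span_kerGenerators_of_red_eq_zero ha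
  induction ha using Submodule.span_induction with
  | mem a ha =>
    rcases ha with ⟨b, rfl⟩ | ⟨l₀, h₀, rfl⟩
    · rw [hm.map_smul, smul_eq_mul, mul_coeff_zero, coeff_X_zero, zero_mul]
    · exact coeff_zero_of_odd hx h₀ (by simp)
  | zero => rw [hm.map_zero, coeff_zero]
  | add a b _ _ ha hb => rw [hm.map_add, coeff_add, ha, hb, add_zero]
  | smul c a _ ha => rw [hm.map_smul, smul_eq_mul, mul_coeff_zero, ha, mul_zero]

/-- The constant terms of the values depend only on the images of the variables in the classical Steenrod
algebra. -/
theorem coeff_zero_eq_of_map_red_eq {x : BarCochain M2 MotivicSteenrod}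
    (hx : x ∈ cochainPart chowZeroDegrees) {l l' : List MotivicSteenrod}
    (h : l.map red = l'.map red) : Polynomial.coeff (x l) 0 = Polynomial.coeff (x l') 0 := by
  suffices ∀ s : List MotivicSteenrod,
      Polynomial.coeff (x (s ++ l)) 0 = Polynomial.coeff (x (s ++ l')) 0 from this []
  induction l generalizing l' with
  | nil =>
    obtain rfl : l' = [] := by simpa using h.symm
    exact fun s => rfl
  | cons a l ih =>
    cases l' with
    | nil => simp at h
    | cons a' l' =>
      simp only [List.map_cons, List.cons.injEq] at h
      intro s
      have h1 := ih h.2 (s ++ [a])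
      simp only [List.append_assoc, List.cons_append, List.nil_append] at h1
      have h2 := coeff_zero_of_red_eq_zero hx s l' (a := a - a') (by rw [map_sub, h.1, sub_self])
      rw [(isMultilinear_of_mem_cochainPart hx s l').map_sub, coeff_sub, sub_eq_zero] at h2
      exact h1.trans h2

end Steenrod

/-! ### Reduction of cochains modulo `τ` -/

namespace Steenrod
open SteenrodAlg BarCochain

/-- `y` is the reduction of `x` modulo `τ`: the constant terms of the values of `x` are the values of `y` at the
images of the variables in the classical Steenrod algebra. -/
def Reduces (x : BarCochain M2 MotivicSteenrod) (y : BarCochain (ZMod 2) ClassicalSteenrod) : Prop :=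
  ∀ l : List MotivicSteenrod, Polynomial.coeff (x l) 0 = y (l.map red)

namespace Reduces
variable {x x' : BarCochain M2 MotivicSteenrod} {y y' : BarCochain (ZMod 2) ClassicalSteenrod}

theorem zero : Reduces 0 0 := fun _ => coeff_zero 0

theorem add (h : Reduces x y) (h' : Reduces x' y') : Reduces (x + x') (y + y') := fun l =>
  (coeff_add _ _ 0).trans (congrArg₂ (· + ·) (h l) (h' l))

theorem sum {ι : Type*} {s : Finset ι} {x : ι → BarCochain M2 MotivicSteenrod}
    {y : ι → BarCochain (ZMod 2) ClassicalSteenrod} (h : ∀ i ∈ s, Reduces (x i) (y i)) :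
    Reduces (∑ i ∈ s, x i) (∑ i ∈ s, y i) := by
  classical
  induction s using Finset.induction_on with
  | empty => exact zero
  | insert i s hi ih =>
    rw [Finset.sum_insert hi, Finset.sum_insert hi]
    exact (h i (Finset.mem_insert_self i s)).add (ih fun j hj => h j (Finset.mem_insert_of_mem hj))

theorem one : Reduces 1 1 := by
  rintro (_ | ⟨a, l⟩)
  · exact coeff_one_zero
  · exact coeff_zero 0

theorem mul (h : Reduces x y) (h' : Reduces x' y') : Reduces (x * x') (y * y') := by
  intro l
  rw [mul_apply, mul_apply, finsetSum_coeff, List.length_map]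
  refine Finset.sum_congr rfl fun p _ => ?_
  rw [mul_coeff_zero, h, h', List.map_take, List.map_drop]

theorem shift (h : Reduces x y) (a : MotivicSteenrod) : Reduces (x.shift a) (y.shift (red a)) :=
  fun l => h (a :: l)

theorem inner (h : Reduces x y) : Reduces (inner x) (inner y) := by
  intro l
  induction l generalizing x y with
  | nil => exact coeff_zero 0
  | cons a l ih =>
    cases l with
    | nil => exact coeff_zero 0
    | cons b l =>
      refine (coeff_add _ _ 0).trans (congrArg₂ (· + ·) ((h (a * b :: l)).trans ?_) (ih (h.shift a)))
      rw [List.map_cons, map_mul]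

theorem counitCochain :
    Reduces (counitCochain M2 MotivicSteenrod) (counitCochain (ZMod 2) ClassicalSteenrod)
  | [] => coeff_zero 0
  | [a] => (counit_red a).symm
  | _ :: _ :: _ => coeff_zero 0

theorem d (h : Reduces x y) : Reduces (d x) (d y) :=
  ((counitCochain.mul h).add h.inner).add (h.mul counitCochain)

theorem star (hy : IsMultilinear y) (hy' : IsMultilinear y') (h : Reduces x y) (h' : Reduces x' y') :
    Reduces (star x x') (star y y') := by
  intro l
  induction l generalizing x x' y y' with
  | nil => exact (mul_coeff_zero _ _).trans (congrArg₂ (· * ·) (h []) (h' []))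
  | cons a l ih =>
    refine Eq.trans ?_ (star_cons_eq_lift hy hy' (red a) (l.map red)).symm
    rw [comul_red]
    conv_rhs => rw [← (Coalgebra.Repr.arbitrary M2 a).eq]
    rw [map_sum, map_sum, star_cons_eq_sum, finsetSum_coeff]
    exact Finset.sum_congr rfl fun i _ => ih (hy.shift _) (hy'.shift _) (h.shift _) (h'.shift _)

theorem evalEven : ∀ (L : List (List MotivicSteenrod)) {x : BarCochain M2 MotivicSteenrod}
    {y : BarCochain (ZMod 2) ClassicalSteenrod}, Reduces x y →
      Polynomial.coeff (evalEven x L) 0 = BarCochain.evalEven y (L.map (List.map red))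
  | [], x, y, h => by
    rw [List.map_nil, evalEven_nil, evalEven_nil]
    exact h []
  | [B], x, y, h => by
    rw [List.map_singleton, evalEven_singleton, evalEven_singleton]
    exact h B
  | [B, C], x, y, h => by
    simp only [List.map_cons, List.map_nil, evalEven_pair]
    rw [mul_coeff_zero, h, ← counit_red, map_list_prod]
  | B :: C :: D :: L, x, y, h => by
    simp only [List.map_cons, evalEven_cons]
    refine evalEven (D :: L) fun l => (h _).trans ?_
    rw [List.map_append, List.map_cons, map_list_prod]

theorem evalOdd (h : Reduces x y) (L : List (List MotivicSteenrod)) :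
    Polynomial.coeff (evalOdd x L) 0 = BarCochain.evalOdd y (L.map (List.map red)) := by
  cases L with
  | nil => exact h []
  | cons B L =>
    refine (mul_coeff_zero _ _).trans (congrArg₂ (· * ·) ?_ (evalEven L h))
    rw [← counit_red, map_list_prod]

theorem trunc (h : Reduces x y) (n : ℕ) : Reduces (trunc n x) (trunc n y) := by
  intro l
  by_cases hl : l.length = n
  · refine (congrArg (Polynomial.coeff · 0) (trunc_apply_of_eq hl)).trans ((h l).trans ?_)
    exact (trunc_apply_of_eq (by rw [List.length_map, hl])).symm
  · refine (congrArg (Polynomial.coeff · 0) (trunc_apply_of_ne hl)).trans ((coeff_zero 0).trans ?_)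
    exact (trunc_apply_of_ne (by rwa [List.length_map])).symm

theorem evenFace (h : Reduces x y) (ns : List ℕ) : Reduces (evenFace x ns) (evenFace y ns) :=
  trunc (fun l => (evalEven _ h).trans (by rw [map_splitLengths])) _

theorem oddFace (h : Reduces x y) (ns : List ℕ) : Reduces (oddFace x ns) (oddFace y ns) :=
  trunc (fun l => (h.evalOdd _).trans (by rw [map_splitLengths])) _

theorem cup (hy : IsMultilinear y) (hy' : IsMultilinear y') (h : Reduces x y) (h' : Reduces x' y')
    (i : ℕ) : Reduces (cup i x x') (cup i y y') := by
  intro l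
  have h1 : Reduces (BarCochain.trunc l.length (BarCochain.cup i x x'))
      (BarCochain.trunc l.length (BarCochain.cup i y y')) := by
    rw [trunc_cup, trunc_cup]
    exact sum fun n _ => ((h.evenFace _).star (hy.evenFace _) (hy'.oddFace _) (h'.oddFace _)).trunc _
  have h2 := h1 l
  rw [BarCochain.trunc, BarCochain.trunc, if_pos rfl, if_pos (List.length_map _)] at h2
  exact h2

/-- The reduction is unique. -/
theorem right_unique (h : Reduces x y) (h' : Reduces x y') : y = y' := by
  funext l
  obtain ⟨l, rfl⟩ := List.map_surjective_iff.2 red_surjective l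
  exact (h l).symm.trans (h' l)

/-- A cochain in Chow degree zero is determined by its reduction. -/
theorem left_unique (hx : x ∈ cochainPart chowZeroDegrees) (hx' : x' ∈ cochainPart chowZeroDegrees)
    (h : Reduces x y) (h' : Reduces x' y) : x = x' :=
  eq_of_coeff_zero_eq hx hx' fun l => (h l).trans (h' l).symm

end Reduces

/-- The homomorphism `(f, w) ↦ (f, (2 w, w))` onto the degrees with `s + f - 2 w = 0`. -/
def chowDeg : ℤ × ℤ →+ ℤ × (ℤ × ℤ) :=
  AddMonoidHom.mk' (fun p => (p.1, (2 * p.2, p.2))) fun p q => by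
    ext
    · rfl
    · exact mul_add 2 p.2 q.2
    · rfl

theorem chowDeg_apply (f w : ℤ) : chowDeg (f, w) = (f, (2 * w, w)) := rfl

theorem chowDeg_mem (p : ℤ × ℤ) : chowDeg p ∈ (chowZeroDegrees : Set (ℤ × (ℤ × ℤ))) := sub_self (2 * p.2)

theorem exists_chowDeg_eq {p : ℤ × (ℤ × ℤ)} (hp : p ∈ (chowZeroDegrees : Set (ℤ × (ℤ × ℤ)))) :
    ∃ q, p = chowDeg q := by
  have hp : p.2.1 - 2 * p.2.2 = 0 := hp
  exact ⟨(p.1, p.2.2), Prod.ext rfl (Prod.ext (sub_eq_zero.1 hp) rfl)⟩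

theorem monoDeg_two_mul (l : List ℕ) :
    monoDeg (l.map (2 * ·)) = (2 * (l.sum : ℤ), (l.sum : ℤ)) := by
  induction l with
  | nil => rfl
  | cons n l ih =>
    simp only [monoDeg, List.map_cons, List.sum_cons, Prod.mk.injEq] at ih ⊢
    omega

theorem classicalGrading_le (t : ℤ) :
    classicalGrading t ≤ (motivicGrading (2 * t, t)).map red.toAddMonoidHom := by
  refine (AddSubgroup.closure_le _).2 ?_
  rintro _ ⟨l, rfl, rfl⟩
  refine ⟨mono X (l.map (2 * ·)), ?_, red_mono_two_mul l⟩
  have h := mono_mem (l.map (2 * ·))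
  rwa [monoDeg_two_mul] at h

/-- The cochain whose values are the constant terms of the values of `x` at lifts of the variables. It is
the reduction of `x` in the sense of `Reduces` if `x` has Chow degree zero. -/
noncomputable def reduction (x : BarCochain M2 MotivicSteenrod) : BarCochain (ZMod 2) ClassicalSteenrod :=
  fun l => Polynomial.coeff (x (l.map (Function.surjInv red_surjective))) 0

theorem reduces_reduction {x : BarCochain M2 MotivicSteenrod} (hx : x ∈ cochainPart chowZeroDegrees) :
    Reduces x (reduction x) := by
  intro l
  refine coeff_zero_eq_of_map_red_eq hx ?_
  rw [List.map_map, List.map_map]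
  exact List.map_congr_left fun a _ => (Function.surjInv_eq red_surjective (red a)).symm

theorem reduction_mem_homogeneous {p : ℤ × ℤ} {x : BarCochain M2 MotivicSteenrod}
    (hx : x ∈ homogeneous motivicBase motivicGrading (chowDeg p)) :
    reduction x ∈ homogeneous classicalBase classicalGrading p := by
  have hred := reduces_reduction (mem_cochainPart (chowDeg_mem p) hx)
  generalize reduction x = y at hred
  have hsurj := List.map_surjective_iff.2 red_surjective
  rw [mem_homogeneous_iff] at hx ⊢
  refine ⟨fun l hl => ?_, fun l r => ⟨fun a b => ?_, fun c a => ?_⟩, fun L hL => ?_⟩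
  · obtain ⟨l, rfl⟩ := hsurj l
    rw [List.length_map] at hl
    rw [← hred l, hx.1 l hl, coeff_zero]
  · obtain ⟨l, rfl⟩ := hsurj l
    obtain ⟨r, rfl⟩ := hsurj r
    obtain ⟨a, rfl⟩ := red_surjective a
    obtain ⟨b, rfl⟩ := red_surjective b
    have h := hred (l ++ (a + b) :: r)
    rw [(hx.2.1 l r).map_add, coeff_add, hred, hred] at h
    simp only [List.map_append, List.map_cons, map_add] at h
    exact h.symm
  · obtain ⟨l, rfl⟩ := hsurj l
    obtain ⟨r, rfl⟩ := hsurj r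
    obtain ⟨a, rfl⟩ := red_surjective a
    have h := hred (l ++ ((C c : M2) • a) :: r)
    rw [(hx.2.1 l r).map_smul, smul_eq_mul, mul_coeff_zero, hred, coeff_C_zero] at h
    simp only [List.map_append, List.map_cons, red_smul, coeff_C_zero] at h
    exact h.symm
  · have hlift : ∃ L' : List ((ℤ × ℤ) × MotivicSteenrod), (∀ q ∈ L', q.2 ∈ motivicGrading q.1) ∧
        (L'.map Prod.snd).map red = L.map Prod.snd ∧
        (L'.map Prod.fst).sum = (2 * (L.map Prod.fst).sum, (L.map Prod.fst).sum) := by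
      clear hx hred
      induction L with
      | nil => exact ⟨[], by simp, rfl, rfl⟩
      | cons q L ih =>
        obtain ⟨L', h1, h2, h3⟩ := ih fun r hr => hL r (List.mem_cons_of_mem _ hr)
        obtain ⟨a, ha, ha'⟩ := classicalGrading_le q.1 (hL q List.mem_cons_self)
        refine ⟨((2 * q.1, q.1), a) :: L', fun r hr => ?_, ?_, ?_⟩
        · rcases List.mem_cons.1 hr with rfl | hr
          · exact ha
          · exact h1 r hr
        · simp only [List.map_cons, h2]
          exact congrArg (· :: _) ha'
        · simp only [List.map_cons, List.sum_cons, h3, Prod.mk_add_mk]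
          ring_nf
    obtain ⟨L', h1, h2, h3⟩ := hlift
    rw [← h2, ← hred]
    intro h
    have h4 := hx.2.2 L' h1 0 h
    rw [h3] at h4
    exact congrArg Prod.snd h4

/-- The `F₂[τ]`-multilinear extension of `y`: for `y` of `n` variables,
`(a₁, …, aₙ) ↦ ∑ τ^(j₁ + ⋯ + jₙ) y(b₁, …, bₙ)`, where `τ ^ jᵢ bᵢ` runs through the terms of the image
of `aᵢ` in `A_cl[τ]`. -/
noncomputable def extend (y : BarCochain (ZMod 2) ClassicalSteenrod) : BarCochain M2 MotivicSteenrod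
  | [] => C (y [])
  | a :: l => (polyRed a).sum fun j b => X ^ j * extend (y.shift b) l

theorem extend_nil (y : BarCochain (ZMod 2) ClassicalSteenrod) : extend y [] = C (y []) := rfl

theorem extend_cons (y : BarCochain (ZMod 2) ClassicalSteenrod) (a : MotivicSteenrod)
    (l : List MotivicSteenrod) :
    extend y (a :: l) = (polyRed a).sum fun j b => X ^ j * extend (y.shift b) l := rfl

theorem extend_add (y y' : BarCochain (ZMod 2) ClassicalSteenrod) (l : List MotivicSteenrod) :
    extend (y + y') l = extend y l + extend y' l := by
  induction l generalizing y y' with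
  | nil => exact C_add
  | cons a l ih =>
    simp only [extend_cons]
    rw [← Polynomial.sum_add]
    congr 1
    funext j b
    rw [← mul_add, ← ih]
    rfl

theorem extend_scale (c : ZMod 2) (y : BarCochain (ZMod 2) ClassicalSteenrod)
    (l : List MotivicSteenrod) : extend (scale c y) l = C c * extend y l := by
  induction l generalizing y with
  | nil => exact C_mul
  | cons a l ih =>
    simp only [extend_cons, Polynomial.sum_def, Finset.mul_sum]
    refine Finset.sum_congr rfl fun j _ => ?_
    rw [mul_left_comm, ← ih]
    rfl

theorem extend_zero (l : List MotivicSteenrod) : extend 0 l = 0 := by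
  have h : (0 : BarCochain (ZMod 2) ClassicalSteenrod) = scale 0 0 :=
    funext fun _ => (zero_mul (0 : ZMod 2)).symm
  rw [h, extend_scale, C_0, zero_mul]

theorem extend_eq_zero {y : BarCochain (ZMod 2) ClassicalSteenrod} {l : List MotivicSteenrod}
    (h : ∀ m : List ClassicalSteenrod, m.length = l.length → y m = 0) : extend y l = 0 := by
  induction l generalizing y with
  | nil => rw [extend_nil, h [] rfl, C_0]
  | cons a l ih =>
    rw [extend_cons, Polynomial.sum_def]
    refine Finset.sum_eq_zero fun j _ => ?_
    rw [ih (y := y.shift _) fun m hm => h (_ :: m) (by simp [hm]), mul_zero]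

/-- The value of `extend y` at `a :: l`, as a function of the image of `a` in `A_cl[τ]`. -/
noncomputable def extendHead {y : BarCochain (ZMod 2) ClassicalSteenrod} (hy : IsMultilinear y)
    (l : List MotivicSteenrod) : ClassicalSteenrod[X] →+ M2 where
  toFun q := q.sum fun j b => X ^ j * extend (y.shift b) l
  map_zero' := Polynomial.sum_zero_index _
  map_add' p q := Polynomial.sum_add_index p q _
    (fun j => by
      have := hy.shift_smul 0 0
      rw [zero_smul] at this
      rw [this, extend_scale, C_0, zero_mul, mul_zero])
    (fun j a b => by rw [hy.shift_add, extend_add, mul_add])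

theorem extendHead_monomial {y : BarCochain (ZMod 2) ClassicalSteenrod} (hy : IsMultilinear y)
    (l : List MotivicSteenrod) (j : ℕ) (b : ClassicalSteenrod) :
    extendHead hy l (monomial j b) = X ^ j * extend (y.shift b) l :=
  Polynomial.sum_monomial_index (n := j) b (fun j b => X ^ j * extend (y.shift b) l) (by
    have := hy.shift_smul 0 0
    rw [zero_smul] at this
    rw [this, extend_scale, C_0, zero_mul, mul_zero])

theorem extend_cons_eq_extendHead {y : BarCochain (ZMod 2) ClassicalSteenrod} (hy : IsMultilinear y)
    (l : List MotivicSteenrod) (a : MotivicSteenrod) :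
    extend y (a :: l) = extendHead hy l (polyRed a) := rfl

theorem extendHead_map_mul {y : BarCochain (ZMod 2) ClassicalSteenrod} (hy : IsMultilinear y)
    (l : List MotivicSteenrod) (c : M2) (q : ClassicalSteenrod[X]) :
    extendHead hy l (c.map (algebraMap (ZMod 2) ClassicalSteenrod) * q) = c * extendHead hy l q := by
  induction c using Polynomial.induction_on' with
  | add c c' hc hc' => rw [Polynomial.map_add, add_mul, map_add, hc, hc', add_mul]
  | monomial n c =>
    induction q using Polynomial.induction_on' with
    | add q q' hq hq' => rw [mul_add, map_add, hq, hq', map_add, mul_add]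
    | monomial m b =>
      rw [map_monomial, monomial_mul_monomial, extendHead_monomial, extendHead_monomial,
        ← Algebra.smul_def, hy.shift_smul, extend_scale, ← C_mul_X_pow_eq_monomial, pow_add]
      ring

theorem isMultilinear_extend {y : BarCochain (ZMod 2) ClassicalSteenrod} (hy : IsMultilinear y) :
    IsMultilinear (extend y) := by
  intro l
  induction l generalizing y with
  | nil =>
    intro r
    simp only [List.nil_append, extend_cons_eq_extendHead hy]
    constructor
    · intro a b
      rw [map_add, map_add]
    · intro c a
      rw [polyRed_smul, extendHead_map_mul, smul_eq_mul]
  | cons a l ih =>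
    intro r
    simp only [List.cons_append, extend_cons, Polynomial.sum_def]
    constructor
    · intro b c
      simp only [(ih (hy.shift _) r).map_add, mul_add, Finset.sum_add_distrib]
    · intro c b
      simp only [(ih (hy.shift _) r).map_smul, Finset.smul_sum, mul_smul_comm]

theorem lowers_extend {e : ℤ} {y : BarCochain (ZMod 2) ClassicalSteenrod} (hy : IsMultilinear y)
    (hy' : Lowers classicalBase classicalGrading e y) :
    Lowers motivicBase motivicGrading (2 * e, e) (extend y) := by
  intro L
  induction L generalizing e y with
  | nil =>
    intro _ j hj
    have h : Polynomial.coeff (C (y [])) j ≠ 0 := hj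
    obtain rfl : j = 0 := by
      by_contra h0
      exact h (coeff_C_of_ne_zero h0)
    rw [coeff_C_zero] at h
    have h1 : (0 : ℤ) - e = 0 := hy' [] (by simp) h
    ext
    · simp; omega
    · simp; omega
  | cons q L ih =>
    intro hL
    have key : motivicGrading q.1 ≤ (motivicBase (q.1 + (L.map Prod.fst).sum - (2 * e, e))).comap
        ((extendHead hy (L.map Prod.snd)).comp polyRed.toAddMonoidHom) := by
      refine motivicGrading_induction fun j l hj => ?_
      change extendHead hy (L.map Prod.snd) (polyRed ((X ^ j : M2) • mono (X : M2) l)) ∈ motivicBase _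
      rw [polyRed_smul, extendHead_map_mul, polyRed_mono]
      by_cases hl : ∃ n ∈ l, Odd n
      · obtain ⟨n, hn, ho⟩ := hl
        rw [prod_halfSq_of_odd hn ho, C_0, map_zero, mul_zero]
        exact zero_mem _
      · obtain ⟨m, rfl⟩ := exists_eq_map_two_mul fun n hn ho => hl ⟨n, hn, ho⟩
        rw [prod_halfSq_two_mul, ← monomial_zero_left, extendHead_monomial, pow_zero, one_mul]
        have hm : mono 1 m ∈ classicalGrading m.sum := AddSubgroup.subset_closure ⟨m, rfl, rfl⟩
        have h1 := ih (hy.shift (mono 1 m)) (hy'.shift hm) fun r hr => hL r (List.mem_cons_of_mem _ hr)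
        refine mem_of_mem_of_eq (SetLike.GradedMul.mul_mem (X_pow_mem j) h1) ?_
        rw [hj, monoDeg_two_mul]
        ext
        · simp; ring
        · simp; ring
    rw [List.map_cons, List.map_cons, List.sum_cons]
    exact key (hL q List.mem_cons_self)

theorem extend_mem_homogeneous {p : ℤ × ℤ} {y : BarCochain (ZMod 2) ClassicalSteenrod}
    (hy : y ∈ homogeneous classicalBase classicalGrading p) :
    extend y ∈ homogeneous motivicBase motivicGrading (chowDeg p) := by
  rw [mem_homogeneous_iff] at hy ⊢
  exact ⟨fun l hl => extend_eq_zero fun m hm => hy.1 m (by rwa [hm]), isMultilinear_extend hy.2.1,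
    lowers_extend hy.2.1 hy.2.2⟩

theorem reduces_extend (y : BarCochain (ZMod 2) ClassicalSteenrod) (hy : IsMultilinear y) :
    Reduces (extend y) y := by
  intro l
  induction l generalizing y with
  | nil => exact coeff_C_zero
  | cons a l ih =>
    rw [extend_cons_eq_extendHead hy, List.map_cons, red_apply]
    generalize polyRed a = q
    induction q using Polynomial.induction_on' with
    | add q q' hq hq' => rw [map_add, coeff_add, hq, hq', coeff_add, hy.cons_add]
    | monomial j b =>
      rw [extendHead_monomial, mul_coeff_zero, coeff_X_pow, coeff_monomial]
      by_cases hj : j = 0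
      · rw [if_pos hj.symm, if_pos hj, one_mul]
        exact ih (y.shift b) (hy.shift b)
      · rw [if_neg (Ne.symm hj), if_neg hj, zero_mul]
        have := hy.cons_smul 0 0 (l.map red)
        rw [zero_smul, zero_mul] at this
        exact this.symm

end Steenrod

/-! ### The comparison of the cohomology rings -/

namespace Steenrod
open SteenrodAlg BarCochain ExtRing

theorem homogeneous_le_total {k H ι : Type*} [CommRing k] [Ring H] [Bialgebra k H] [AddCommGroup ι]
    (M : ι → AddSubgroup k) (A : ι → AddSubgroup H) [SetLike.GradedMonoid M] {p : ℤ × ι}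
    {x : BarCochain k H} (hx : x ∈ homogeneous M A p) : x ∈ total M A :=
  AddSubgroup.mem_iSup_of_mem (S := homogeneous M A) p hx

theorem total_induction {k H ι : Type*} [CommRing k] [Ring H] [Bialgebra k H] [AddCommGroup ι]
    {M : ι → AddSubgroup k} {A : ι → AddSubgroup H} [SetLike.GradedMonoid M]
    {P : BarCochain k H → Prop} (hom : ∀ p, ∀ x ∈ homogeneous M A p, P x)
    (zero : P 0) (add : ∀ x y, P x → P y → P (x + y)) {x : BarCochain k H} (hx : x ∈ total M A) : P x :=
  AddSubgroup.iSup_induction (homogeneous M A) (C := P) hx hom zero add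

theorem cochainPart_le_total {S : Set (ℤ × (ℤ × ℤ))} {x : BarCochain M2 MotivicSteenrod}
    (hx : x ∈ cochainPart S) : x ∈ total motivicBase motivicGrading :=
  cochainPart_induction (P := (· ∈ total motivicBase motivicGrading))
    (fun _ _ _ hx => homogeneous_le_total _ _ hx) (zero_mem _) (fun _ _ => add_mem) hx

theorem isMultilinear_of_mem_total {y : BarCochain (ZMod 2) ClassicalSteenrod}
    (hy : y ∈ total classicalBase classicalGrading) : IsMultilinear y :=
  total_induction (fun _ _ hx => isMultilinear_of_mem_homogeneous _ _ hx) .zero (fun _ _ => .add) hy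

theorem extend_mem_cochainPart {y : BarCochain (ZMod 2) ClassicalSteenrod}
    (hy : y ∈ total classicalBase classicalGrading) : extend y ∈ cochainPart chowZeroDegrees :=
  total_induction (P := fun y => extend y ∈ cochainPart chowZeroDegrees)
    (fun p _ hy => mem_cochainPart (chowDeg_mem p) (extend_mem_homogeneous hy))
    ((funext extend_zero : extend 0 = 0) ▸ zero_mem _)
    (fun x y hx hy => (funext (extend_add x y) : extend (x + y) = extend x + extend y) ▸ add_mem hx hy) hy

theorem reduces_extend_of_mem_total {y : BarCochain (ZMod 2) ClassicalSteenrod}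
    (hy : y ∈ total classicalBase classicalGrading) : Reduces (extend y) y :=
  reduces_extend y (isMultilinear_of_mem_total hy)

theorem exists_reduces_of_mem_cochainPart {x : BarCochain M2 MotivicSteenrod}
    (hx : x ∈ cochainPart chowZeroDegrees) :
    ∃ y ∈ total classicalBase classicalGrading, Reduces x y := by
  refine cochainPart_induction (P := fun x => ∃ y ∈ total classicalBase classicalGrading, Reduces x y)
    ?_ ⟨0, zero_mem _, .zero⟩ ?_ hx
  · intro p hp x hx
    obtain ⟨q, rfl⟩ := exists_chowDeg_eq hp
    exact ⟨reduction x, homogeneous_le_total _ _ (reduction_mem_homogeneous hx),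
      reduces_reduction (mem_cochainPart hp hx)⟩
  · rintro x x' ⟨y, hy, h⟩ ⟨y', hy', h'⟩
    exact ⟨y + y', add_mem hy hy', h.add h'⟩

theorem add_one_mem_chowZeroDegrees (p : ℤ × (ℤ × ℤ)) :
    p + (1, 0) ∈ (chowZeroDegrees : Set (ℤ × (ℤ × ℤ))) ↔ p ∈ (chowZeroDegrees : Set (ℤ × (ℤ × ℤ))) := by
  change (p + (1, 0)).2.1 - 2 * (p + (1, 0)).2.2 = 0 ↔ p.2.1 - 2 * p.2.2 = 0
  simp

theorem d_mem_chowZero {x : BarCochain M2 MotivicSteenrod} (hx : x ∈ cochainPart chowZeroDegrees) :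
    d x ∈ cochainPart chowZeroDegrees :=
  d_mem_cochainPart (fun p hp => (add_one_mem_chowZeroDegrees p).2 hp) hx

theorem d_extend {y z : BarCochain (ZMod 2) ClassicalSteenrod}
    (hy : y ∈ total classicalBase classicalGrading) (hz : z ∈ total classicalBase classicalGrading)
    (h : d y = z) : d (extend y) = extend z :=
  Reduces.left_unique (d_mem_chowZero (extend_mem_cochainPart hy)) (extend_mem_cochainPart hz)
    (h ▸ (reduces_extend_of_mem_total hy).d) (reduces_extend_of_mem_total hz)

/-- `extend` as a homomorphism between the rings of cocycles. -/
noncomputable def extendCocycle :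
    cocycles classicalBase classicalGrading →+* cocycles motivicBase motivicGrading where
  toFun z := ⟨extend z, cochainPart_le_total (extend_mem_cochainPart z.2.1), by
    rw [d_extend z.2.1 (zero_mem _) z.2.2]
    exact funext extend_zero⟩
  map_zero' := Subtype.ext (funext extend_zero)
  map_add' x y := Subtype.ext (funext (extend_add x y))
  map_one' := Subtype.ext (Reduces.left_unique (extend_mem_cochainPart (one_mem _))
    (mem_cochainPart chowZeroDegrees.zero_mem (one_mem_homogeneous _ _))
    (reduces_extend_of_mem_total (one_mem _)) .one)
  map_mul' x y := Subtype.ext (Reduces.left_unique (extend_mem_cochainPart (mul_mem x.2.1 y.2.1))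
    (mul_mem_cochainPart _ (extend_mem_cochainPart x.2.1) (extend_mem_cochainPart y.2.1))
    (reduces_extend_of_mem_total (mul_mem x.2.1 y.2.1))
    ((reduces_extend_of_mem_total x.2.1).mul (reduces_extend_of_mem_total y.2.1)))

theorem coe_extendCocycle (z : cocycles classicalBase classicalGrading) :
    (extendCocycle z : BarCochain M2 MotivicSteenrod) = extend z := rfl

/-- A reduction of a cocycle in Chow degree zero is a cocycle, and extends to the given one. -/
theorem exists_extendCocycle_eq {z : cocycles motivicBase motivicGrading}
    (hz : (z : BarCochain M2 MotivicSteenrod) ∈ cochainPart chowZeroDegrees)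
    {y : BarCochain (ZMod 2) ClassicalSteenrod} (hy : y ∈ total classicalBase classicalGrading)
    (h : Reduces z y) : ∃ z' : cocycles classicalBase classicalGrading,
      (z' : BarCochain (ZMod 2) ClassicalSteenrod) = y ∧ extendCocycle z' = z := by
  have hd : Reduces 0 (d y) := z.2.2 ▸ h.d
  exact ⟨⟨y, hy, hd.right_unique .zero⟩, rfl, Subtype.ext (Reduces.left_unique
    (extend_mem_cochainPart hy) hz (reduces_extend_of_mem_total hy) h)⟩

theorem exists_homogeneous_extendCocycle_eq {p : ℤ × ℤ} {z : cocycles motivicBase motivicGrading}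
    (hz : (z : BarCochain M2 MotivicSteenrod) ∈ homogeneous motivicBase motivicGrading (chowDeg p)) :
    ∃ z' : cocycles classicalBase classicalGrading,
      (z' : BarCochain (ZMod 2) ClassicalSteenrod) = reduction z ∧ extendCocycle z' = z :=
  exists_extendCocycle_eq (mem_cochainPart (chowDeg_mem p) hz)
    (homogeneous_le_total _ _ (reduction_mem_homogeneous hz))
    (reduces_reduction (mem_cochainPart (chowDeg_mem p) hz))

/-- The homomorphism of cohomology rings induced by `extend`. -/
noncomputable def extMap : ExtCl →+* ExtMot :=
  Ideal.Quotient.lift _ ((cls motivicBase motivicGrading).comp extendCocycle) (by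
    rintro z ⟨x, hx, h⟩
    exact Ideal.Quotient.eq_zero_iff_mem.2 ⟨extend x, cochainPart_le_total (extend_mem_cochainPart hx),
      d_extend hx z.2.1 h⟩)

/-- A coboundary in Chow degree zero is the coboundary of a cochain in Chow degree zero: the differential
preserves the Chow degree, so the part of a primitive outside Chow degree zero is a cocycle, and may be
dropped. -/
theorem exists_primitive {x : BarCochain M2 MotivicSteenrod} (hx : x ∈ cochainPart chowZeroDegrees)
    {u : BarCochain M2 MotivicSteenrod} (hu : u ∈ total motivicBase motivicGrading) (h : d u = x) :
    ∃ v ∈ cochainPart chowZeroDegrees, d v = x := by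
  obtain ⟨v, hv, w, hw, rfl⟩ : ∃ v ∈ cochainPart chowZeroDegrees,
      ∃ w ∈ cochainPart (chowZeroDegrees : Set (ℤ × (ℤ × ℤ)))ᶜ, u = v + w := by
    refine total_induction (P := fun u => ∃ v ∈ cochainPart chowZeroDegrees,
      ∃ w ∈ cochainPart (chowZeroDegrees : Set (ℤ × (ℤ × ℤ)))ᶜ, u = v + w) ?_ ?_ ?_ hu
    · intro p u hu
      by_cases hp : p ∈ (chowZeroDegrees : Set (ℤ × (ℤ × ℤ)))
      · exact ⟨u, mem_cochainPart hp hu, 0, zero_mem _, (add_zero u).symm⟩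
      · exact ⟨0, zero_mem _, u, mem_cochainPart hp hu, (zero_add u).symm⟩
    · exact ⟨0, zero_mem _, 0, zero_mem _, (add_zero 0).symm⟩
    · rintro _ _ ⟨v, hv, w, hw, rfl⟩ ⟨v', hv', w', hw', rfl⟩
      exact ⟨v + v', add_mem hv hv', w + w', add_mem hw hw', add_add_add_comm _ _ _ _⟩
  refine ⟨v, hv, ?_⟩
  rw [d_add] at h
  -- The cochain `d w = x - d v` has only components in Chow degree zero, and only components outside it.
  have h1 : d w = x - d v := by rw [← h, add_sub_cancel_left]
  have h2 : d w = 0 := eq_zero_of_mem_cochainPart_of_disjoint disjoint_compl_right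
    (h1 ▸ sub_mem hx (d_mem_chowZero hv))
    (d_mem_cochainPart (S := (chowZeroDegrees : Set (ℤ × (ℤ × ℤ)))ᶜ)
      (fun p hp h => hp ((add_one_mem_chowZeroDegrees p).1 h)) hw)
  rw [← h, h2, add_zero]

theorem extMap_injective : Function.Injective extMap := by
  rw [injective_iff_map_eq_zero]
  intro x hx
  obtain ⟨z, rfl⟩ := Ideal.Quotient.mk_surjective x
  obtain ⟨u, hu, h⟩ := Ideal.Quotient.eq_zero_iff_mem.1 hx
  obtain ⟨v, hv, h⟩ := exists_primitive (extend_mem_cochainPart z.2.1) hu h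
  obtain ⟨y, hy, hvy⟩ := exists_reduces_of_mem_cochainPart hv
  exact Ideal.Quotient.eq_zero_iff_mem.2
    ⟨y, hy, (h ▸ hvy.d).right_unique (reduces_extend_of_mem_total z.2.1)⟩

theorem exists_finsupp_of_mem_cochainPart {S : Set (ℤ × (ℤ × ℤ))} {x : BarCochain M2 MotivicSteenrod}
    (hx : x ∈ cochainPart S) : ∃ v : ℤ × (ℤ × ℤ) →₀ BarCochain M2 MotivicSteenrod,
      (∀ p, v p ∈ homogeneous motivicBase motivicGrading p) ∧ (∀ p ∈ v.support, p ∈ S) ∧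
        x = v.sum fun _ a => a := by
  classical
  refine cochainPart_induction (P := fun x => ∃ v : ℤ × (ℤ × ℤ) →₀ BarCochain M2 MotivicSteenrod,
      (∀ p, v p ∈ homogeneous motivicBase motivicGrading p) ∧ (∀ p ∈ v.support, p ∈ S) ∧
        x = v.sum fun _ a => a) ?_ ?_ ?_ hx
  · intro p hp x hx
    refine ⟨Finsupp.single p x, fun q => ?_, fun q hq => ?_,
      (Finsupp.sum_single_index (h := fun _ a => a) rfl).symm⟩
    · by_cases hpq : p = q
      · subst hpq
        rwa [Finsupp.single_eq_same]
      · rw [Finsupp.single_eq_of_ne (Ne.symm hpq)]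
        exact zero_mem _
    · rw [Finset.mem_singleton.1 (Finsupp.support_single_subset hq)]
      exact hp
  · exact ⟨0, fun _ => zero_mem _, fun _ h => absurd rfl (Finsupp.mem_support_iff.1 h),
      Finsupp.sum_zero_index.symm⟩
  · rintro _ _ ⟨v, h1, h2, rfl⟩ ⟨v', h1', h2', rfl⟩
    exact ⟨v + v', fun p => add_mem (h1 p) (h1' p),
      fun p hp => (Finset.mem_union.1 (Finsupp.support_add hp)).elim (h2 p) (h2' p),
      (Finsupp.sum_add_index' (fun _ => rfl) fun _ _ _ => rfl).symm⟩

theorem d_sum {α : Type*} (s : Finset α) (v : α → BarCochain M2 MotivicSteenrod) :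
    d (∑ p ∈ s, v p) = ∑ p ∈ s, d (v p) := by
  classical
  induction s using Finset.induction_on with
  | empty => exact d_zero
  | insert p s hp ih => rw [Finset.sum_insert hp, Finset.sum_insert hp, d_add, ih]

/-- The homogeneous components of a cocycle are cocycles. -/
theorem d_component_eq_zero {s : Finset (ℤ × (ℤ × ℤ))}
    {v : ℤ × (ℤ × ℤ) → BarCochain M2 MotivicSteenrod}
    (hv : ∀ p, v p ∈ homogeneous motivicBase motivicGrading p) (h : d (∑ p ∈ s, v p) = 0)
    {p : ℤ × (ℤ × ℤ)} (hp : p ∈ s) : d (v p) = 0 := by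
  have hdv : ∀ q, d (v q) ∈ homogeneous motivicBase motivicGrading (q + (1, 0)) := fun q =>
    d_mem_homogeneous counit_mem_motivicBase (hv q)
  rw [d_sum, ← Finset.add_sum_erase _ (fun q => d (v q)) hp] at h
  have hsum : ∑ q ∈ s.erase p, d (v q) ∈ cochainPart ({p + (1, 0)}ᶜ : Set (ℤ × (ℤ × ℤ))) := by
    refine sum_mem fun q hq => mem_cochainPart ?_ (hdv q)
    rw [Set.mem_compl_iff, Set.mem_singleton_iff, add_left_inj]
    exact (Finset.mem_erase.1 hq).1
  refine eq_zero_of_mem_cochainPart_of_disjoint (S := {p + (1, 0)}) (T := {p + (1, 0)}ᶜ)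
    disjoint_compl_right (mem_cochainPart (Set.mem_singleton _) (hdv p)) ?_
  rw [eq_neg_of_add_eq_zero_left h]
  exact neg_mem hsum

theorem cls_mem_chowZero {z : cocycles motivicBase motivicGrading}
    (hz : (z : BarCochain M2 MotivicSteenrod) ∈ cochainPart chowZeroDegrees) :
    cls _ _ z ∈ ExtMot.chowZero := by
  obtain ⟨v, h1, h2, h3⟩ := exists_finsupp_of_mem_cochainPart hz
  have h3' : (z : BarCochain M2 MotivicSteenrod) = ∑ p ∈ v.support, v p := h3
  have hd : d (∑ p ∈ v.support, v p) = 0 := by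
    rw [← h3']
    exact z.2.2
  let c : v.support → cocycles motivicBase motivicGrading := fun p =>
    ⟨v p, homogeneous_le_total _ _ (h1 p), d_component_eq_zero h1 hd p.2⟩
  have hc : z = ∑ p, c p := by
    refine Subtype.ext ?_
    rw [h3', AddSubmonoidClass.coe_finsetSum]
    exact (Finset.sum_coe_sort v.support v).symm
  rw [hc, map_sum]
  refine sum_mem fun p _ => ?_
  have h4 : cls _ _ (c p) ∈ deg motivicBase motivicGrading p.1 := ⟨c p, h1 p, rfl⟩
  exact AddSubgroup.mem_iSup_of_mem
    (S := fun p : chowZeroDegrees => deg motivicBase motivicGrading p) ⟨p, h2 p p.2⟩ h4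

theorem extMap_mem_chowZero (x : ExtCl) : extMap x ∈ ExtMot.chowZero := by
  obtain ⟨z, rfl⟩ := Ideal.Quotient.mk_surjective x
  exact cls_mem_chowZero (extend_mem_cochainPart z.2.1)

theorem extMap_mem_deg_iff (p : ℤ × ℤ) (x : ExtCl) :
    x ∈ deg classicalBase classicalGrading p ↔
      extMap x ∈ deg motivicBase motivicGrading (chowDeg p) := by
  constructor
  · rintro ⟨z, hz, rfl⟩
    exact ⟨extendCocycle z, extend_mem_homogeneous hz, rfl⟩
  · rintro ⟨z, hz, h⟩
    obtain ⟨z', h1, rfl⟩ := exists_homogeneous_extendCocycle_eq hz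
    refine ⟨z', ?_, extMap_injective h⟩
    change (z' : BarCochain (ZMod 2) ClassicalSteenrod) ∈ homogeneous _ _ _
    rw [h1]
    exact reduction_mem_homogeneous hz

theorem exists_extMap_eq {y : ExtMot} (hy : y ∈ ExtMot.chowZero) : ∃ x, extMap x = y := by
  have h : (⨆ p : chowZeroDegrees, deg motivicBase motivicGrading p) ≤ extMap.toAddMonoidHom.range := by
    refine iSup_le ?_
    rintro ⟨p, hp⟩ _ ⟨z, hz, rfl⟩
    obtain ⟨q, rfl⟩ := exists_chowDeg_eq hp
    obtain ⟨z', -, rfl⟩ := exists_homogeneous_extendCocycle_eq hz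
    exact ⟨cls _ _ z', rfl⟩
  exact h hy

/-- The isomorphism onto the part in Chow degree zero. -/
noncomputable def chowEquiv : ExtCl ≃+* ExtMot.chowZero :=
  RingEquiv.ofBijective (extMap.codRestrict ExtMot.chowZero extMap_mem_chowZero)
    ⟨fun _ _ h => extMap_injective (congrArg Subtype.val h), fun y => by
      obtain ⟨x, hx⟩ := exists_extMap_eq y.2
      exact ⟨x, Subtype.ext hx⟩⟩

/-! ### Squaring operations and Massey products -/

/-- As `cup i (extend z) (extend z)` has Chow degree zero, it is determined by its reduction. -/
theorem extend_cup {p q : ℤ × ℤ} {z w : BarCochain (ZMod 2) ClassicalSteenrod} (i : ℕ)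
    (hz : z ∈ homogeneous classicalBase classicalGrading p)
    (hw : w ∈ homogeneous classicalBase classicalGrading q) (h : w = cup i z z) :
    extend w = cup i (extend z) (extend z) := by
  have hzm := isMultilinear_of_mem_homogeneous _ _ hz
  have hzr := reduces_extend z hzm
  -- A component of `cup i` is homogeneous, whatever `i` is, and homogeneous cochains of Chow degree zero can be
  -- compared by their reductions.
  have key : ∀ N, trunc N (extend w) = trunc N (cup i (extend z) (extend z)) := by
    intro N
    have hE := extend_mem_homogeneous hz
    refine Reduces.left_unique (y := trunc N w)
      (mem_cochainPart ?_ (trunc_mem_homogeneous (extend_mem_homogeneous hw) N))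
      (mem_cochainPart ?_ (trunc_cup_mem_homogeneous counit_mem_motivicBase comul_mem_tensorGrading
        hE hE N i)) ((reduces_extend w (isMultilinear_of_mem_homogeneous _ _ hw)).trunc N) ?_
    · exact sub_self (2 * q.2)
    · change 2 * p.2 + 2 * p.2 - 2 * (p.2 + p.2) = 0
      ring
    · rw [h]
      exact (hzr.cup hzm hzm hzr i).trunc N
  funext l
  exact (trunc_apply_of_eq rfl).symm.trans ((congrFun (key l.length) l).trans (trunc_apply_of_eq rfl))

theorem image_squaring (f r : ℕ) (e : ℤ) (x : ExtCl) :
    extMap '' squaring classicalBase classicalGrading f r e x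
      = squaring motivicBase motivicGrading f r (2 * e, e) (extMap x) := by
  have hdeg : ((f : ℤ) + (r : ℤ), ((2 * e, e) + (2 * e, e) : ℤ × ℤ))
      = chowDeg ((f : ℤ) + (r : ℤ), e + e) := by
    rw [chowDeg_apply, mul_add]
    rfl
  apply Set.Subset.antisymm
  · rintro _ ⟨_, ⟨z, w, hz, rfl, hw, h, rfl⟩, rfl⟩
    refine ⟨extendCocycle z, extendCocycle w, extend_mem_homogeneous hz, rfl, ?_,
      extend_cup _ hz hw h, rfl⟩
    rw [hdeg]
    exact extend_mem_homogeneous hw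
  · rintro _ ⟨z, w, hz, hx, hw, h, rfl⟩
    rw [hdeg] at hw
    obtain ⟨z', hz', rfl⟩ := exists_homogeneous_extendCocycle_eq (p := ((f : ℤ), e)) hz
    obtain ⟨w', hw', rfl⟩ := exists_homogeneous_extendCocycle_eq hw
    have hz2 : (z' : BarCochain (ZMod 2) ClassicalSteenrod) ∈ homogeneous _ _ _ :=
      hz' ▸ reduction_mem_homogeneous (p := ((f : ℤ), e)) hz
    have hm := isMultilinear_of_mem_homogeneous _ _ hz2
    have hzr := reduces_extend_of_mem_total z'.2.1
    refine ⟨_, ⟨z', w', hz2, extMap_injective hx, hw' ▸ reduction_mem_homogeneous hw, ?_, rfl⟩, rfl⟩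
    refine (reduces_extend_of_mem_total w'.2.1).right_unique ?_
    rw [← coe_extendCocycle w', h]
    exact hzr.cup hm hm hzr (f - r)

theorem image_massey {n : ℕ} (hn : 3 ≤ n) (p : ℕ → ℤ × ℤ) (x : ℕ → ExtCl) :
    extMap '' massey classicalBase classicalGrading n p x
      = massey motivicBase motivicGrading n (fun i => chowDeg (p i)) (fun i => extMap (x i)) := by
  have hdeg : ∀ i j : ℕ, (∑ m ∈ Finset.Ico i j, chowDeg (p m)) - ((j : ℤ) - i - 1, 0)
      = chowDeg ((∑ m ∈ Finset.Ico i j, p m) - ((j : ℤ) - i - 1, 0)) := by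
    intro i j
    rw [map_sub, map_sum]
    rfl
  apply Set.Subset.antisymm
  · rintro _ ⟨_, ⟨a, ha, hx, w, hw, rfl⟩, rfl⟩
    have hmem : ∀ i j, i < j → j ≤ n → (i, j) ≠ (0, n) → a i j ∈ total classicalBase classicalGrading :=
      fun i j hij hj hne => homogeneous_le_total _ _ (ha i j hij hj hne).1
    have hsum : ∀ i j, i < j → j ≤ n →
        Reduces (∑ m ∈ Finset.Ioo i j, extend (a i m) * extend (a m j))
          (∑ m ∈ Finset.Ioo i j, a i m * a m j) ∧
        ∑ m ∈ Finset.Ioo i j, extend (a i m) * extend (a m j) ∈ cochainPart chowZeroDegrees := by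
      intro i j hij hj
      have h : ∀ m ∈ Finset.Ioo i j, a i m ∈ total classicalBase classicalGrading ∧
          a m j ∈ total classicalBase classicalGrading := by
        intro m hm
        rw [Finset.mem_Ioo] at hm
        exact ⟨hmem i m hm.1 (by omega) fun h => by simp only [Prod.mk.injEq] at h; omega,
          hmem m j hm.2 hj fun h => by simp only [Prod.mk.injEq] at h; omega⟩
      exact ⟨.sum fun m hm => (reduces_extend_of_mem_total (h m hm).1).mul
          (reduces_extend_of_mem_total (h m hm).2),
        sum_mem fun m hm => mul_mem_cochainPart _ (extend_mem_cochainPart (h m hm).1)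
          (extend_mem_cochainPart (h m hm).2)⟩
    refine ⟨fun i j => extend (a i j), fun i j hij hj hne => ⟨?_, ?_⟩, fun i hi => ?_,
      extendCocycle w, ?_, rfl⟩
    · rw [hdeg]
      exact extend_mem_homogeneous (ha i j hij hj hne).1
    · refine Reduces.left_unique (d_mem_chowZero (extend_mem_cochainPart (hmem i j hij hj hne)))
        (hsum i j hij hj).2 (reduces_extend_of_mem_total (hmem i j hij hj hne)).d ?_
      rw [(ha i j hij hj hne).2]
      exact (hsum i j hij hj).1
    · obtain ⟨z, hz, h⟩ := hx i hi
      refine ⟨extendCocycle z, ?_, ?_⟩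
      · rw [coe_extendCocycle, hz]
      · exact congrArg extMap h
    · refine Reduces.left_unique (extend_mem_cochainPart w.2.1) (hsum 0 n (by omega) le_rfl).2
        (reduces_extend_of_mem_total w.2.1) ?_
      rw [hw]
      exact (hsum 0 n (by omega) le_rfl).1
  · rintro _ ⟨a, ha, hx, w, hw, rfl⟩
    have hhom : ∀ i j, i < j → j ≤ n → (i, j) ≠ (0, n) → a i j ∈ homogeneous motivicBase motivicGrading
        (chowDeg ((∑ m ∈ Finset.Ico i j, p m) - ((j : ℤ) - i - 1, 0))) := fun i j hij hj hne => by
      rw [← hdeg]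
      exact (ha i j hij hj hne).1
    have hmem : ∀ i j, i < j → j ≤ n → (i, j) ≠ (0, n) → a i j ∈ cochainPart chowZeroDegrees :=
      fun i j hij hj hne => mem_cochainPart (chowDeg_mem _) (hhom i j hij hj hne)
    have hsum : ∀ i j, i < j → j ≤ n →
        Reduces (∑ m ∈ Finset.Ioo i j, a i m * a m j)
          (∑ m ∈ Finset.Ioo i j, reduction (a i m) * reduction (a m j)) ∧
        ∑ m ∈ Finset.Ioo i j, a i m * a m j ∈ cochainPart chowZeroDegrees ∧
        ∑ m ∈ Finset.Ioo i j, reduction (a i m) * reduction (a m j)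
          ∈ total classicalBase classicalGrading := by
      intro i j hij hj
      have h : ∀ m ∈ Finset.Ioo i j, (i < m ∧ m ≤ n ∧ (i, m) ≠ (0, n)) ∧
          m < j ∧ j ≤ n ∧ (m, j) ≠ (0, n) := by
        intro m hm
        rw [Finset.mem_Ioo] at hm
        exact ⟨⟨hm.1, by omega, fun h => by simp only [Prod.mk.injEq] at h; omega⟩,
          hm.2, hj, fun h => by simp only [Prod.mk.injEq] at h; omega⟩
      refine ⟨.sum fun m hm => ?_, sum_mem fun m hm => ?_, sum_mem fun m hm => ?_⟩ <;>
        obtain ⟨⟨h1, h2, h3⟩, h4, h5, h6⟩ := h m hm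
      · exact (reduces_reduction (hmem _ _ h1 h2 h3)).mul (reduces_reduction (hmem _ _ h4 h5 h6))
      · exact mul_mem_cochainPart _ (hmem _ _ h1 h2 h3) (hmem _ _ h4 h5 h6)
      · exact mul_mem (homogeneous_le_total _ _ (reduction_mem_homogeneous (hhom _ _ h1 h2 h3)))
          (homogeneous_le_total _ _ (reduction_mem_homogeneous (hhom _ _ h4 h5 h6)))
    obtain ⟨h1, h2, h3⟩ := hsum 0 n (by omega) le_rfl
    rw [← hw] at h1 h2
    obtain ⟨w', hw', rfl⟩ := exists_extendCocycle_eq h2 h3 h1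
    refine ⟨_, ⟨fun i j => reduction (a i j), fun i j hij hj hne => ⟨?_, ?_⟩, fun i hi => ?_,
      w', hw', rfl⟩, rfl⟩
    · exact reduction_mem_homogeneous (hhom i j hij hj hne)
    · refine (reduces_reduction (hmem i j hij hj hne)).d.right_unique ?_
      rw [(ha i j hij hj hne).2]
      exact (hsum i j hij hj).1
    · obtain ⟨z, hz, h⟩ := hx i hi
      have hh := hhom i (i + 1) (Nat.lt_succ_self i) hi fun h => by
        simp only [Prod.mk.injEq] at h; omega
      rw [← hz] at hh
      obtain ⟨z', hz', rfl⟩ := exists_homogeneous_extendCocycle_eq hh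
      exact ⟨z', by rw [hz', hz], extMap_injective h⟩

end Steenrod

theorem mainTheorem10 :
    ∃ φ : ExtCl ≃+* ExtMot.chowZero,
      (∀ (s f : ℤ) (x : ExtCl),
        x ∈ ExtCl.deg s f ↔ (φ x : ExtMot) ∈ ExtMot.deg (2 * s + f) f (s + f)) ∧
      (∀ (s : ℤ) (f r : ℕ), r ≤ f → ∀ x ∈ ExtCl.deg s f,
        (fun y => (φ y : ExtMot)) '' ExtCl.squaring s f r x
          = ExtMot.squaring (2 * s + f) f (s + f) r (φ x)) ∧
      (∀ n : ℕ, 3 ≤ n → ∀ (s f : ℕ → ℤ) (x : ℕ → ExtCl), (∀ i < n, x i ∈ ExtCl.deg (s i) (f i)) →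
        (fun y => (φ y : ExtMot)) '' ExtCl.massey n s f x
          = ExtMot.massey n (fun i => 2 * s i + f i) f (fun i => s i + f i)
              (fun i => (φ (x i) : ExtMot))) := by
  have hstem : ∀ s f : ℤ, 2 * s + f + f = 2 * (s + f) := fun s f => by ring
  refine ⟨Steenrod.chowEquiv, fun s f x => ?_, fun s f r _ x _ => ?_, fun n hn s f x _ => ?_⟩
  · rw [ExtMot.deg, hstem]
    exact Steenrod.extMap_mem_deg_iff (f, s + f) x
  · rw [ExtMot.squaring, hstem]
    exact Steenrod.image_squaring f r (s + f) x
  · simp only [ExtMot.massey, hstem]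
    exact Steenrod.image_massey hn (fun i => (f i, s i + f i)) x
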